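/- Let $m,n$ be positive integers, $K$ a field and $Q=(q_1,\dots,q_m)\in K^m$. The degenerate cyclotomic Hecke algebra $H=H_{m,n}(Q)$ is the unital associative $K$-algebra with generators $t,t_1,\dots,t_{n-1}$ and relations $(t-q_1)\cdots(t-q_m)=0$; $t(t_1tt_1+t_1)=(t_1tt_1+t_1)t$; $tt_i=t_it$ for $i\ge 2$; $t_i^2=1$; $t_it_{i+1}t_i=t_{i+1}t_it_{i+1}$; $t_it_j=t_jt_i$ for $|i-j|>1$. Its Jucys–Murphy elements are $J_1=t$ and $J_{i+1}=t_iJ_it_i+t_i$. Assume that $H$ is generic, that is, $$n!\prod_{1\le i<j\le m}\ \prod_{|d|\le n}(d+q_i-q_j)\ne 0\quad\text{in }K,$$ where $d$ runs over integers. Let $\boldsymbol\lambda=(\lambda^1;\dots;\lambda^m)$ be an $m$-multipartition of $n$, with nodes $(a,b,c)$ (row $a$, column $b$, component $c$), and let $\mathfrak t$ be a standard $\boldsymbol\lambda$-tableau. Put $\mathrm{res}_{\mathfrak t}(k)=b-a+q_c$ if $k$ lies in the node $(a,b,c)$ of $\mathfrak t$. Write $\lambda_i$ for the $i$-th part of a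 partition $\lambda$ and $\hat\mu_j$ for the $j$-th part of the conjugate of a partition $\mu$, put $h^{\lambda,\mu}_{i,j}=\lambda_i-i+\hat\mu_j-j+1$, and define $$\Theta_{\boldsymbol\lambda}(Q)=\prod_{s=1}^m\ \prod_{(i,j)\in\lambda^s}\ \prod_{u=1}^m\frac1{h^{\lambda^s,\lambda^u}_{i,j}+q_s-q_u}.$$ Let $f(z)=(z-q_1)\cdots(z-q_m)$, $t(z)=\dfrac{f(z)}{z-t}$, $t_k(x,y)=\dfrac1{x-y}+t_k$, and define rational functions with values in $H$ by $\phi_1(z)=t(z)$, $$\phi_{k+1}(z_1,\dots,z_k;z)=t_k(z,z_k)\,\phi_k(z_1,\dots,z_{k-1};z)\,t_k,$$ $$\Phi(z_1,\dots,z_n)=\phi_n(z_1,\dots,z_{n-1};z_n)\,\phi_{n-1}(z_1,\dots,z_{n-2};z_{n-1})\cdots\phi_1(z_1).$$ **Theorem.** There is exactly one primitive idempotent $E_{\mathfrak t}$ of $H$ corresponding to $\mathfrak t$, that is, with $J_kE_{\mathfrak t}=E_{\mathfrak t}J_k=\mathrm{res}_{\mathfrak t}(k)E_{\mathfrak t}$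 for $k=1,\dots,n$. It is obtained by the consecutive evaluations $$E_{\mathfrak t}=\Theta_{\boldsymbol\lambda}(Q)\,\Phi(z_1,\dots,z_n)\Big|_{z_1=\mathrm{res}_{\mathfrak t}(1)}\cdots\Big|_{z_{n-1}=\mathrm{res}_{\mathfrak t}(n-1)}\Big|_{z_n=\mathrm{res}_{\mathfrak t}(n)},$$ made in this order, first in $z_1$ and last in $z_n$. At each step the rational function obtained so far is regular at the value substituted. -/

import Mathlib

open scoped TensorProduct

namespace DegenerateCyclotomic

/-! ### The degenerate cyclotomic Hecke algebra -/

/-- The generators `t, t_1, …, t_{n-1}`; with indices starting at `0`, `s k` is `t_{k+1}`. -/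
inductive Gen (n : ℕ) : Type
  | t : Gen n
  | s (k : ℕ) (h : k + 1 < n) : Gen n

section Algebra

variable {K : Type*} [Field K] {m : ℕ}

open FreeAlgebra in
/-- The defining relations of the degenerate cyclotomic Hecke algebra. -/
inductive Rel (n : ℕ) (q : Fin m → K) :
    FreeAlgebra K (Gen n) → FreeAlgebra K (Gen n) → Prop
  | cyclotomic :
      Rel n q (List.ofFn fun c : Fin m => ι K Gen.t - algebraMap K _ (q c)).prod 0
  | reflection (h : 0 + 1 < n) :
      Rel n q
        (ι K Gen.t * (ι K (Gen.s 0 h) * ι K Gen.t * ι K (Gen.s 0 h) + ι K (Gen.s 0 h)))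
        ((ι K (Gen.s 0 h) * ι K Gen.t * ι K (Gen.s 0 h) + ι K (Gen.s 0 h)) * ι K Gen.t)
  | comm_t (k : ℕ) (hk : 1 ≤ k) (h : k + 1 < n) :
      Rel n q (ι K Gen.t * ι K (Gen.s k h)) (ι K (Gen.s k h) * ι K Gen.t)
  | sq (k : ℕ) (h : k + 1 < n) :
      Rel n q (ι K (Gen.s k h) * ι K (Gen.s k h)) 1
  | braid (k : ℕ) (h : k + 1 < n) (h' : k + 1 + 1 < n) :
      Rel n q (ι K (Gen.s k h) * ι K (Gen.s (k + 1) h') * ι K (Gen.s k h))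
        (ι K (Gen.s (k + 1) h') * ι K (Gen.s k h) * ι K (Gen.s (k + 1) h'))
  | comm (k l : ℕ) (hkl : k + 1 < l) (hk : k + 1 < n) (hl : l + 1 < n) :
      Rel n q (ι K (Gen.s k hk) * ι K (Gen.s l hl)) (ι K (Gen.s l hl) * ι K (Gen.s k hk))

/-- The degenerate cyclotomic Hecke algebra `H_{m,n}(Q)` with parameters `q_1, …, q_m`. -/
abbrev Hecke (n : ℕ) (q : Fin m → K) : Type _ := RingQuot (Rel n q)

variable {n : ℕ}

/-- The generator `t`. -/
noncomputable def genT (n : ℕ) (q : Fin m → K) : Hecke n q :=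
  RingQuot.mkAlgHom K (Rel n q) (FreeAlgebra.ι K Gen.t)

/-- The generator `t_{k+1}`. -/
noncomputable def genS (q : Fin m → K) (k : ℕ) (h : k + 1 < n) : Hecke n q :=
  RingQuot.mkAlgHom K (Rel n q) (FreeAlgebra.ι K (Gen.s k h))

/-- The Jucys-Murphy elements: `jm q k _` is `J_{k+1}`, that is, `J_1 = t` and
`J_{i+1} = t_i J_i t_i + t_i`. -/
noncomputable def jm (q : Fin m → K) : (k : ℕ) → k < n → Hecke n q
  | 0, _ => genT n q
  | k + 1, h =>
      genS q k h * jm q k (Nat.lt_of_succ_lt h) * genS q k h + genS q k h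

/-- The element `P_H(Q) = n! ∏_{i<j} ∏_{|d| ≤ n} (d + q_i - q_j)`; the algebra is generic when
it does not vanish. -/
noncomputable def separation (n : ℕ) (q : Fin m → K) : K :=
  (n.factorial : K) *
    ∏ i : Fin m, ∏ j ∈ Finset.Ioi i, ∏ d ∈ Finset.Icc (-(n : ℤ)) (n : ℤ), ((d : K) + q i - q j)

end Algebra

/-! ### Multipartitions, standard tableaux, residues, generalized hook lengths -/

/-- An `m`-multipartition of `n`. -/
structure Multipartition (m n : ℕ) where
  parts : Fin m → YoungDiagram
  card_eq : ∑ c, (parts c).card = n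

/-- The nodes (row, column, component) of a multipartition; rows and columns start at `0`. -/
abbrev Multipartition.Node {m n : ℕ} (lam : Multipartition m n) : Type :=
  {x : ℕ × ℕ × Fin m // (x.1, x.2.1) ∈ lam.parts x.2.2}

/-- A standard tableau: a bijection from the nodes to the `n` entries which increases along the
rows and down the columns of each component. The entry `k : Fin n` stands for the number `k + 1`. -/
structure StandardTableau {m n : ℕ} (lam : Multipartition m n) where
  entry : lam.Node ≃ Fin n
  row_lt : ∀ (a b b' : ℕ) (c : Fin m) (h : (a, b) ∈ lam.parts c) (h' : (a, b') ∈ lam.parts c),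
    b < b' → entry ⟨(a, b, c), h⟩ < entry ⟨(a, b', c), h'⟩
  col_lt : ∀ (a a' b : ℕ) (c : Fin m) (h : (a, b) ∈ lam.parts c) (h' : (a', b) ∈ lam.parts c),
    a < a' → entry ⟨(a, b, c), h⟩ < entry ⟨(a', b, c), h'⟩

/-- The generalized hook length `h^{λ,μ}_{i,j} = λ_i - i + μ'_j - j + 1` (with `μ'` conjugate
to `μ`), written for rows and columns that start at `0`. -/
def genHook (lam mu : YoungDiagram) (i j : ℕ) : ℤ :=
  (lam.rowLen i : ℤ) - i + mu.colLen j - j - 1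

section Tableaux

variable {K : Type*} [Field K] {m n : ℕ}

/-- The residue `b - a + q_c` of the node `(a, b, c)` that contains the entry `k`. -/
def StandardTableau.res {lam : Multipartition m n} (T : StandardTableau lam) (q : Fin m → K)
    (k : Fin n) : K :=
  let x := (T.entry.symm k).1
  (x.2.1 : K) - (x.1 : K) + q x.2.2

/-- `Θ_λ(Q)`, the inverse of the product of the `h^{λ^s,λ^u}_{i,j} + q_s - q_u` over all `s`, `u`
and all nodes `(i, j)` of `λ^s`. -/
noncomputable def theta (q : Fin m → K) (lam : Multipartition m n) : K :=
  ∏ s : Fin m, ∏ x ∈ (lam.parts s).cells, ∏ u : Fin m,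
    ((genHook (lam.parts s) (lam.parts u) x.1 x.2 : K) + q s - q u)⁻¹

end Tableaux

/-- A primitive idempotent of a ring: a nonzero idempotent that is not the sum of two nonzero
orthogonal idempotents. -/
def IsPrimitiveIdempotent {A : Type*} [Ring A] (e : A) : Prop :=
  e ≠ 0 ∧ IsIdempotentElem e ∧
    ∀ x y : A, IsIdempotentElem x → IsIdempotentElem y → x * y = 0 → y * x = 0 → x + y = e →
      x = 0 ∨ y = 0

section Fusion

variable {K : Type*} [Field K] {m n : ℕ}

/-- `E` is a primitive idempotent corresponding to the standard tableau `T`: it is primitive and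
`J_k E = E J_k = res_T(k) E` for all `k`. -/
structure IsTableauIdempotent (q : Fin m → K) {lam : Multipartition m n}
    (T : StandardTableau lam) (E : Hecke n q) : Prop where
  primitive : IsPrimitiveIdempotent E
  jm_mul : ∀ k : Fin n, jm q k k.isLt * E = T.res q k • E
  mul_jm : ∀ k : Fin n, E * jm q k k.isLt = T.res q k • E

/-! ### Rational functions in `z_1, …, z_n` with values in the Hecke algebra -/

/-- The polynomial ring `K[z_1, …, z_n]`. -/
abbrev Pol (K : Type*) [Field K] (n : ℕ) : Type _ := MvPolynomial (Fin n) K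

/-- The field of rational functions `K(z_1, …, z_n)`. -/
abbrev RatFun (K : Type*) [Field K] (n : ℕ) : Type _ := FractionRing (Pol K n)

/-- Polynomials in `z_1, …, z_n` with coefficients in the Hecke algebra. -/
abbrev HPol (n : ℕ) (q : Fin m → K) : Type _ := Hecke n q ⊗[K] Pol K n

/-- Rational functions in `z_1, …, z_n` with values in the Hecke algebra. -/
abbrev HRat (n : ℕ) (q : Fin m → K) : Type _ := Hecke n q ⊗[K] RatFun K n

/-- An element of the Hecke algebra as a constant rational function. -/
noncomputable def const (q : Fin m → K) : Hecke n q →ₐ[K] HRat n q :=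
  Algebra.TensorProduct.includeLeft

/-- A scalar rational function as a rational function with values in the Hecke algebra. -/
noncomputable def scal (q : Fin m → K) : RatFun K n →ₐ[K] HRat n q :=
  Algebra.TensorProduct.includeRight

/-- The inclusion of polynomials into rational functions, with values in the Hecke algebra. -/
noncomputable def polToRat (q : Fin m → K) : HPol n q →ₐ[K] HRat n q :=
  Algebra.TensorProduct.map (AlgHom.id K (Hecke n q))
    (IsScalarTower.toAlgHom K (Pol K n) (RatFun K n))

/-- The variable `z_{k+1}` in `K(z_1, …, z_n)`. -/
noncomputable def var (K : Type*) [Field K] (k : Fin n) : RatFun K n :=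
  algebraMap (Pol K n) (RatFun K n) (MvPolynomial.X k)

/-- The substitution `z_{k+1} = a` in scalar polynomials. -/
noncomputable def subst (k : Fin n) (a : K) : Pol K n →ₐ[K] Pol K n :=
  MvPolynomial.aeval (Function.update MvPolynomial.X k (MvPolynomial.C a))

/-- The substitution `z_{k+1} = a` in polynomials with coefficients in the Hecke algebra. -/
noncomputable def hsubst (q : Fin m → K) (k : Fin n) (a : K) : HPol n q →ₐ[K] HPol n q :=
  Algebra.TensorProduct.map (AlgHom.id K (Hecke n q)) (subst k a)

/-- The rational function `F` is regular along `z_{k+1} = a` and its evaluation there is `G`: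
one can write `F = P / d` with a polynomial `P` with coefficients in the Hecke algebra and a
scalar polynomial `d` such that `d|_{z_{k+1} = a} ≠ 0`, and
`G = P|_{z_{k+1} = a} / d|_{z_{k+1} = a}`. -/
def EvaluatesTo (q : Fin m → K) (k : Fin n) (a : K) (F G : HRat n q) : Prop :=
  ∃ (P : HPol n q) (d : Pol K n), subst k a d ≠ 0 ∧
    scal q (algebraMap (Pol K n) (RatFun K n) d) * F = polToRat q P ∧
    scal q (algebraMap (Pol K n) (RatFun K n) (subst k a d)) * G = polToRat q (hsubst q k a P)

/-- `E = F|_{z_1 = a_1}|_{z_2 = a_2} ⋯ |_{z_n = a_n}`: the evaluations are made one after another,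
first at `z_1 = a_1`, last at `z_n = a_n`, each of them being possible. -/
def ConsecutiveEval (q : Fin m → K) (a : Fin n → K) (F : HRat n q) (E : Hecke n q) : Prop :=
  ∃ G : Fin (n + 1) → HRat n q, G 0 = F ∧
    (∀ k : Fin n, EvaluatesTo q k (a k) (G k.castSucc) (G k.succ)) ∧
    G (Fin.last n) = const q E

theorem polToRat_injective (q : Fin m → K) : Function.Injective (polToRat (n := n) q) := by
  have h := Module.Flat.lTensor_preserves_injective_linearMap (M := Hecke n q)
    (IsScalarTower.toAlgHom K (Pol K n) (RatFun K n)).toLinearMap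
    (IsFractionRing.injective (Pol K n) (RatFun K n))
  exact h

theorem scal_pol (q : Fin m → K) (d : Pol K n) :
    scal q (algebraMap (Pol K n) (RatFun K n) d) =
      polToRat q (Algebra.TensorProduct.includeRight d) := by
  simp [scal, polToRat]

/-- An evaluation, if it exists, is unique. -/
theorem EvaluatesTo.unique {q : Fin m → K} {k : Fin n} {a : K} {F G G' : HRat n q}
    (h : EvaluatesTo q k a F G) (h' : EvaluatesTo q k a F G') : G = G' := by
  obtain ⟨P, d, hd, hF, hG⟩ := h
  obtain ⟨P', d', hd', hF', hG'⟩ := h'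
  have key : (Algebra.TensorProduct.includeRight d' : HPol n q) * P =
      Algebra.TensorProduct.includeRight d * P' := by
    apply polToRat_injective q
    rw [map_mul, map_mul, ← scal_pol, ← scal_pol, ← hF, ← hF', ← mul_assoc, ← mul_assoc,
      ← map_mul (scal q), ← map_mul (scal q), mul_comm]
  have key2 := congrArg (polToRat q) (congrArg (hsubst q k a) key)
  have hs : ∀ e : Pol K n, hsubst q k a (Algebra.TensorProduct.includeRight e) =
      Algebra.TensorProduct.includeRight (subst k a e) := fun e => by simp [hsubst]
  rw [map_mul, map_mul, map_mul, map_mul, hs, hs, ← scal_pol, ← scal_pol, ← hG, ← hG',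
    ← mul_assoc, ← mul_assoc, ← map_mul (scal q), ← map_mul (scal q), mul_comm] at key2
  have hu0 : algebraMap (Pol K n) (RatFun K n) (subst k a d) *
      algebraMap (Pol K n) (RatFun K n) (subst k a d') ≠ 0 := by
    rw [← map_mul]
    simpa using ⟨hd, hd'⟩
  generalize algebraMap (Pol K n) (RatFun K n) (subst k a d) *
      algebraMap (Pol K n) (RatFun K n) (subst k a d') = u at key2 hu0
  have := congrArg (scal q u⁻¹ * ·) key2
  simpa only [← mul_assoc, ← map_mul, inv_mul_cancel₀ hu0, map_one, one_mul] using this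

/-- The result of consecutive evaluations, if it exists, is unique. -/
theorem ConsecutiveEval.unique {q : Fin m → K} {a : Fin n → K} {F : HRat n q} {E E' : Hecke n q}
    (h : ConsecutiveEval q a F E) (h' : ConsecutiveEval q a F E') : E = E' := by
  obtain ⟨G, h0, h1, h2⟩ := h
  obtain ⟨G', h0', h1', h2'⟩ := h'
  have : ∀ k, G k = G' k := fun k => by
    induction k using Fin.induction with
    | zero => rw [h0, h0']
    | succ k ih => exact (h1 k).unique (ih ▸ h1' k)
  have h3 : const q E = const q E' := by rw [← h2, ← h2', this]
  exact Algebra.TensorProduct.includeLeft_injective (algebraMap K (RatFun K n)).injective h3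

/-! ### The rational function `Φ(z_1, …, z_n)` -/

/-- `t(z) = f(z) / (z - t)` with `f(z) = (z - q_1) ⋯ (z - q_m)`. -/
noncomputable def tFun (q : Fin m → K) (z : RatFun K n) : HRat n q :=
  scal q (∏ c : Fin m, (z - algebraMap K (RatFun K n) (q c))) *
    Ring.inverse (scal q z - const q (genT n q))

/-- The Baxterized element `t_{k+1}(x, y) = 1 / (x - y) + t_{k+1}`. -/
noncomputable def baxter (q : Fin m → K) (k : ℕ) (h : k + 1 < n) (x y : RatFun K n) : HRat n q :=
  scal q (1 / (x - y)) + const q (genS q k h)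

/-- `phi q k _ z` is `φ_{k+1}(z_1, …, z_k; z)`, that is, `φ_1(z) = t(z)` and
`φ_{i+1}(z_1, …, z_i; z) = t_i(z, z_i) φ_i(z_1, …, z_{i-1}; z) t_i`. -/
noncomputable def phi (q : Fin m → K) : (k : ℕ) → k < n → RatFun K n → HRat n q
  | 0, _, z => tFun q z
  | k + 1, h, z =>
      baxter q k h z (var K ⟨k, Nat.lt_of_succ_lt h⟩) * phi q k (Nat.lt_of_succ_lt h) z *
        const q (genS q k h)

/-- `φ_k(z_1, …, z_{k-1}, z_k) ⋯ φ_2(z_1, z_2) φ_1(z_1)`. -/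
noncomputable def phiProd (q : Fin m → K) : (k : ℕ) → k ≤ n → HRat n q
  | 0, _ => 1
  | k + 1, h => phi q k h (var K ⟨k, h⟩) * phiProd q k (Nat.le_of_succ_le h)

/-- `Φ(z_1, …, z_n) = φ_n(z_1, …, z_n) φ_{n-1}(z_1, …, z_{n-1}) ⋯ φ_1(z_1)`. -/
noncomputable def Phi (n : ℕ) (q : Fin m → K) : HRat n q :=
  phiProd q n le_rfl

end Fusion

end DegenerateCyclotomic

/-!
The idempotents are built from the Jucys-Murphy elements. A standard tableau is recorded as the
sequence `p` of its boxes, in the order of their entries, and its idempotent `tabIdem q J p k` is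
the product, over the first `k` boxes, of the Lagrange interpolation polynomials in `J_i` which
separate the residue of the box from the residues of the other boxes that could have been added.

*Eigenvalues.* Let `x` be a joint eigenvector of `J_1, …, J_k` whose eigenvalues are the residues of
a standard tableau of shape `λ`. The intertwiners of the degenerate affine Hecke algebra permute
eigenvalues, and the relations of rank two exclude a few patterns; from this alone it follows that
every eigenvalue of `J_{k+1}` on the multiples of `x` is the residue of an addable box of `λ`
(`IsSpectral.exists_addable`). As genericity makes the residues of the addable boxes distinct, no
Jordan blocks occur and `J_{k+1}` is diagonalizable there (`IsJucysMurphy.isDiagonal`). Hence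
`tabIdem` has the required eigenvalues and is the sum of the idempotents of its extensions by one
box (`IsJucysMurphy.sum_tabIdem_update`).

*Primitivity and uniqueness.* For every `a` in the algebra, `E a E` is a multiple of `E`, and
`E' a E = 0` for tableaux of different shapes; both are shown together by induction on `k`, writing
the Coxeter part of the algebra as `B + B s B` (`IsJucysMurphy.tabIdem_mul_mul_aux`). So `E` is
primitive as soon as it is nonzero, and this is seen in Young's seminormal representation
(`tabIdem_ne_zero`). An idempotent `e` with the eigenvalues of `E` satisfies `E e = e = e E`, and is
therefore `E`.

*Fusion.* When the first `k` variables are the residues of a tableau with idempotent `E_k`, the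
function `φ_{k+1}(z) (z - J_{k+1})` acts on `E_k` as the scalar
`F(z) = f(z) ∏ (1 - 1 / (z - c) ^ 2)`, `c` running over these residues
(`IsJucysMurphy.baxter_mul`). Splitting `E_k` into the idempotents of its extensions shows that
`φ_{k+1}(z) E_k` is the sum of the terms `F(z) / (z - r) E_{k+1}`, where `r` is the residue of the
added box. The product `F` telescopes along the diagrams (`exists_hookProd_ratio`): at the residue
of the next box of the tableau only the term of that box survives, and its coefficient is the factor
by which the product of the generalized hook lengths changes. The evaluations of the remaining
variables do not interfere, so that `Φ` evaluates to the product of the generalized hook lengths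
times `E` (`consecutiveEval_Phi`).
-/

namespace DegenerateCyclotomic

/-! ### Boxes, standard sequences of boxes, residues -/

section Combinatorics

variable {K : Type*} [Field K] {m n : ℕ}

/-- A box `(row, column, component)` of a multidiagram, rows and columns starting at `0`. -/
abbrev Box (m : ℕ) : Type := ℕ × ℕ × Fin m

/-- The residue of a box. -/
def boxRes (q : Fin m → K) (x : Box m) : K := (x.2.1 : K) - (x.1 : K) + q x.2.2

/-- The content of a box. -/
def content (x : Box m) : ℤ := (x.2.1 : ℤ) - x.1

/-- A finite set of boxes which contains, with a box, every box weakly above and to the left of it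
in the same component: a multidiagram. -/
def IsLowerBoxes (s : Finset (Box m)) : Prop :=
  ∀ a b c, (a, b, c) ∈ s → ∀ a' ≤ a, ∀ b' ≤ b, (a', b', c) ∈ s

/-- The box `x` can be added to the multidiagram `s`. -/
def Addable (s : Finset (Box m)) (x : Box m) : Prop :=
  x ∉ s ∧ (∀ a b c, x = (a + 1, b, c) → (a, b, c) ∈ s) ∧
    (∀ a b c, x = (a, b + 1, c) → (a, b, c) ∈ s)

/-- The set of the first `k` boxes of a sequence. -/
def boxShape (p : ℕ → Box m) (k : ℕ) : Finset (Box m) := (Finset.range k).image p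

/-- The first `k` terms of `p` build up a multidiagram box by box; such initial segments are the
standard tableaux with `k` entries. Only the first `k` terms matter. -/
def Std (k : ℕ) (p : ℕ → Box m) : Prop := ∀ i < k, Addable (boxShape p i) (p i)

/-- The separation properties of the parameters that a nonzero `separation n q` expresses. -/
structure IsSeparated (n : ℕ) (q : Fin m → K) : Prop where
  int_ne : ∀ d : ℤ, d ≠ 0 → |d| ≤ n → (d : K) ≠ 0
  sub_ne : ∀ c c', c ≠ c' → ∀ d : ℤ, |d| ≤ n → (d : K) + q c - q c' ≠ 0

theorem isSeparated_of_separation_ne_zero {q : Fin m → K} (h : separation n q ≠ 0) :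
    IsSeparated n q := by
  obtain ⟨h1, h2⟩ := mul_ne_zero_iff.1 h
  have h3 : ∀ j : ℕ, j ≠ 0 → j ≤ n → (j : K) ≠ 0 := fun j hj hjn h0 => h1 <| by
    obtain ⟨e, he⟩ := Nat.dvd_factorial (Nat.pos_of_ne_zero hj) hjn
    rw [he, Nat.cast_mul, h0, zero_mul]
  have h4 : ∀ i j : Fin m, i < j → ∀ d : ℤ, |d| ≤ n → (d : K) + q i - q j ≠ 0 := by
    intro i j hij d hd
    have h5 := Finset.prod_ne_zero_iff.1 h2 i (Finset.mem_univ i)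
    have h6 := Finset.prod_ne_zero_iff.1 h5 j (Finset.mem_Ioi.2 hij)
    exact Finset.prod_ne_zero_iff.1 h6 d (Finset.mem_Icc.2 (abs_le.1 hd))
  refine ⟨fun d hd hdn h0 => ?_, fun c c' hc d hd => ?_⟩
  · refine h3 d.natAbs (by simpa using hd) (by rw [Int.abs_eq_natAbs] at hdn; omega) ?_
    rcases Int.natAbs_eq d with h5 | h5
    · rw [h5] at h0; simpa using h0
    · rw [h5] at h0; simpa using h0
  · rcases lt_or_gt_of_ne hc with h5 | h5
    · exact h4 c c' h5 d hd
    · intro h0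
      refine h4 c' c h5 (-d) (by simpa using hd) ?_
      push_cast
      linear_combination -h0

theorem boxRes_eq (q : Fin m → K) (x : Box m) : boxRes q x = (content x : K) + q x.2.2 := by
  simp [boxRes, content]

theorem boxShape_succ (p : ℕ → Box m) (k : ℕ) :
    boxShape p (k + 1) = insert (p k) (boxShape p k) := by
  simp [boxShape, Finset.range_add_one, Finset.image_insert]

theorem mem_boxShape {p : ℕ → Box m} {k : ℕ} {x : Box m} :
    x ∈ boxShape p k ↔ ∃ i < k, p i = x := by
  simp [boxShape]

theorem boxShape_congr {p p' : ℕ → Box m} {k : ℕ} (h : ∀ i < k, p i = p' i) :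
    boxShape p k = boxShape p' k :=
  Finset.image_congr fun i hi => h i (by simpa using hi)

theorem Std.congr {p p' : ℕ → Box m} {k : ℕ} (hp : Std k p) (h : ∀ i < k, p i = p' i) :
    Std k p' := fun i hi => by
  rw [← boxShape_congr fun j hj => h j (hj.trans hi), ← h i hi]
  exact hp i hi

theorem Std.mono {p : ℕ → Box m} {k l : ℕ} (hp : Std k p) (h : l ≤ k) : Std l p :=
  fun i hi => hp i (hi.trans_le h)

theorem Std.update {p : ℕ → Box m} {k : ℕ} {x : Box m} (hp : Std k p)
    (hx : Addable (boxShape p k) x) : Std (k + 1) (Function.update p k x) := by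
  have h : ∀ i < k, p i = Function.update p k x i := fun i hi => by
    rw [Function.update_of_ne hi.ne]
  intro i hi
  rcases Nat.lt_succ_iff_lt_or_eq.1 hi with h1 | rfl
  · exact (hp.congr h) i h1
  · rw [← boxShape_congr h]
    simpa using hx

theorem boxShape_update (p : ℕ → Box m) (k : ℕ) (x : Box m) :
    boxShape (Function.update p k x) (k + 1) = insert x (boxShape p k) := by
  rw [boxShape_succ, Function.update_self]
  congr 1
  exact boxShape_congr fun i hi => Function.update_of_ne hi.ne _ _

theorem Std.ne {p : ℕ → Box m} {k i j : ℕ} (hp : Std k p) (hij : i < j) (hj : j < k) :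
    p i ≠ p j := fun h => (hp j hj).1 (mem_boxShape.2 ⟨i, hij, h⟩)

theorem Std.card {p : ℕ → Box m} {k : ℕ} (hp : Std k p) : (boxShape p k).card = k := by
  rw [boxShape, Finset.card_image_of_injOn, Finset.card_range]
  intro i hi j hj h
  simp only [Finset.coe_range, Set.mem_Iio] at hi hj
  by_contra hne
  rcases lt_or_gt_of_ne hne with h1 | h1
  · exact hp.ne h1 hj h
  · exact hp.ne h1 hi h.symm

theorem IsLowerBoxes.insert_addable {s : Finset (Box m)} {x : Box m} (hs : IsLowerBoxes s)
    (hx : Addable s x) : IsLowerBoxes (insert x s) := by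
  intro a b c h a' ha b' hb
  rw [Finset.mem_insert] at h ⊢
  rcases h with rfl | h
  · rcases Nat.eq_or_lt_of_le ha with rfl | ha
    · rcases Nat.eq_or_lt_of_le hb with rfl | hb
      · exact Or.inl rfl
      · obtain ⟨b, rfl⟩ := Nat.exists_eq_succ_of_ne_zero (by omega : b ≠ 0)
        exact Or.inr (hs _ _ _ (hx.2.2 _ _ _ rfl) _ le_rfl _ (by omega))
    · obtain ⟨a, rfl⟩ := Nat.exists_eq_succ_of_ne_zero (by omega : a ≠ 0)
      exact Or.inr (hs _ _ _ (hx.2.1 _ _ _ rfl) _ (by omega) _ hb)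
  · exact Or.inr (hs _ _ _ h _ ha _ hb)

theorem Std.isLower {p : ℕ → Box m} {k : ℕ} (hp : Std k p) : IsLowerBoxes (boxShape p k) := by
  induction k with
  | zero => intro a b c h; simp [boxShape] at h
  | succ k ih =>
    rw [boxShape_succ]
    exact (ih (hp.mono k.le_succ)).insert_addable (hp k k.lt_succ_self)

/-- The boxes weakly above and to the left of the `i`-th box occur among the boxes up to the
`i`-th. -/
theorem Std.exists_le {p : ℕ → Box m} {k i a b a' b' : ℕ} {c : Fin m} (hp : Std k p) (hi : i < k)
    (h : p i = (a, b, c)) (ha : a' ≤ a) (hb : b' ≤ b) : ∃ j ≤ i, p j = (a', b', c) := by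
  obtain ⟨j, hj, h1⟩ := mem_boxShape.1 ((hp.mono hi).isLower a b c
    (mem_boxShape.2 ⟨i, i.lt_succ_self, h⟩) a' ha b' hb)
  exact ⟨j, Nat.lt_succ_iff.1 hj, h1⟩

theorem Std.le_of_le {p : ℕ → Box m} {k i j a b a' b' : ℕ} {c : Fin m} (hp : Std k p) (hi : i < k)
    (hj : j < k) (h : p i = (a, b, c)) (h' : p j = (a', b', c)) (ha : a' ≤ a) (hb : b' ≤ b) :
    j ≤ i := by
  obtain ⟨l, hl, h1⟩ := hp.exists_le hi h ha hb
  by_contra hne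
  exact hp.ne (by omega : l < j) hj (h1.trans h'.symm)

/-- A multidiagram contains the first column down to a box of it, and the first row up to another
one of the same component. -/
theorem IsLowerBoxes.add_lt_card {s : Finset (Box m)} (hs : IsLowerBoxes s) {a b a' b' : ℕ}
    {c : Fin m} (h : (a, b, c) ∈ s) (h' : (a', b', c) ∈ s) : a + b' + 1 ≤ s.card := by
  let f : ℕ → Box m := fun i => if i ≤ a then (i, 0, c) else (0, i - a, c)
  have hf : Set.InjOn f (Finset.range (a + b' + 1)) := by
    intro i _ j _ hij
    simp only [f] at hij
    split_ifs at hij <;> simp only [Prod.mk.injEq] at hij <;> omega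
  rw [← Finset.card_range (a + b' + 1), ← Finset.card_image_of_injOn hf]
  refine Finset.card_le_card fun x hx => ?_
  obtain ⟨i, hi, rfl⟩ := Finset.mem_image.1 hx
  rw [Finset.mem_range] at hi
  simp only [f]
  split_ifs with h1
  · exact hs _ _ _ h _ h1 _ (Nat.zero_le _)
  · exact hs _ _ _ h' _ (Nat.zero_le _) _ (by omega)

theorem IsLowerBoxes.add_lt_card_of_ne {s : Finset (Box m)} (hs : IsLowerBoxes s) {a b a' b' : ℕ}
    {c c' : Fin m} (hc : c ≠ c') (h : (a, b, c) ∈ s) (h' : (a', b', c') ∈ s) :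
    a + b' + 2 ≤ s.card := by
  let f : ℕ → Box m := fun i => if i ≤ a then (i, 0, c) else (0, i - a - 1, c')
  have hf : Set.InjOn f (Finset.range (a + b' + 2)) := by
    intro i _ j _ hij
    simp only [f] at hij
    split_ifs at hij <;> simp only [Prod.mk.injEq] at hij
    · omega
    · exact absurd hij.2.2 hc
    · exact absurd hij.2.2.symm hc
    · omega
  rw [← Finset.card_range (a + b' + 2), ← Finset.card_image_of_injOn hf]
  refine Finset.card_le_card fun x hx => ?_
  obtain ⟨i, hi, rfl⟩ := Finset.mem_image.1 hx
  rw [Finset.mem_range] at hi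
  simp only [f]
  split_ifs with h1
  · exact hs _ _ _ h _ h1 _ (Nat.zero_le _)
  · exact hs _ _ _ h' _ (Nat.zero_le _) _ (by omega)

/-- In a small multidiagram, residues that differ by a small integer come from the same component,
and the contents differ by that integer. -/
theorem IsSeparated.of_boxRes_eq {q : Fin m → K} (hq : IsSeparated n q) {s : Finset (Box m)}
    (hs : IsLowerBoxes s) {x y : Box m} (hx : x ∈ s) (hy : y ∈ s) (e : ℤ)
    (he : (s.card : ℤ) - 1 + |e| ≤ n) (h : boxRes q x = boxRes q y + e) :
    x.2.2 = y.2.2 ∧ content x = content y + e := by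
  obtain ⟨a, b, c⟩ := x
  obtain ⟨a', b', c'⟩ := y
  simp only [boxRes_eq, content] at h ⊢
  have he' := abs_nonneg e
  have he1 := le_abs_self e
  have he2 := neg_abs_le e
  by_cases hc : c = c'
  · subst hc
    refine ⟨rfl, ?_⟩
    by_contra hne
    have h1 := hs.add_lt_card hx hy
    have h2 := hs.add_lt_card hy hx
    refine hq.int_ne ((b : ℤ) - a - ((b' : ℤ) - a' + e)) (by omega)
      (abs_le.2 ⟨by omega, by omega⟩) ?_
    push_cast at h ⊢
    linear_combination h
  · exfalso
    have h1 := hs.add_lt_card_of_ne hc hx hy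
    have h2 := hs.add_lt_card_of_ne (Ne.symm hc) hy hx
    refine hq.sub_ne c c' hc ((b : ℤ) - a - ((b' : ℤ) - a' + e)) (abs_le.2 ⟨by omega, by omega⟩) ?_
    push_cast at h ⊢
    linear_combination h

theorem Addable.insert_of_ne {s : Finset (Box m)} {x y : Box m} (hx : Addable s x)
    (hne : x ≠ y) : Addable (insert y s) x :=
  ⟨by simp [hne, hx.1], fun a b c h => Finset.mem_insert_of_mem (hx.2.1 a b c h),
    fun a b c h => Finset.mem_insert_of_mem (hx.2.2 a b c h)⟩

theorem Addable.of_insert {s : Finset (Box m)} {x y : Box m} (hx : Addable (insert y s) x)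
    (h1 : ∀ a b c, y = (a, b, c) → x ≠ (a + 1, b, c))
    (h2 : ∀ a b c, y = (a, b, c) → x ≠ (a, b + 1, c)) : Addable s x := by
  refine ⟨fun h => hx.1 (Finset.mem_insert_of_mem h), fun a b c h => ?_, fun a b c h => ?_⟩
  · rcases Finset.mem_insert.1 (hx.2.1 a b c h) with h3 | h3
    · exact absurd h (h1 _ _ _ h3.symm)
    · exact h3
  · rcases Finset.mem_insert.1 (hx.2.2 a b c h) with h3 | h3
    · exact absurd h (h2 _ _ _ h3.symm)
    · exact h3

/-- Two distinct addable boxes of one component are never comparable. -/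
theorem Addable.eq_of_le {s : Finset (Box m)} (hs : IsLowerBoxes s) {a b a' b' : ℕ} {c : Fin m}
    (h : Addable s (a, b, c)) (h' : Addable s (a', b', c)) (ha : a ≤ a') (hb : b ≤ b') :
    a = a' ∧ b = b' := by
  by_contra hne
  rcases Nat.eq_or_lt_of_le ha with rfl | ha
  · obtain ⟨b', rfl⟩ := Nat.exists_eq_succ_of_ne_zero (by omega : b' ≠ 0)
    exact h.1 (hs _ _ _ (h'.2.2 _ _ _ rfl) _ le_rfl _ (by omega))
  · obtain ⟨a', rfl⟩ := Nat.exists_eq_succ_of_ne_zero (by omega : a' ≠ 0)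
    exact h.1 (hs _ _ _ (h'.2.1 _ _ _ rfl) _ (by omega) _ hb)

/-- Residues of addable boxes that differ by a small integer belong to the same component: after
adding one box, the other one is still addable. -/
theorem IsSeparated.addable_aux {q : Fin m → K} (hq : IsSeparated n q)
    {s : Finset (Box m)} (hs : IsLowerBoxes s) {x y : Box m} (hx : Addable s x)
    (hy : Addable s y) (e : ℤ) (he : (s.card : ℤ) + 1 + |e| ≤ n)
    (h : boxRes q x = boxRes q y + e) : x.2.2 = y.2.2 ∧ content x = content y + e := by
  by_cases hxy : x = y
  · subst hxy
    have h0 : (e : K) = 0 := by linear_combination -h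
    by_cases he0 : e = 0
    · simp [he0]
    · exact absurd h0 (hq.int_ne e he0 (by have := Int.natCast_nonneg s.card; omega))
  · have hx' := hx.insert_of_ne hxy
    refine hq.of_boxRes_eq ((hs.insert_addable hy).insert_addable hx') (Finset.mem_insert_self _ _)
      (Finset.mem_insert_of_mem (Finset.mem_insert_self _ _)) e ?_ h
    rw [Finset.card_insert_of_notMem hx'.1, Finset.card_insert_of_notMem hy.1]
    push_cast
    omega

/-- Distinct addable boxes have distinct residues. -/
theorem IsSeparated.addable_inj {q : Fin m → K} (hq : IsSeparated n q)
    {s : Finset (Box m)} (hs : IsLowerBoxes s) (hn : s.card + 1 ≤ n) {x y : Box m}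
    (hx : Addable s x) (hy : Addable s y) (h : boxRes q x = boxRes q y) : x = y := by
  obtain ⟨h1, h2⟩ := hq.addable_aux hs hx hy 0 (by simp; omega) (by simpa using h)
  obtain ⟨a, b, c⟩ := x
  obtain ⟨a', b', c'⟩ := y
  simp only [content] at h1 h2
  subst h1
  rcases le_total a a' with h3 | h3
  · obtain ⟨rfl, rfl⟩ := hx.eq_of_le hs hy h3 (by omega); rfl
  · obtain ⟨rfl, rfl⟩ := hy.eq_of_le hs hx h3 (by omega); rfl

/-- The residues of addable boxes never differ by `1`. -/
theorem IsSeparated.addable_ne_add_one {q : Fin m → K} (hq : IsSeparated n q)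
    {s : Finset (Box m)} (hs : IsLowerBoxes s) (hn : s.card + 2 ≤ n) {x y : Box m}
    (hx : Addable s x) (hy : Addable s y) : boxRes q x ≠ boxRes q y + 1 := by
  intro h
  obtain ⟨h1, h2⟩ := hq.addable_aux hs hx hy 1 (by simp; omega) (by simpa using h)
  obtain ⟨a, b, c⟩ := x
  obtain ⟨a', b', c'⟩ := y
  simp only [content] at h1 h2
  subst h1
  rcases le_or_gt a a' with h3 | h3
  · rcases Nat.lt_or_ge b' b with h4 | h4
    · rcases Nat.lt_or_ge a a' with h5 | h5
      · omega
      · obtain ⟨rfl, rfl⟩ := hy.eq_of_le hs hx h5 h4.le; omega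
    · obtain ⟨rfl, rfl⟩ := hx.eq_of_le hs hy h3 h4; omega
  · obtain ⟨rfl, rfl⟩ := hy.eq_of_le hs hx h3.le (by omega); omega

/-- Two terms of a standard sequence with the same residue are at least three steps apart, since
the two boxes adjacent to both of them lie in between. -/
theorem IsSeparated.add_three_le {q : Fin m → K} (hq : IsSeparated n q) {p : ℕ → Box m} {k i j : ℕ}
    (hp : Std k p) (hk : k ≤ n) (hij : i < j) (hj : j < k)
    (h : boxRes q (p i) = boxRes q (p j)) : i + 3 ≤ j := by
  have hi := hij.trans hj
  obtain ⟨h1, h2⟩ := hq.of_boxRes_eq hp.isLower (mem_boxShape.2 ⟨i, hi, rfl⟩)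
    (mem_boxShape.2 ⟨j, hj, rfl⟩) 0 (by rw [hp.card]; simp; omega) (by simpa using h)
  have hne := hp.ne hij hj
  obtain ⟨a, b, c, hx⟩ : ∃ a b c, p i = (a, b, c) := ⟨_, _, _, rfl⟩
  obtain ⟨a', b', c', hy⟩ : ∃ a b c, p j = (a, b, c) := ⟨_, _, _, rfl⟩
  rw [hx, hy] at h1 h2 hne
  simp only [content] at h1 h2
  subst h1
  have ha : a < a' := by
    by_contra hlt
    have := hp.le_of_le hi hj hx hy (by omega) (by omega)
    omega
  obtain ⟨l, hl, hl'⟩ := hp.exists_le hj hy (by omega : a + 1 ≤ a') (by omega : b ≤ b')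
  obtain ⟨r, hr, hr'⟩ := hp.exists_le hj hy (by omega : a ≤ a') (by omega : b + 1 ≤ b')
  have e1 := hp.le_of_le (by omega) hi hl' hx (by omega) le_rfl
  have e2 := hp.le_of_le (by omega) hi hr' hx le_rfl (by omega)
  have e3 : l ≠ i := by rintro rfl; rw [hx] at hl'; simp at hl'
  have e4 : r ≠ i := by rintro rfl; rw [hx] at hr'; simp at hr'
  have e5 : l ≠ r := by rintro rfl; rw [hl'] at hr'; simp at hr'
  have e6 : l ≠ j := by rintro rfl; rw [hl', Prod.mk.injEq, Prod.mk.injEq] at hy; omega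
  have e7 : r ≠ j := by rintro rfl; rw [hr', Prod.mk.injEq, Prod.mk.injEq] at hy; omega
  omega

theorem boxShape_comp_swap (p : ℕ → Box m) {i k : ℕ} (h : i + 1 < k) :
    boxShape (p ∘ Equiv.swap i (i + 1)) k = boxShape p k := by
  ext x
  simp only [mem_boxShape, Function.comp]
  have key : ∀ j < k, Equiv.swap i (i + 1) j < k := fun j hj => by
    rw [Equiv.swap_apply_def]; split_ifs <;> omega
  constructor
  · rintro ⟨j, hj, rfl⟩
    exact ⟨_, key j hj, rfl⟩
  · rintro ⟨j, hj, rfl⟩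
    exact ⟨_, key j hj, by simp⟩

theorem swap_apply_of_lt {i j : ℕ} (h : j < i) : Equiv.swap i (i + 1) j = j :=
  Equiv.swap_apply_of_ne_of_ne (by omega) (by omega)

theorem swap_apply_of_gt {i j : ℕ} (h : i + 1 < j) : Equiv.swap i (i + 1) j = j :=
  Equiv.swap_apply_of_ne_of_ne (by omega) (by omega)

/-- Consecutive entries of a standard tableau may be exchanged unless their residues differ
by `1`. -/
theorem Std.swap {q : Fin m → K} {p : ℕ → Box m} {k i : ℕ} (hp : Std k p) (hi : i + 1 < k)
    (h1 : boxRes q (p (i + 1)) ≠ boxRes q (p i) + 1)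
    (h2 : boxRes q (p (i + 1)) ≠ boxRes q (p i) - 1) : Std k (p ∘ Equiv.swap i (i + 1)) := by
  have hs : ∀ j ≤ i, boxShape (p ∘ Equiv.swap i (i + 1)) j = boxShape p j := fun j hj =>
    boxShape_congr fun l hl => by rw [Function.comp, swap_apply_of_lt (hl.trans_le hj)]
  have hA := hp (i + 1) hi
  have hB := hp i (by omega)
  rw [boxShape_succ] at hA
  intro j hj
  rcases lt_trichotomy j i with h | rfl | h
  · rw [hs j h.le, Function.comp, swap_apply_of_lt h]
    exact hp j hj
  · rw [hs j le_rfl, Function.comp, Equiv.swap_apply_left]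
    refine hA.of_insert (fun a b c hy hx => h2 ?_) (fun a b c hy hx => h1 ?_)
    · rw [hx, hy]; simp [boxRes]; ring
    · rw [hx, hy]; simp [boxRes]; ring
  · rcases Nat.eq_or_lt_of_le h with rfl | h
    · rw [Nat.succ_eq_add_one, boxShape_succ, hs i le_rfl, Function.comp, Function.comp,
        Equiv.swap_apply_right, Equiv.swap_apply_left]
      exact hB.insert_of_ne (hp.ne (Nat.lt_succ_self i) hi)
    · rw [boxShape_comp_swap p h, Function.comp, swap_apply_of_gt h]
      exact hp j hj

/-- A standard tableau is determined by its residues. -/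
theorem IsSeparated.std_ext {q : Fin m → K} (hq : IsSeparated n q) {p p' : ℕ → Box m} {k : ℕ}
    (hk : k ≤ n) (hp : Std k p) (hp' : Std k p')
    (h : ∀ i < k, boxRes q (p i) = boxRes q (p' i)) : ∀ i < k, p i = p' i := by
  intro i
  induction i using Nat.strong_induction_on with
  | _ i ih =>
    intro hi
    have h1 := boxShape_congr fun j (hj : j < i) => ih j hj (hj.trans hi)
    refine hq.addable_inj (hp.mono hi.le).isLower ?_ (hp i hi) (h1 ▸ hp' i hi) (h i hi)
    rw [(hp.mono hi.le).card]; omega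

/-- If the residues of two standard tableaux differ by an exchange of the last two, so do the
tableaux; in particular their shapes agree. -/
theorem IsSeparated.boxShape_eq_of_swap {q : Fin m → K} (hq : IsSeparated n q) {p p' : ℕ → Box m}
    {k : ℕ} (hk : k + 2 ≤ n) (hp : Std (k + 2) p) (hp' : Std (k + 2) p')
    (h : ∀ i < k + 2, boxRes q (p' i) = boxRes q (p (Equiv.swap k (k + 1) i))) :
    boxShape p' (k + 2) = boxShape p (k + 2) := by
  have h0 : ∀ i < k, p i = p' i :=
    hq.std_ext (by omega) (hp.mono (by omega)) (hp'.mono (by omega)) fun i hi => by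
      rw [h i (by omega), swap_apply_of_lt hi]
  have h1 := h k (by omega)
  have h2 := h (k + 1) (by omega)
  rw [Equiv.swap_apply_left] at h1
  have hA := hp k (by omega)
  have hB := hp' k (by omega)
  rw [← boxShape_congr h0] at hB
  have hl := (hp.mono (by omega : k ≤ k + 2)).isLower
  have hc : (boxShape p k).card + 2 ≤ n := by rw [(hp.mono (by omega : k ≤ k + 2)).card]; omega
  have hsw : Std (k + 2) (p ∘ Equiv.swap k (k + 1)) := by
    refine hp.swap (q := q) (by omega) (fun h3 => ?_) (fun h3 => ?_)
    · exact hq.addable_ne_add_one hl hc hB hA (h1.trans h3)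
    · exact hq.addable_ne_add_one hl hc hA hB (by rw [h1, h3]; ring)
  rw [boxShape_congr (hq.std_ext hk hp' hsw h), boxShape_comp_swap _ (by omega)]

open Classical in
/-- The set of addable boxes. The bounds on rows and columns only serve to make it finite: an
addable box of a multidiagram with `N` boxes lies in the first `N + 1` rows and columns. -/
noncomputable def addables (s : Finset (Box m)) : Finset (Box m) :=
  (Finset.range (s.card + 1) ×ˢ Finset.range (s.card + 1) ×ˢ Finset.univ).filter (Addable s)

theorem mem_addables {s : Finset (Box m)} (hs : IsLowerBoxes s) {x : Box m} :
    x ∈ addables s ↔ Addable s x := by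
  obtain ⟨a, b, c⟩ := x
  simp only [addables, Finset.mem_filter, Finset.mem_product, Finset.mem_range, Finset.mem_univ,
    and_true, and_iff_right_iff_imp]
  intro h
  have h1 := (hs.insert_addable h).add_lt_card (Finset.mem_insert_self _ _) (Finset.mem_insert_self _ _)
  rw [Finset.card_insert_of_notMem h.1] at h1
  omega

end Combinatorics

/-! ### Sequences of eigenvalues are residue sequences -/

section Spectrum

variable {K : Type*} [Field K] {m n : ℕ}

/-- Properties of a set `P` of sequences of length `N` in `K` which force its members to be
residue sequences of standard tableaux. They hold for the sequences of joint eigenvalues of the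
Jucys-Murphy elements. -/
structure IsSpectral (q : Fin m → K) (N : ℕ) (P : (ℕ → K) → Prop) : Prop where
  zero : ∀ w, P w → ∃ c, w 0 = q c
  ne_succ : ∀ w i, P w → i + 1 < N → w i ≠ w (i + 1)
  swap : ∀ w i, P w → i + 1 < N → w (i + 1) ≠ w i + 1 → w (i + 1) ≠ w i - 1 →
    P (w ∘ Equiv.swap i (i + 1))
  not_triple : ∀ w i, P w → i + 2 < N → w (i + 2) = w i → w (i + 1) ≠ w i + 1 ∧
    w (i + 1) ≠ w i - 1

variable {q : Fin m → K} {N : ℕ} {P : (ℕ → K) → Prop}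

/-- A letter `w j` that may be exchanged with all letters before it can be moved to the front. -/
theorem IsSpectral.exists_of_forall (hP : IsSpectral q N P) {w : ℕ → K} {j : ℕ} (hw : P w)
    (hj : j < N) (h : ∀ i < j, w i ≠ w j + 1 ∧ w i ≠ w j - 1) : ∃ c, w j = q c := by
  induction j generalizing w with
  | zero => exact hP.zero w hw
  | succ j ih =>
    have h1 := h j j.lt_succ_self
    have h2 := hP.swap w j hw hj (fun h3 => h1.2 (by rw [h3]; ring))
      (fun h3 => h1.1 (by rw [h3]; ring))
    obtain ⟨c, hc⟩ := ih h2 (by omega) fun i hi => by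
      simpa [swap_apply_of_lt hi] using h i (by omega)
    exact ⟨c, by simpa using hc⟩

/-- Between two equal letters there is one that differs from them by `1`. -/
theorem IsSpectral.exists_between (hP : IsSpectral q N P) {w : ℕ → K} {i j : ℕ} (hw : P w)
    (hij : i < j) (hj : j < N) (h : w i = w j) :
    ∃ l, i < l ∧ l < j ∧ (w l = w j + 1 ∨ w l = w j - 1) := by
  by_contra! hno
  induction j, hij using Nat.le_induction generalizing w with
  | base => exact hP.ne_succ w i hw hj h
  | succ j hij ih =>
    have h1 := hno j hij j.lt_succ_self
    have h2 := hP.swap w j hw hj (fun h3 => h1.2 (by rw [h3]; ring))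
      (fun h3 => h1.1 (by rw [h3]; ring))
    refine ih h2 (by omega) ?_ fun l hl hlj => ?_
    · simpa [swap_apply_of_lt (Nat.lt_of_succ_le hij)] using h
    · simpa [swap_apply_of_lt hlj] using hno l hl (by omega)

/-- Between two equal letters there are at least two that differ from them by `1`. -/
theorem IsSpectral.exists_two_between (hP : IsSpectral q N P) {w : ℕ → K} {i l j : ℕ} (hw : P w)
    (hil : i < l) (hlj : l < j) (hj : j < N) (h : w i = w j)
    (hl : w l = w i + 1 ∨ w l = w i - 1) :
    ∃ t, i < t ∧ t < j ∧ t ≠ l ∧ (w t = w j + 1 ∨ w t = w j - 1) := by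
  by_contra! hno
  induction j, hlj using Nat.le_induction generalizing w with
  | base =>
    -- the last letter is now next to the exceptional one; the first letter is moved there
    obtain ⟨e, rfl⟩ := Nat.exists_eq_add_of_lt hil
    induction e generalizing i w with
    | zero =>
      have h3 := hP.not_triple w i hw hj h.symm
      rcases hl with hl | hl
      · exact h3.1 hl
      · exact h3.2 hl
    | succ e ih =>
      have h1 := hno (i + 1) (by omega) (by omega) (by omega)
      rw [← h] at h1
      have h2 := hP.swap w i hw (by omega) h1.1 h1.2
      have hg : ∀ t, i + 1 < t → (w ∘ Equiv.swap i (i + 1)) t = w t := fun t ht => by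
        simp [swap_apply_of_gt ht]
      have hg1 : (w ∘ Equiv.swap i (i + 1)) (i + 1) = w i := by simp
      refine ih (i := i + 1) h2 (by omega) ?_ ?_ ?_ ?_
      · omega
      · rw [hg1, hg _ (by omega)]; rw [h]; congr 1; omega
      · rw [hg1, hg _ (by omega)]
        convert hl using 3 <;> omega
      · intro t ht1 ht2 ht3
        rw [hg _ (by omega), hg _ (by omega)]
        convert hno t (by omega) (by omega) (by omega) using 4 <;> omega
  | succ j hlj ih =>
    have hlj' : l < j := hlj
    have h1 := hno j (by omega) (by omega) (by omega)
    have h2 := hP.swap w j hw hj (fun h3 => h1.2 (by rw [h3]; ring))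
      (fun h3 => h1.1 (by rw [h3]; ring))
    have hg : ∀ t < j, (w ∘ Equiv.swap j (j + 1)) t = w t := fun t ht => by
      simp [swap_apply_of_lt ht]
    have hg1 : (w ∘ Equiv.swap j (j + 1)) j = w (j + 1) := by simp
    refine ih h2 (by omega) ?_ ?_ ?_
    · rw [hg _ (by omega), hg1, h]
    · rwa [hg _ (by omega), hg _ (by omega)]
    · intro t ht1 ht2 ht3
      rw [hg _ ht2, hg1]
      exact hno t ht1 (by omega) ht3

/-- A member of a spectral set that starts with the residues of a standard tableau continues with
the residue of an addable box. -/
theorem IsSpectral.exists_addable {k : ℕ} (hP : IsSpectral q (k + 1) P) (hq : IsSeparated n q)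
    (hk : k < n) {p : ℕ → Box m} (hp : Std k p) {w : ℕ → K} (hw : P w)
    (hwp : ∀ i < k, w i = boxRes q (p i)) :
    ∃ x, Addable (boxShape p k) x ∧ boxRes q x = w k := by
  classical
  -- residues of `p` that differ by `e` belong to contents that differ by `e`
  have hres : ∀ i < k, ∀ j < k, ∀ e : ℤ, |e| ≤ 1 → w i = w j + e →
      (p i).2.2 = (p j).2.2 ∧ content (p i) = content (p j) + e := by
    intro i hi j hj e he h
    rw [hwp i hi, hwp j hj] at h
    refine hq.of_boxRes_eq hp.isLower (mem_boxShape.2 ⟨i, hi, rfl⟩) (mem_boxShape.2 ⟨j, hj, rfl⟩)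
      e ?_ h
    rw [hp.card]; omega
  set B : Finset ℕ := (Finset.range k).filter fun i => w i = w k ∨ w i = w k + 1 ∨ w i = w k - 1
    with hB
  have hmemB : ∀ i, i ∈ B ↔ i < k ∧ (w i = w k ∨ w i = w k + 1 ∨ w i = w k - 1) := by
    intro i; simp [hB]
  rcases B.eq_empty_or_nonempty with h0 | hne
  · -- no letter before the last one interferes with it: a new first box of some component
    have hno : ∀ i < k, ¬ (w i = w k ∨ w i = w k + 1 ∨ w i = w k - 1) := fun i hi h => by
      have := (hmemB i).2 ⟨hi, h⟩
      rw [h0] at this; simp at this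
    obtain ⟨c, hc⟩ := hP.exists_of_forall hw k.lt_succ_self fun i hi =>
      ⟨fun h => hno i hi (Or.inr (Or.inl h)), fun h => hno i hi (Or.inr (Or.inr h))⟩
    refine ⟨(0, 0, c), ⟨fun h => ?_, fun a b c h => ?_, fun a b c h => ?_⟩, by simp [boxRes, hc]⟩
    · obtain ⟨i, hi, h⟩ := mem_boxShape.1 h
      exact hno i hi (Or.inl (by rw [hwp i hi, h, hc]; simp [boxRes]))
    · simp at h
    · simp at h
  · obtain ⟨hl, hwl⟩ := (hmemB _).1 (B.max'_mem hne)
    have hmax : ∀ t, B.max' hne < t → t < k → w t ≠ w k ∧ w t ≠ w k + 1 ∧ w t ≠ w k - 1 := by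
      intro t ht htk
      by_contra hcon
      have := B.le_max' t ((hmemB t).2 ⟨htk, by tauto⟩)
      omega
    generalize B.max' hne = l at hl hwl hmax
    obtain ⟨a, b, c, hpl⟩ : ∃ a b c, p l = (a, b, c) := ⟨_, _, _, rfl⟩
    have hlow := hp.isLower
    have hmeml : (a, b, c) ∈ boxShape p k := mem_boxShape.2 ⟨l, hl, hpl⟩
    -- two letters equal to `w k` with only one interfering letter in between are impossible
    have hfin : ∀ l' < l, w l' = w k → (w l = w k + 1 ∨ w l = w k - 1) →
        (∀ t, l' < t → t < l → w t ≠ w k + 1 ∧ w t ≠ w k - 1) → False := by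
      intro l' hl' h1 h2 h3
      obtain ⟨t, ht1, ht2, ht3, ht4⟩ :=
        hP.exists_two_between hw hl' hl k.lt_succ_self h1 (by rwa [h1])
      rcases lt_or_gt_of_ne ht3 with h4 | h4
      · have := h3 t ht1 h4; tauto
      · have := hmax t h4 ht2; tauto
    rcases hwl with h | h | h
    · obtain ⟨t, ht1, ht2, ht3⟩ := hP.exists_between hw hl k.lt_succ_self h
      have := hmax t ht1 ht2
      tauto
    · -- the box below `p l`
      have hrl := hwp l hl
      rw [h, hpl] at hrl
      have hrx : boxRes q (a + 1, b, c) = w k := by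
        simp only [boxRes] at hrl ⊢; push_cast; linear_combination -hrl
      refine ⟨(a + 1, b, c), ⟨fun hmem => ?_, ?_, ?_⟩, hrx⟩
      · obtain ⟨t, ht, hpt⟩ := mem_boxShape.1 hmem
        have h1 := hp.le_of_le ht hl hpt hpl (by omega) le_rfl
        have h2 : t ≠ l := by rintro rfl; rw [hpl] at hpt; simp at hpt
        exact (hmax t (by omega) ht).1 (by rw [hwp t ht, hpt, hrx])
      · rintro a' b' c' ⟨⟩; exact hmeml
      · rintro a' b' c' ⟨⟩
        by_contra hnot
        obtain ⟨l', hl'l, hpl'⟩ := hp.exists_le hl hpl (le_refl a) (Nat.le_succ b')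
        have hne' : l' ≠ l := by rintro rfl; rw [hpl] at hpl'; simp at hpl'
        have hl'k : l' < k := by omega
        have hwl' : w l' = w k := by
          rw [hwp l' hl'k, hpl', ← hrx]; simp only [boxRes]; push_cast; ring
        refine hfin l' (by omega) hwl' (Or.inl h) fun t ht1 ht2 => ⟨fun h1 => ?_, fun h1 => ?_⟩
        · obtain ⟨e1, e2⟩ := hres t (by omega) l hl 0 (by simp) (by rw [h1, h]; simp)
          obtain ⟨x, y, c', hpt⟩ : ∃ x y c, p t = (x, y, c) := ⟨_, _, _, rfl⟩
          simp only [hpt, hpl, content] at e1 e2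
          subst e1
          have hlt : x < a := by
            by_contra hge
            have := hp.le_of_le (by omega) hl hpt hpl (by omega) (by omega)
            omega
          have := hp.le_of_le hl'k (by omega) hpl' hpt (by omega) (by omega)
          omega
        · obtain ⟨e1, e2⟩ := hres t (by omega) l' hl'k (-1) (by simp)
            (by rw [h1, hwl']; push_cast; ring)
          obtain ⟨x, y, c', hpt⟩ : ∃ x y c, p t = (x, y, c) := ⟨_, _, _, rfl⟩
          simp only [hpt, hpl', content] at e1 e2
          subst e1
          rcases Nat.lt_or_ge a x with hx | hx
          · exact hnot (hlow _ _ _ (mem_boxShape.2 ⟨t, by omega, hpt⟩) _ hx _ (by omega))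
          · have := hp.le_of_le hl'k (by omega) hpl' hpt hx (by omega)
            omega
    · -- the box to the right of `p l`
      have hrl := hwp l hl
      rw [h, hpl] at hrl
      have hrx : boxRes q (a, b + 1, c) = w k := by
        simp only [boxRes] at hrl ⊢; push_cast; linear_combination -hrl
      refine ⟨(a, b + 1, c), ⟨fun hmem => ?_, ?_, ?_⟩, hrx⟩
      · obtain ⟨t, ht, hpt⟩ := mem_boxShape.1 hmem
        have h1 := hp.le_of_le ht hl hpt hpl le_rfl (by omega)
        have h2 : t ≠ l := by rintro rfl; rw [hpl] at hpt; simp at hpt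
        exact (hmax t (by omega) ht).1 (by rw [hwp t ht, hpt, hrx])
      · rintro a' b' c' ⟨⟩
        by_contra hnot
        obtain ⟨l', hl'l, hpl'⟩ := hp.exists_le hl hpl (Nat.le_succ a') (le_refl b)
        have hne' : l' ≠ l := by rintro rfl; rw [hpl] at hpl'; simp at hpl'
        have hl'k : l' < k := by omega
        have hwl' : w l' = w k := by
          rw [hwp l' hl'k, hpl', ← hrx]; simp only [boxRes]; push_cast; ring
        refine hfin l' (by omega) hwl' (Or.inr h) fun t ht1 ht2 => ⟨fun h1 => ?_, fun h1 => ?_⟩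
        · obtain ⟨e1, e2⟩ := hres t (by omega) l' hl'k 1 (by simp)
            (by rw [h1, hwl']; push_cast; ring)
          obtain ⟨x, y, c', hpt⟩ : ∃ x y c, p t = (x, y, c) := ⟨_, _, _, rfl⟩
          simp only [hpt, hpl', content] at e1 e2
          subst e1
          rcases Nat.lt_or_ge b y with hx | hx
          · exact hnot (hlow _ _ _ (mem_boxShape.2 ⟨t, by omega, hpt⟩) _ (by omega) _ hx)
          · have := hp.le_of_le hl'k (by omega) hpl' hpt (by omega) hx
            omega
        · obtain ⟨e1, e2⟩ := hres t (by omega) l hl 0 (by simp) (by rw [h1, h]; simp)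
          obtain ⟨x, y, c', hpt⟩ : ∃ x y c, p t = (x, y, c) := ⟨_, _, _, rfl⟩
          simp only [hpt, hpl, content] at e1 e2
          subst e1
          have hlt : y < b := by
            by_contra hge
            have := hp.le_of_le (by omega) hl hpt hpl (by omega) (by omega)
            omega
          have := hp.le_of_le hl'k (by omega) hpl' hpt (by omega) (by omega)
          omega
      · rintro a' b' c' ⟨⟩; exact hmeml

end Spectrum

/-! ### Joint eigenvectors of the Jucys-Murphy elements -/

section Weights

variable {K : Type*} [Field K] {m n : ℕ} {A : Type*} [Ring A] [Algebra K A]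

/-- Elements `J 0, …, J (n - 1)` and `s 0, …, s (n - 2)` of an algebra which satisfy the relations
of the Jucys-Murphy elements and of the Coxeter generators of the degenerate cyclotomic Hecke
algebra. -/
structure IsJucysMurphy (n : ℕ) (q : Fin m → K) (J s : ℕ → A) : Prop where
  cyclotomic : (List.ofFn fun c => J 0 - algebraMap K A (q c)).prod = 0
  sq : ∀ i, i + 1 < n → s i * s i = 1
  braid : ∀ i, i + 2 < n → s i * s (i + 1) * s i = s (i + 1) * s i * s (i + 1)
  comm : ∀ i j, i + 1 < j → j + 1 < n → Commute (s i) (s j)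
  jm_comm : ∀ i j, i < n → j < n → Commute (J i) (J j)
  jm_succ : ∀ i, i + 1 < n → J (i + 1) = s i * J i * s i + s i
  s_comm : ∀ i j, i + 1 < n → j < n → j ≠ i → j ≠ i + 1 → Commute (s i) (J j)

/-- `x` is a joint eigenvector of the left multiplications by `J 0, …, J (k - 1)`, with
eigenvalues `w 0, …, w (k - 1)`; it may vanish. -/
def IsWeight (J : ℕ → A) (k : ℕ) (w : ℕ → K) (x : A) : Prop := ∀ i < k, J i * x = w i • x

variable {q : Fin m → K} {J s : ℕ → A}

theorem IsWeight.mono {k l : ℕ} {w : ℕ → K} {x : A} (h : IsWeight J k w x) (hl : l ≤ k) :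
    IsWeight J l w x := fun i hi => h i (hi.trans_le hl)

theorem IsWeight.congr {k : ℕ} {w w' : ℕ → K} {x : A} (h : IsWeight J k w x)
    (hw : ∀ i < k, w i = w' i) : IsWeight J k w' x := fun i hi => by rw [h i hi, hw i hi]

theorem IsWeight.mul_left {k : ℕ} {w : ℕ → K} {x a : A} (h : IsWeight J k w x)
    (ha : ∀ i < k, Commute (J i) a) : IsWeight J k w (a * x) := fun i hi => by
  rw [← mul_assoc, (ha i hi).eq, mul_assoc, h i hi, mul_smul_comm]

theorem IsWeight.mul_right {k : ℕ} {w : ℕ → K} {x : A} (h : IsWeight J k w x) (a : A) :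
    IsWeight J k w (x * a) := fun i hi => by
  rw [← mul_assoc, h i hi, smul_mul_assoc]

theorem IsWeight.extend {k : ℕ} {w : ℕ → K} {x : A} (h : IsWeight J k w x) {a : K}
    (ha : J k * x = a • x) : IsWeight J (k + 1) (Function.update w k a) x := fun i hi => by
  rcases Nat.lt_succ_iff_lt_or_eq.1 hi with h1 | rfl
  · rw [Function.update_of_ne h1.ne, h i h1]
  · rw [Function.update_self, ha]

open Polynomial in
theorem aeval_mul_of_mul_eq_smul {y x : A} {a : K} (h : y * x = a • x) (f : K[X]) :
    aeval y f * x = f.eval a • x := by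
  induction f using Polynomial.induction_on' with
  | add f g hf hg => rw [map_add, add_mul, hf, hg, eval_add, add_smul]
  | monomial i c =>
    rw [aeval_monomial, eval_monomial, mul_assoc]
    have : y ^ i * x = a ^ i • x := by
      induction i with
      | zero => simp
      | succ i ih => rw [pow_succ, mul_assoc, h, mul_smul_comm, ih, smul_smul, pow_succ']
    rw [this, mul_smul_comm, ← Algebra.smul_def, smul_smul, mul_comm]

open Polynomial in
theorem commute_aeval {x y : A} (h : Commute x y) (f : K[X]) : Commute x (aeval y f) := by
  induction f using Polynomial.induction_on' with
  | add f g hf hg => rw [map_add]; exact hf.add_right hg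
  | monomial i c =>
    rw [aeval_monomial]
    exact (Algebra.commute_algebraMap_right c x).mul_right (h.pow_right i)

open Polynomial in
/-- The Lagrange basis polynomial at `b` projects to the eigenspace of `b`. -/
theorem mul_aeval_basis_mul {ι : Type*} [DecidableEq ι] {S : Finset ι} {r : ι → K} {y x : A}
    (h : aeval y (∏ i ∈ S, (X - C (r i))) * x = 0) {i : ι} (hi : i ∈ S) :
    y * (aeval y (Lagrange.basis S r i) * x) = r i • (aeval y (Lagrange.basis S r i) * x) := by
  have h1 : (X - C (r i)) * Lagrange.basis S r i =
      C (∏ j ∈ S.erase i, (r i - r j)⁻¹) * ∏ j ∈ S, (X - C (r j)) := by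
    rw [← Finset.mul_prod_erase S _ hi, Lagrange.basis, map_prod]
    simp only [Lagrange.basisDivisor]
    rw [Finset.prod_mul_distrib]
    ring
  have h2 := congrArg (fun f => aeval y f * x) h1
  simp only [map_mul, map_sub, aeval_X, aeval_C, mul_assoc] at h2
  rw [h, mul_zero, sub_mul, sub_eq_zero] at h2
  rw [h2, ← Algebra.smul_def]

open Polynomial in
/-- If a polynomial with distinct roots kills `x`, and only the roots `r i` with `i ∈ S` can have
nonzero eigenvectors among the multiples of `x`, then the product over these roots kills `x`. -/
theorem aeval_prod_mul_eq_zero {ι : Type*} {S : Finset ι} {r : ι → K} {R : Finset K} {y x : A}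
    (h : aeval y (∏ b ∈ R, (X - C b)) * x = 0)
    (h' : ∀ b ∈ R, ∀ f : K[X], y * (aeval y f * x) = b • (aeval y f * x) →
      aeval y f * x ≠ 0 → ∃ i ∈ S, r i = b) :
    aeval y (∏ i ∈ S, (X - C (r i))) * x = 0 := by
  classical
  rcases R.eq_empty_or_nonempty with rfl | hne
  · simp only [Finset.prod_empty, map_one, one_mul] at h
    rw [h, mul_zero]
  have h1 : ∑ b ∈ R, aeval y (Lagrange.basis R id b) * x = x := by
    rw [← Finset.sum_mul, ← map_sum, Lagrange.sum_basis Function.injective_id.injOn hne, map_one,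
      one_mul]
  rw [← h1, Finset.mul_sum]
  refine Finset.sum_eq_zero fun b hb => ?_
  have h2 := mul_aeval_basis_mul (r := id) h hb
  by_cases h0 : aeval y (Lagrange.basis R id b) * x = 0
  · rw [h0, mul_zero]
  · obtain ⟨i, hi, rfl⟩ := h' b hb _ h2 h0
    rw [aeval_mul_of_mul_eq_smul h2, eval_prod, Finset.prod_eq_zero hi (by simp), zero_smul]

open Polynomial in
/-- There are no Jordan blocks when a polynomial without multiple roots vanishes. -/
theorem eq_zero_of_aeval_prod {ι : Type*} {S : Finset ι} {r : ι → K} (hr : Set.InjOn r S)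
    {y x z : A} {a : K} (h : aeval y (∏ i ∈ S, (X - C (r i))) * x = 0)
    (hz : y * x = a • x + z) (hz' : y * z = a • z) : z = 0 := by
  classical
  -- `f(y) x = f(a) x + f'(a) z` for every polynomial `f`
  have key : ∀ f : K[X], aeval y f * x = f.eval a • x + f.derivative.eval a • z := by
    intro f
    induction f using Polynomial.induction_on' with
    | add f g hf hg =>
      simp only [map_add, add_mul, hf, hg, eval_add, add_smul]; abel
    | monomial i c =>
      have : y ^ i * x = a ^ i • x + ((i : K) * a ^ (i - 1)) • z := by
        induction i with
        | zero => simp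
        | succ i ih =>
          have hp : y ^ i * z = a ^ i • z := by
            simpa using aeval_mul_of_mul_eq_smul hz' (X ^ i)
          rw [pow_succ, mul_assoc, hz, mul_add, mul_smul_comm, ih, smul_add, smul_smul, smul_smul,
            hp, ← pow_succ', add_assoc, ← add_smul]
          congr 2
          rcases i with _ | i
          · simp
          · simp only [Nat.add_sub_cancel]; push_cast; ring
      rw [aeval_monomial, mul_assoc, this, ← Algebra.smul_def, derivative_monomial, eval_monomial,
        eval_monomial, smul_add, smul_smul, smul_smul]
      congr 2
      ring
  have h2 : ∀ f : K[X], aeval y f * z = f.eval a • z := aeval_mul_of_mul_eq_smul hz'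
  by_cases haS : ∃ i ∈ S, r i = a
  · obtain ⟨i, hi, rfl⟩ := haS
    have h3 := key (∏ i ∈ S, (X - C (r i)))
    have h4 : ∏ i ∈ S, (X - C (r i)) = (X - C (r i)) * ∏ j ∈ S.erase i, (X - C (r j)) :=
      (Finset.mul_prod_erase S _ hi).symm
    rw [h, h4, derivative_mul] at h3
    simp only [derivative_X_sub_C, one_mul, eval_add, eval_mul, eval_sub, eval_X, eval_C, sub_self,
      zero_mul, zero_smul, zero_add, add_zero] at h3
    refine (smul_eq_zero.1 h3.symm).resolve_left ?_
    rw [eval_prod]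
    refine Finset.prod_ne_zero_iff.2 fun j hj => ?_
    simp only [eval_sub, eval_X, eval_C]
    rw [Finset.mem_erase] at hj
    exact sub_ne_zero.2 fun h => hj.1 (hr hj.2 hi h.symm)
  · have h3 : (∏ i ∈ S, (X - C (r i))).eval a ≠ 0 := by
      rw [eval_prod]
      refine Finset.prod_ne_zero_iff.2 fun j hj => ?_
      simp only [eval_sub, eval_X, eval_C]
      exact sub_ne_zero.2 fun h => haS ⟨j, hj, h.symm⟩
    have h4 : z = y * x - a • x := by rw [hz]; abel
    have h5 : aeval y (∏ i ∈ S, (X - C (r i))) * z = 0 := by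
      have hc : Commute (aeval y (∏ i ∈ S, (X - C (r i)))) y :=
        (commute_aeval (Commute.refl y) _).symm
      rw [h4, mul_sub, ← mul_assoc, hc.eq, mul_assoc, h, mul_smul_comm, h]; simp
    rw [h2] at h5
    exact (smul_eq_zero.1 h5).resolve_left h3

namespace IsJucysMurphy

variable (hJ : IsJucysMurphy n q J s)
include hJ

theorem s_mul_jm_succ {i : ℕ} (hi : i + 1 < n) : s i * J (i + 1) = J i * s i + 1 := by
  rw [hJ.jm_succ i hi, mul_add, ← mul_assoc, ← mul_assoc, hJ.sq i hi, one_mul]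

theorem jm_succ_mul_s {i : ℕ} (hi : i + 1 < n) : J (i + 1) * s i = s i * J i + 1 := by
  rw [hJ.jm_succ i hi, add_mul, mul_assoc, hJ.sq i hi, mul_one]

theorem jm_mul_s {i : ℕ} (hi : i + 1 < n) : J i * s i = s i * J (i + 1) - 1 := by
  rw [hJ.s_mul_jm_succ hi, add_sub_cancel_right]

/-- The basic intertwining relation: `s i + 1 / (w i - w (i + 1))` exchanges two eigenvalues. -/
theorem isWeight_swap {k i : ℕ} (hk : k ≤ n) (hi : i + 1 < k) {w : ℕ → K} {x : A}
    (hx : IsWeight J k w x) (hne : w i ≠ w (i + 1)) :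
    IsWeight J k (w ∘ Equiv.swap i (i + 1)) (s i * x + (w i - w (i + 1))⁻¹ • x) := by
  have h0 : w i - w (i + 1) ≠ 0 := sub_ne_zero.2 hne
  have ha := hx i (by omega)
  have hb := hx (i + 1) hi
  have hin : i + 1 < n := by omega
  have hinv : (w i - w (i + 1)) * (w i - w (i + 1))⁻¹ = 1 := mul_inv_cancel₀ h0
  intro j hj
  rcases eq_or_ne j i with rfl | h1
  · rw [Function.comp, Equiv.swap_apply_left, mul_add, ← mul_assoc, hJ.jm_mul_s hin, sub_mul,
      mul_assoc, hb, mul_smul_comm, mul_smul_comm, ha, one_mul]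
    linear_combination (norm := module) hinv • x
  rcases eq_or_ne j (i + 1) with rfl | h2
  · rw [Function.comp, Equiv.swap_apply_right, mul_add, ← mul_assoc, hJ.jm_succ_mul_s hin, add_mul,
      mul_assoc, ha, mul_smul_comm, mul_smul_comm, hb, one_mul]
    linear_combination (norm := module) -hinv • x
  · rw [Function.comp, Equiv.swap_apply_of_ne_of_ne h1 h2, mul_add, ← mul_assoc,
      ← (hJ.s_comm i j hin (by omega) h1 h2).eq, mul_assoc, hx j hj, mul_smul_comm, mul_smul_comm,
      hx j hj]
    module

/-- The shift of eigenvalues by `s i` is not zero unless the two eigenvalues differ by `1`. -/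
theorem swap_ne_zero {i : ℕ} (hi : i + 1 < n) {a b : K} {x : A} (hx : x ≠ 0)
    (h1 : b ≠ a + 1) (h2 : b ≠ a - 1) : s i * x + (a - b)⁻¹ • x ≠ 0 := by
  intro h
  have h3 : s i * x = -(a - b)⁻¹ • x := by rw [neg_smul]; exact eq_neg_of_add_eq_zero_left h
  have h4 : x = ((a - b)⁻¹ * (a - b)⁻¹) • x := by
    calc x = s i * (s i * x) := by rw [← mul_assoc, hJ.sq i hi, one_mul]
      _ = _ := by rw [h3, mul_smul_comm, h3, smul_smul]; congr 1; ring
  have h5 : (1 - (a - b)⁻¹ * (a - b)⁻¹) • x = 0 := by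
    rw [sub_smul, one_smul, ← h4, sub_self]
  have h6 := (smul_eq_zero.1 h5).resolve_right hx
  have h7 : a - b ≠ 0 := fun h8 => by simp [h8] at h6
  field_simp at h6
  have h8 : (b - (a + 1)) * (b - (a - 1)) = 0 := by linear_combination h6
  rcases mul_eq_zero.1 h8 with h9 | h9
  · exact h1 (sub_eq_zero.1 h9)
  · exact h2 (sub_eq_zero.1 h9)

theorem isWeight_s_mul {i : ℕ} (hi : i + 1 < n) {w : ℕ → K} {x : A} (hx : IsWeight J i w x) :
    IsWeight J i w (s i * x) :=
  hx.mul_left fun j hj => (hJ.s_comm i j hi (by omega) (by omega) (by omega)).symm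

end IsJucysMurphy

open Polynomial in
/-- On joint eigenvectors with the residues of a standard tableau with `k` entries as eigenvalues,
`J k` is diagonalizable, the eigenvalues being residues of addable boxes. -/
def IsDiagonal (q : Fin m → K) (J : ℕ → A) (k : ℕ) : Prop :=
  ∀ p, Std k p → ∀ x, IsWeight J k (boxRes q ∘ p) x →
    aeval (J k) (∏ i ∈ addables (boxShape p k), (X - C (boxRes q i))) * x = 0

theorem IsSeparated.injOn_addables (hq : IsSeparated n q) {k : ℕ} (hk : k < n) {p : ℕ → Box m}
    (hp : Std k p) : Set.InjOn (boxRes q) (addables (boxShape p k)) := fun x hx y hy h =>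
  hq.addable_inj hp.isLower (by rw [hp.card]; omega) ((mem_addables hp.isLower).1 hx)
    ((mem_addables hp.isLower).1 hy) h

theorem exists_std_of_isDiagonal [Nonempty (Fin m)] {k : ℕ} (hD : ∀ j < k, IsDiagonal q J j) {w : ℕ → K} {x : A}
    (hx : IsWeight J k w x) (hx0 : x ≠ 0) : ∃ p, Std k p ∧ ∀ i < k, w i = boxRes q (p i) := by
  induction k with
  | zero =>
    exact ⟨fun _ => (0, 0, Classical.arbitrary _), fun i hi => absurd hi (Nat.not_lt_zero i),
      fun i hi => absurd hi (Nat.not_lt_zero i)⟩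
  | succ k ih =>
    obtain ⟨p, hp, hw⟩ := ih (fun j hj => hD j (by omega)) (hx.mono k.le_succ)
    have h1 := hD k k.lt_succ_self p hp x ((hx.mono k.le_succ).congr hw)
    rw [aeval_mul_of_mul_eq_smul (hx k k.lt_succ_self), Polynomial.eval_prod] at h1
    obtain ⟨y, hy, h2⟩ := Finset.prod_eq_zero_iff.1 ((smul_eq_zero.1 h1).resolve_right hx0)
    rw [mem_addables hp.isLower] at hy
    refine ⟨_, hp.update hy, fun i hi => ?_⟩
    rcases Nat.lt_succ_iff_lt_or_eq.1 hi with h3 | rfl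
    · rw [Function.update_of_ne h3.ne, hw i h3]
    · rw [Function.update_self]
      simpa [sub_eq_zero] using h2

namespace IsJucysMurphy

variable (hJ : IsJucysMurphy n q J s)
include hJ

theorem eq_zero_of_eq [Nonempty (Fin m)] (hq : IsSeparated n q) {k i : ℕ} (hD : ∀ j ≤ i, IsDiagonal q J j)
    (hi : i + 1 < k) (hk : k ≤ n) {w : ℕ → K} {x : A} (hx : IsWeight J k w x)
    (h : w i = w (i + 1)) : x = 0 := by
  have hin : i + 1 < n := by omega
  by_contra hx0
  have ha := hx i (by omega)
  have hb := hx (i + 1) hi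
  have hy0 : s i * x ≠ 0 := fun h0 => hx0 <| by
    rw [← one_mul x, ← hJ.sq i hin, mul_assoc, h0, mul_zero]
  have hy := hJ.isWeight_s_mul hin (hx.mono (by omega))
  obtain ⟨p, hp, hw⟩ := exists_std_of_isDiagonal (fun j hj => hD j hj.le) hy hy0
  refine hx0 (neg_eq_zero.1 ?_)
  refine eq_zero_of_aeval_prod (hq.injOn_addables (by omega) hp)
    (hD i le_rfl p hp (s i * x) (hy.congr hw)) (a := w i) ?_ ?_
  · rw [← mul_assoc, hJ.jm_mul_s hin, sub_mul, mul_assoc, hb, mul_smul_comm, one_mul, h,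
      sub_eq_add_neg]
  · rw [mul_neg, ha, smul_neg]

/-- The sequences of joint eigenvalues on nonzero vectors have the properties that force residue
sequences of standard tableaux. -/
theorem isSpectral [Nonempty (Fin m)] (hq : IsSeparated n q) {k : ℕ} (hk : k < n)
    (hD : ∀ j < k, IsDiagonal q J j) :
    IsSpectral q (k + 1) fun w => ∃ x : A, x ≠ 0 ∧ IsWeight J (k + 1) w x where
  zero := by
    rintro w ⟨x, hx0, hx⟩
    have h1 := hx 0 k.succ_pos
    have h2 : ∀ l : List K, (l.map fun c => J 0 - algebraMap K A c).prod * x =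
        (l.map fun c => w 0 - c).prod • x := by
      intro l
      induction l with
      | nil => simp
      | cons c l ih =>
        rw [List.map_cons, List.prod_cons, mul_assoc, ih, mul_smul_comm, sub_mul, h1,
          ← Algebra.smul_def, ← sub_smul, smul_smul, List.map_cons, List.prod_cons, mul_comm]
    have h3 := h2 (List.ofFn q)
    rw [List.map_ofFn] at h3
    have h4 := hJ.cyclotomic
    rw [show (List.ofFn ((fun c => J 0 - algebraMap K A c) ∘ q)).prod = 0 from h4, zero_mul] at h3
    have h5 := List.prod_eq_zero_iff.1 ((smul_eq_zero.1 h3.symm).resolve_right hx0)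
    simp only [List.map_ofFn, List.mem_ofFn, Function.comp, sub_eq_zero] at h5
    exact h5
  ne_succ := by
    rintro w i ⟨x, hx0, hx⟩ hi h
    exact hx0 (hJ.eq_zero_of_eq hq (fun j hj => hD j (by omega)) hi hk hx h)
  swap := by
    rintro w i ⟨x, hx0, hx⟩ hi h1 h2
    have hne : w i ≠ w (i + 1) := fun h =>
      hx0 (hJ.eq_zero_of_eq hq (fun j hj => hD j (by omega)) hi hk hx h)
    exact ⟨_, hJ.swap_ne_zero (by omega) hx0 h1 h2, hJ.isWeight_swap hk hi hx hne⟩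
  not_triple := by
    rintro w i ⟨x, hx0, hx⟩ hi h
    rw [← not_or]
    intro h1
    have hD' : ∀ i, i + 1 < k + 1 → ∀ j ≤ i, IsDiagonal q J j := fun i hi j hj => hD j (by omega)
    have hn1 : w i ≠ w (i + 1) := fun h =>
      hx0 (hJ.eq_zero_of_eq hq (hD' i (by omega)) (by omega) hk hx h)
    have hn2 : w (i + 1) ≠ w (i + 1 + 1) := fun h =>
      hx0 (hJ.eq_zero_of_eq hq (hD' (i + 1) hi) hi hk hx h)
    -- both exchanges would lead to two equal neighbours, so they give zero
    have e1 := hJ.eq_zero_of_eq hq (hD' (i + 1) hi) hi hk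
      (hJ.isWeight_swap hk (by omega : i + 1 < k + 1) hx hn1)
      (by rw [Function.comp, Function.comp, Equiv.swap_apply_right, swap_apply_of_gt (by omega), h])
    have e2 := hJ.eq_zero_of_eq hq (hD' i (by omega)) (by omega : i + 1 < k + 1) hk
      (hJ.isWeight_swap hk hi hx hn2)
      (by rw [Function.comp, Function.comp, Equiv.swap_apply_left, swap_apply_of_lt (by omega),
        ← h])
    rw [show i + 1 + 1 = i + 2 from rfl, h] at e2
    set d := w i - w (i + 1) with hd
    have f1 : s i * x = -d⁻¹ • x := by rw [neg_smul]; exact eq_neg_of_add_eq_zero_left e1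
    have f2 : s (i + 1) * x = d⁻¹ • x := by
      rw [eq_neg_of_add_eq_zero_left e2, ← neg_smul, ← neg_sub (w i), inv_neg, neg_neg]
    have hdd : d⁻¹ * d⁻¹ = 1 := by
      have : d = -1 ∨ d = 1 := by
        rcases h1 with h1 | h1
        · left; rw [hd, h1]; ring
        · right; rw [hd, h1]; ring
      rcases this with h | h <;> rw [h] <;> norm_num
    -- `s i` and `s (i + 1)` act on `x` by opposite signs, against the braid relation as `2 ≠ 0`
    have hb := congrArg (· * x) (hJ.braid i (by omega))
    simp only [mul_assoc, f1, f2, mul_smul_comm, smul_smul] at hb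
    have h2 : (2 : K) • x = 0 := by
      have h3 : d⁻¹ ≠ 0 := fun h => by simp [h] at hdd
      have h4 : (2 * d⁻¹) • x = 0 := by
        have h5 : (d⁻¹ * d⁻¹ * d⁻¹ + d⁻¹ * d⁻¹ * d⁻¹) • x = 0 := by
          rw [add_smul]
          nth_rewrite 1 [show d⁻¹ * d⁻¹ * d⁻¹ = -d⁻¹ * (d⁻¹ * -d⁻¹) by ring]
          rw [hb, ← add_smul]
          convert zero_smul K x using 2
          ring
        rw [hdd, one_mul, ← two_mul] at h5
        exact h5
      rw [mul_comm, mul_smul] at h4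
      exact (smul_eq_zero.1 h4).resolve_left h3
    have h3 := hq.int_ne 2 (by norm_num) (by norm_num; omega)
    rw [Int.cast_ofNat] at h3
    exact hx0 ((smul_eq_zero.1 h2).resolve_left h3)

open Polynomial in
/-- The Jucys-Murphy elements act diagonalizably, and their joint eigenvalues are the residue
sequences of standard tableaux. -/
theorem isDiagonal [Nonempty (Fin m)] (hq : IsSeparated n q) {k : ℕ} (hk : k < n) :
    IsDiagonal q J k := by
  classical
  induction k using Nat.strong_induction_on with
  | _ k ih =>
  have hD : ∀ j < k, IsDiagonal q J j := fun j hj => ih j hj (hj.trans hk)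
  intro p hp x hx
  -- some polynomial in `J k` without multiple roots kills `x`
  obtain ⟨R, hR⟩ : ∃ R : Finset K, aeval (J k) (∏ b ∈ R, (X - C b)) * x = 0 := by
    rcases k with _ | k
    · have hinj : Function.Injective q := fun c c' h => by
        by_contra hne
        exact hq.sub_ne c c' hne 0 (by simp) (by simp [h])
      refine ⟨Finset.univ.image q, ?_⟩
      rw [Finset.prod_image hinj.injOn, ← List.prod_ofFn, map_list_prod, List.map_ofFn]
      have h4 := hJ.cyclotomic
      have h5 : (⇑(aeval (J 0)) ∘ fun i => X - C (q i)) = fun c => J 0 - algebraMap K A (q c) := by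
        funext c; simp
      rw [h5, h4, zero_mul]
    · have hp' := hp.mono k.le_succ
      set S := addables (boxShape p k)
      have hpS : p k ∈ S := (mem_addables hp'.isLower).2 (hp k k.lt_succ_self)
      have hS : ∀ b ∈ S, ∀ c ∈ S, boxRes q b ≠ boxRes q c + 1 := fun b hb c hc =>
        hq.addable_ne_add_one hp'.isLower (by rw [hp'.card]; omega)
          ((mem_addables hp'.isLower).1 hb) ((mem_addables hp'.isLower).1 hc)
      have hinj := hq.injOn_addables (by omega) hp'
      set a := boxRes q (p k) with ha
      have h2 : (2 : K) ≠ 0 := by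
        simpa using hq.int_ne 2 (by norm_num) (by norm_num; omega)
      have hnot1 : a + 1 ∉ insert (a - 1) (S.image (boxRes q)) := by
        rw [Finset.mem_insert, Finset.mem_image]
        rintro (h | ⟨b, hb, h⟩)
        · exact h2 (by linear_combination h)
        · exact hS b hb _ hpS h
      have hnot2 : a - 1 ∉ S.image (boxRes q) := by
        rw [Finset.mem_image]
        rintro ⟨b, hb, h⟩
        exact hS _ hpS b hb (by rw [h, ← ha]; ring)
      -- `a ± 1` are the eigenvalues of `J (k + 1)` where the intertwiner may vanish
      refine ⟨insert (a + 1) (insert (a - 1) (S.image (boxRes q))), ?_⟩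
      rw [Finset.prod_insert hnot1, Finset.prod_insert hnot2, Finset.prod_image hinj]
      set f : K[X] := ∏ b ∈ S, (X - C (boxRes q b))
      -- the intertwiner `u` moves the spectrum of `J (k + 1)` into the one of `J k`
      obtain ⟨u, hu⟩ : ∃ u, u = s k * (J k - J (k + 1)) + 1 := ⟨_, rfl⟩
      have hkn : k + 1 < n := hk
      have hc := hJ.jm_comm k (k + 1) (by omega) hk
      have hJu : J k * u = u * J (k + 1) := by
        have h3 := hJ.jm_mul_s hkn
        have h4 := hc.eq
        calc J k * u = J k * s k * (J k - J (k + 1)) + J k := by rw [hu]; noncomm_ring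
          _ = s k * (J (k + 1) * J k) - s k * J (k + 1) * J (k + 1) + J (k + 1) := by
            rw [h3]; noncomm_ring
          _ = _ := by rw [← h4, hu]; noncomm_ring
      have hJu' : J (k + 1) * u = u * J k := by
        have h3 := hJ.jm_succ_mul_s hkn
        have h4 := hc.eq
        calc J (k + 1) * u = J (k + 1) * s k * (J k - J (k + 1)) + J (k + 1) := by
              rw [hu]; noncomm_ring
          _ = s k * J k * J k - s k * (J k * J (k + 1)) + J k := by
            rw [h3]; noncomm_ring
          _ = _ := by rw [h4, hu]; noncomm_ring
      have hpoly : ∀ g : K[X], aeval (J k) g * u = u * aeval (J (k + 1)) g := by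
        intro g
        induction g using Polynomial.induction_on' with
        | add g g' h h' => rw [map_add, map_add, add_mul, mul_add, h, h']
        | monomial i c =>
          have : J k ^ i * u = u * J (k + 1) ^ i := (SemiconjBy.pow_right hJu.symm i).symm
          rw [aeval_monomial, aeval_monomial, mul_assoc, this, ← mul_assoc, Algebra.commutes,
            mul_assoc]
      have huu : u * u = 1 - (J k - J (k + 1)) * (J k - J (k + 1)) := by
        calc u * u = s k * (J k * u - J (k + 1) * u) + u := by
              nth_rewrite 1 [hu]; noncomm_ring
          _ = s k * u * (J (k + 1) - J k) + u := by rw [hJu, hJu']; noncomm_ring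
          _ = s k * s k * (J k - J (k + 1)) * (J (k + 1) - J k) + 1 := by
              rw [hu]; noncomm_ring
          _ = _ := by rw [hJ.sq k hkn]; noncomm_ring
      have hux : IsWeight J k (boxRes q ∘ p) (u * x) := (hx.mono k.le_succ).mul_left fun i hi => by
        rw [hu]
        exact ((hJ.s_comm k i hkn (by omega) (by omega) (by omega)).symm.mul_right
          ((hJ.jm_comm i k (by omega) (by omega)).sub_right
            (hJ.jm_comm i (k + 1) (by omega) hk))).add_right (Commute.one_right _)
      have h5 := hD k k.lt_succ_self p hp' _ hux
      rw [← mul_assoc, hpoly, mul_assoc] at h5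
      have h6 := congrArg (u * ·) h5
      simp only [mul_zero] at h6
      rw [← mul_assoc, huu] at h6
      have h7 : J k * (aeval (J (k + 1)) f * x) = a • (aeval (J (k + 1)) f * x) := by
        rw [← mul_assoc, (commute_aeval hc f).eq, mul_assoc, hx k k.lt_succ_self, mul_smul_comm]
        rfl
      rw [map_mul, map_mul, mul_assoc, mul_assoc]
      generalize aeval (J (k + 1)) f * x = z at h6 h7
      have h8 : J k * (J (k + 1) * z) = a • (J (k + 1) * z) := by
        rw [← mul_assoc, hc.eq, mul_assoc, h7, mul_smul_comm]
      simp only [map_sub, aeval_X, aeval_C, sub_mul, mul_sub, ← Algebra.smul_def, mul_smul_comm,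
        one_mul, mul_assoc, h7, h8] at h6 ⊢
      linear_combination (norm := module) -h6
  -- an eigenvalue that does occur is the residue of an addable box
  refine aeval_prod_mul_eq_zero hR fun b hb f h1 h2 => ?_
  have hy : IsWeight J k (boxRes q ∘ p) (aeval (J k) f * x) := hx.mul_left fun i hi =>
    commute_aeval (hJ.jm_comm i k (by omega) hk) f
  obtain ⟨y, hy1, hy2⟩ := (hJ.isSpectral hq hk hD).exists_addable hq hk hp
    ⟨_, h2, hy.extend h1⟩ fun i hi => by rw [Function.update_of_ne hi.ne]; rfl
  exact ⟨y, (mem_addables hp.isLower).2 hy1, by rw [hy2, Function.update_self]⟩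

end IsJucysMurphy

end Weights

/-! ### The idempotents of standard tableaux -/

section Idempotents

variable {K : Type*} [Field K] {m n : ℕ} {A : Type*} [Ring A] [Algebra K A]
  {q : Fin m → K} {J s : ℕ → A}

/-- The projection to the joint eigenvectors of `J 0, …, J (k - 1)` with the residues of the first
`k` boxes of `p` as eigenvalues: at each step the interpolation polynomial of `J k` which singles
out the box `p k` among all addable boxes. -/
noncomputable def tabIdem (q : Fin m → K) (J : ℕ → A) (p : ℕ → Box m) : ℕ → A
  | 0 => 1
  | k + 1 => tabIdem q J p k *
      Polynomial.aeval (J k) (Lagrange.basis (addables (boxShape p k)) (boxRes q) (p k))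

theorem tabIdem_congr {p p' : ℕ → Box m} {k : ℕ} (h : ∀ i < k, p i = p' i) :
    tabIdem q J p k = tabIdem q J p' k := by
  induction k with
  | zero => rfl
  | succ k ih =>
    rw [tabIdem, tabIdem, ih fun i hi => h i (by omega), h k k.lt_succ_self,
      boxShape_congr fun i hi => h i (by omega)]

theorem commute_tabIdem (p : ℕ → Box m) {k : ℕ} {x : A} (h : ∀ i < k, Commute x (J i)) :
    Commute x (tabIdem q J p k) := by
  induction k with
  | zero => exact Commute.one_right x
  | succ k ih =>
    exact (ih fun i hi => h i (by omega)).mul_right (commute_aeval (h k k.lt_succ_self) _)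

open Polynomial in
theorem mul_aeval_of_mul_eq_smul {y x : A} {a : K} (h : x * y = a • x) (f : K[X]) :
    x * aeval y f = f.eval a • x := by
  induction f using Polynomial.induction_on' with
  | add f g hf hg => rw [map_add, mul_add, hf, hg, eval_add, add_smul]
  | monomial i c =>
    rw [aeval_monomial, eval_monomial, Algebra.commutes, ← mul_assoc]
    have : x * y ^ i = a ^ i • x := by
      induction i with
      | zero => simp
      | succ i ih => rw [pow_succ, ← mul_assoc, ih, smul_mul_assoc, h, smul_smul, pow_succ]
    rw [this, smul_mul_assoc, ← Algebra.commutes, ← Algebra.smul_def, smul_smul, mul_comm]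

theorem eval_basis_self (hq : IsSeparated n q) {k : ℕ} (hk : k < n) {p : ℕ → Box m}
    (hp : Std (k + 1) p) :
    (Lagrange.basis (addables (boxShape p k)) (boxRes q) (p k)).eval (boxRes q (p k)) = 1 := by
  have hp' := hp.mono k.le_succ
  exact Lagrange.eval_basis_self (hq.injOn_addables hk hp')
    ((mem_addables hp'.isLower).2 (hp k k.lt_succ_self))

theorem tabIdem_mul_eq_self (hq : IsSeparated n q) {k : ℕ} (hk : k ≤ n) {p : ℕ → Box m}
    (hp : Std k p) {x : A} (hx : IsWeight J k (boxRes q ∘ p) x) : tabIdem q J p k * x = x := by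
  induction k with
  | zero => exact one_mul x
  | succ k ih =>
    rw [tabIdem, mul_assoc, aeval_mul_of_mul_eq_smul (hx k k.lt_succ_self), Function.comp,
      eval_basis_self hq hk hp, one_smul]
    exact ih (by omega) (hp.mono k.le_succ) (hx.mono k.le_succ)

theorem mul_tabIdem_eq_self (hq : IsSeparated n q) {k : ℕ} (hk : k ≤ n) {p : ℕ → Box m}
    (hp : Std k p) {x : A} (hx : ∀ i < k, x * J i = boxRes q (p i) • x) :
    x * tabIdem q J p k = x := by
  induction k with
  | zero => exact mul_one x
  | succ k ih =>
    rw [tabIdem, ← mul_assoc, ih (by omega) (hp.mono k.le_succ) fun i hi => hx i (by omega),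
      mul_aeval_of_mul_eq_smul (hx k k.lt_succ_self), eval_basis_self hq hk hp, one_smul]

/-- The subalgebra generated by the first `k - 1` Coxeter generators. -/
def coxeterAlg (K : Type*) [Field K] {A : Type*} [Ring A] [Algebra K A] (s : ℕ → A) (k : ℕ) :
    Subalgebra K A :=
  Algebra.adjoin K {x | ∃ i, i + 1 < k ∧ s i = x}

/-- The subalgebra generated by the first `k` Jucys-Murphy elements and the first `k - 1` Coxeter
generators. -/
def heckeAlg (K : Type*) [Field K] {A : Type*} [Ring A] [Algebra K A] (J s : ℕ → A) (k : ℕ) :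
    Subalgebra K A :=
  Algebra.adjoin K ({x | ∃ i, i < k ∧ J i = x} ∪ {x | ∃ i, i + 1 < k ∧ s i = x})

theorem s_mem_coxeterAlg {k i : ℕ} (hi : i + 1 < k) : s i ∈ coxeterAlg K s k :=
  Algebra.subset_adjoin ⟨i, hi, rfl⟩

theorem coxeterAlg_mono {k l : ℕ} (h : k ≤ l) : coxeterAlg K s k ≤ coxeterAlg K s l :=
  Algebra.adjoin_mono fun _ ⟨i, hi, hx⟩ => ⟨i, by omega, hx⟩

theorem coxeterAlg_le_heckeAlg (k : ℕ) : coxeterAlg K s k ≤ heckeAlg K J s k :=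
  Algebra.adjoin_mono fun _ h => Or.inr h

theorem coxeterAlg_one : coxeterAlg K s 1 = ⊥ := by
  rw [coxeterAlg, show {x | ∃ i, i + 1 < 1 ∧ s i = x} = (∅ : Set A) by ext; simp,
    Algebra.adjoin_empty]

theorem heckeAlg_zero : heckeAlg K J s 0 = ⊥ := by
  rw [heckeAlg, show {x | ∃ i, i < 0 ∧ J i = x} ∪ {x | ∃ i, i + 1 < 0 ∧ s i = x} = (∅ : Set A) by
    ext; simp, Algebra.adjoin_empty]

theorem commute_of_mem_coxeterAlg {k : ℕ} {x b : A} (hx : ∀ i, i + 1 < k → Commute x (s i))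
    (hb : b ∈ coxeterAlg K s k) : Commute x b := by
  induction hb using Algebra.adjoin_induction with
  | mem y hy => obtain ⟨i, hi, rfl⟩ := hy; exact hx i hi
  | algebraMap r => exact Algebra.commute_algebraMap_right r x
  | add y z _ _ hy hz => exact hy.add_right hz
  | mul y z _ _ hy hz => exact hy.mul_right hz

theorem tabIdem_mem_heckeAlg (p : ℕ → Box m) (k : ℕ) : tabIdem q J p k ∈ heckeAlg K J s k := by
  have key : ∀ l ≤ k, tabIdem q J p l ∈ heckeAlg K J s k := by
    intro l hl
    induction l with
    | zero => exact one_mem _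
    | succ l ih =>
      refine mul_mem (ih (by omega)) ?_
      have hl' : J l ∈ heckeAlg K J s k := Algebra.subset_adjoin (Or.inl ⟨l, hl, rfl⟩)
      exact Algebra.adjoin_le (Set.singleton_subset_iff.2 hl')
        (Polynomial.aeval_mem_adjoin_singleton K (J l))
  exact key k le_rfl

/-- An element with right eigenvalue `a` times one with left eigenvalue `b ≠ a` is zero. -/
theorem mul_eq_zero_of_ne {x y z : A} {a b : K} (hz : z * x = a • z)
    (hy : x * y = b • y) (h : a ≠ b) : z * y = 0 := by
  have h1 : (a - b) • (z * y) = 0 := by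
    rw [sub_smul, ← smul_mul_assoc, ← hz, mul_assoc, hy, mul_smul_comm, sub_self]
  exact (smul_eq_zero.1 h1).resolve_left (sub_ne_zero.2 h)

/-- The elements of `coxeterAlg K s (k + 1)` and the double coset of `s k`. -/
def cosetSpan (K : Type*) [Field K] {A : Type*} [Ring A] [Algebra K A]
    (s : ℕ → A) (k : ℕ) : Submodule K A :=
  Subalgebra.toSubmodule (coxeterAlg K s (k + 1)) ⊔
    Submodule.span K {x | ∃ u ∈ coxeterAlg K s (k + 1), ∃ v ∈ coxeterAlg K s (k + 1),
      u * s k * v = x}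

theorem cosetSpan_induction {k : ℕ} {C : A → Prop}
    (h1 : ∀ b ∈ coxeterAlg K s (k + 1), C b)
    (h2 : ∀ u ∈ coxeterAlg K s (k + 1), ∀ v ∈ coxeterAlg K s (k + 1), C (u * s k * v))
    (hadd : ∀ x y, C x → C y → C (x + y)) (hsmul : ∀ (r : K) x, C x → C (r • x)) {x : A}
    (hx : x ∈ cosetSpan K s k) : C x := by
  obtain ⟨y, hy, z, hz, rfl⟩ := Submodule.mem_sup.1 hx
  clear hx
  refine hadd _ _ (h1 y hy) ?_
  induction hz using Submodule.span_induction with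
  | mem x hx => obtain ⟨u, hu, v, hv, rfl⟩ := hx; exact h2 u hu v hv
  | zero => exact h1 0 (zero_mem _)
  | add x y _ _ hx hy => exact hadd _ _ hx hy
  | smul r x _ hx => exact hsmul _ _ hx

theorem mem_cosetSpan_of_mem {k : ℕ} {b : A} (hb : b ∈ coxeterAlg K s (k + 1)) :
    b ∈ cosetSpan K s k :=
  Submodule.mem_sup_left hb

theorem mul_mem_cosetSpan {k : ℕ} {u v : A} (hu : u ∈ coxeterAlg K s (k + 1))
    (hv : v ∈ coxeterAlg K s (k + 1)) : u * s k * v ∈ cosetSpan K s k :=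
  Submodule.mem_sup_right (Submodule.subset_span ⟨u, hu, v, hv, rfl⟩)

namespace IsJucysMurphy

variable (hJ : IsJucysMurphy n q J s)
include hJ

theorem isWeight_tabIdem [Nonempty (Fin m)] (hq : IsSeparated n q) {k : ℕ} (hk : k ≤ n)
    {p : ℕ → Box m} (hp : Std k p) : IsWeight J k (boxRes q ∘ p) (tabIdem q J p k) := by
  induction k with
  | zero => exact fun i hi => absurd hi (Nat.not_lt_zero i)
  | succ k ih =>
    have hp' := hp.mono k.le_succ
    have h1 := ih (by omega) hp'
    have hc : tabIdem q J p (k + 1) =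
        Polynomial.aeval (J k) (Lagrange.basis (addables (boxShape p k)) (boxRes q) (p k)) *
          tabIdem q J p k :=
      ((commute_tabIdem p fun i hi =>
        (commute_aeval (hJ.jm_comm i k (by omega) hk) _).symm).eq).symm
    intro i hi
    rcases Nat.lt_succ_iff_lt_or_eq.1 hi with h | rfl
    · exact h1.mul_right _ i h
    · rw [hc]
      exact mul_aeval_basis_mul (hJ.isDiagonal hq hk p hp' _ h1)
        ((mem_addables hp'.isLower).2 (hp i i.lt_succ_self))

theorem commute_jm_tabIdem (p : ℕ → Box m) {i k : ℕ} (hi : i < n) (hk : k ≤ n) :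
    Commute (J i) (tabIdem q J p k) :=
  commute_tabIdem p fun j hj => hJ.jm_comm i j hi (by omega)

theorem tabIdem_mul_jm [Nonempty (Fin m)] (hq : IsSeparated n q) {k : ℕ} (hk : k ≤ n)
    {p : ℕ → Box m} (hp : Std k p) {i : ℕ} (hi : i < k) :
    tabIdem q J p k * J i = boxRes q (p i) • tabIdem q J p k := by
  rw [← (hJ.commute_jm_tabIdem p (by omega) hk).eq]
  exact hJ.isWeight_tabIdem hq hk hp i hi

theorem tabIdem_mul_self [Nonempty (Fin m)] (hq : IsSeparated n q) {k : ℕ} (hk : k ≤ n)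
    {p : ℕ → Box m} (hp : Std k p) : tabIdem q J p k * tabIdem q J p k = tabIdem q J p k :=
  tabIdem_mul_eq_self hq hk hp (hJ.isWeight_tabIdem hq hk hp)

/-- The idempotent of a tableau is the sum over its extensions by one box. -/
theorem sum_tabIdem_update (hq : IsSeparated n q) [Nonempty (Fin m)] {k : ℕ} (hk : k < n)
    {p : ℕ → Box m} (hp : Std k p) :
    ∑ x ∈ addables (boxShape p k), tabIdem q J (Function.update p k x) (k + 1) =
      tabIdem q J p k := by
  have hE : ∀ x, ∀ i < k, Function.update p k x i = p i := fun x i hi =>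
    Function.update_of_ne hi.ne _ _
  simp only [tabIdem, Function.update_self, tabIdem_congr (hE _), boxShape_congr (hE _)]
  rw [← Finset.mul_sum, ← map_sum]
  rcases (addables (boxShape p k)).eq_empty_or_nonempty with h0 | hne
  · -- without addable boxes the empty product kills the idempotent
    have h1 := hJ.isDiagonal hq hk p hp _ (hJ.isWeight_tabIdem hq hk.le hp)
    rw [h0, Finset.prod_empty, map_one, one_mul] at h1
    rw [h1, zero_mul]
  · rw [Lagrange.sum_basis (hq.injOn_addables hk hp) hne, map_one, mul_one]

/-- The unit is the sum of the idempotents of all standard tableaux with `k` entries. -/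
theorem exists_sum_tabIdem_eq_one (hq : IsSeparated n q) [Nonempty (Fin m)] {k : ℕ} (hk : k ≤ n) :
    ∃ (ι : Type) (_ : Fintype ι) (P : ι → ℕ → Box m), (∀ i, Std k (P i)) ∧
      ∑ i, tabIdem q J (P i) k = 1 := by
  induction k with
  | zero =>
    exact ⟨Unit, inferInstance, fun _ _ => (0, 0, Classical.arbitrary _),
      fun i j hj => absurd hj (Nat.not_lt_zero j), by simp [tabIdem]⟩
  | succ k ih =>
    obtain ⟨ι, _, P, hP, hsum⟩ := ih (by omega)
    refine ⟨Σ i, addables (boxShape (P i) k), inferInstance,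
      fun x => Function.update (P x.1) k x.2, fun x => ?_, ?_⟩
    · exact (hP x.1).update ((mem_addables (hP x.1).isLower).1 x.2.2)
    · rw [Fintype.sum_sigma, ← hsum]
      refine Finset.sum_congr rfl fun i _ => ?_
      rw [← hJ.sum_tabIdem_update hq hk (hP i)]
      exact Finset.sum_coe_sort (addables (boxShape (P i) k))
        fun x => tabIdem q J (Function.update (P i) k x) (k + 1)

/-- On joint eigenvectors of the Jucys-Murphy elements the algebra acts through the group algebra
of the symmetric group. -/
theorem exists_coxeterAlg_mul_eq {k : ℕ} (hk : k ≤ n) {w : ℕ → K} {e : A}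
    (he : IsWeight J k w e) {a : A} (ha : a ∈ heckeAlg K J s k) :
    ∃ b ∈ coxeterAlg K s k, a * e = b * e := by
  let M : Submodule K A := (Subalgebra.toSubmodule (coxeterAlg K s k)).map (LinearMap.mulRight K e)
  have hM : ∀ x, x ∈ M ↔ ∃ b ∈ coxeterAlg K s k, b * e = x := fun x => by
    simp [M, Submodule.mem_map]
  have hs : ∀ i, i + 1 < k → ∀ x ∈ M, s i * x ∈ M := by
    intro i hi x hx
    obtain ⟨b, hb, rfl⟩ := (hM x).1 hx
    exact (hM _).2 ⟨s i * b, mul_mem (s_mem_coxeterAlg hi) hb, mul_assoc _ _ _⟩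
  -- moving `J i` past a Coxeter generator costs a term without Jucys-Murphy elements
  have hB : ∀ b ∈ coxeterAlg K s k, ∀ x ∈ M, (∀ i < k, J i * x ∈ M) →
      b * x ∈ M ∧ ∀ i < k, J i * (b * x) ∈ M := by
    intro b hb
    induction hb using Algebra.adjoin_induction with
    | mem y hy =>
      obtain ⟨l, hl, rfl⟩ := hy
      intro x hx hJx
      refine ⟨hs l hl x hx, fun i hi => ?_⟩
      have hln : l + 1 < n := by omega
      rcases eq_or_ne i l with rfl | h1
      · rw [← mul_assoc, hJ.jm_mul_s hln, sub_mul, one_mul, mul_assoc]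
        exact M.sub_mem (hs _ hl _ (hJx _ hl)) hx
      rcases eq_or_ne i (l + 1) with rfl | h2
      · rw [← mul_assoc, hJ.jm_succ_mul_s hln, add_mul, one_mul, mul_assoc]
        exact M.add_mem (hs _ hl _ (hJx _ (by omega))) hx
      · rw [← mul_assoc, ← (hJ.s_comm l i hln (by omega) h1 h2).eq, mul_assoc]
        exact hs _ hl _ (hJx _ hi)
    | algebraMap r =>
      intro x hx hJx
      simp only [← Algebra.smul_def, mul_smul_comm]
      exact ⟨M.smul_mem _ hx, fun i hi => M.smul_mem _ (hJx i hi)⟩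
    | add y z _ _ hy hz =>
      intro x hx hJx
      have h1 := hy x hx hJx
      have h2 := hz x hx hJx
      simp only [add_mul, mul_add]
      exact ⟨M.add_mem h1.1 h2.1, fun i hi => M.add_mem (h1.2 i hi) (h2.2 i hi)⟩
    | mul y z _ _ hy hz =>
      intro x hx hJx
      have h2 := hz x hx hJx
      rw [mul_assoc]
      exact hy _ h2.1 h2.2
  have heM : e ∈ M := (hM e).2 ⟨1, one_mem _, one_mul e⟩
  have hJM : ∀ i < k, ∀ x ∈ M, J i * x ∈ M := by
    intro i hi x hx
    obtain ⟨b, hb, rfl⟩ := (hM x).1 hx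
    refine (hB b hb e heM fun j hj => ?_).2 i hi
    rw [he j hj]
    exact M.smul_mem _ heM
  have hA : ∀ x ∈ M, a * x ∈ M := by
    induction ha using Algebra.adjoin_induction with
    | mem y hy =>
      rcases hy with ⟨i, hi, rfl⟩ | ⟨i, hi, rfl⟩
      · exact hJM i hi
      · exact hs i hi
    | algebraMap r =>
      intro x hx
      rw [← Algebra.smul_def]
      exact M.smul_mem _ hx
    | add y z _ _ hy hz => exact fun x hx => by rw [add_mul]; exact M.add_mem (hy x hx) (hz x hx)
    | mul y z _ _ hy hz => exact fun x hx => by rw [mul_assoc]; exact hy _ (hz x hx)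
  obtain ⟨b, hb, h⟩ := (hM _).1 (hA e heM)
  exact ⟨b, hb, h.symm⟩

/-- The double coset decomposition of the symmetric group with respect to the stabilizer of one
letter. -/
theorem mem_cosetSpan {k : ℕ} (hk : k + 2 ≤ n) {b : A} (hb : b ∈ coxeterAlg K s (k + 2)) :
    b ∈ cosetSpan K s k := by
  have hmul : ∀ k, ∀ u ∈ coxeterAlg K s (k + 1), ∀ x ∈ cosetSpan K s k,
      u * x ∈ cosetSpan K s k := by
    intro k u hu x hx
    refine cosetSpan_induction (C := fun x => u * x ∈ cosetSpan K s k) ?_ ?_ ?_ ?_ hx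
    · exact fun b hb => mem_cosetSpan_of_mem (mul_mem hu hb)
    · intro u' hu' v hv
      rw [← mul_assoc, ← mul_assoc]
      exact mul_mem_cosetSpan (mul_mem hu hu') hv
    · exact fun x y hx hy => by rw [mul_add]; exact add_mem hx hy
    · exact fun r x hx => by rw [mul_smul_comm]; exact Submodule.smul_mem _ _ hx
  have hmul' : ∀ k, ∀ u ∈ coxeterAlg K s (k + 1), ∀ x ∈ cosetSpan K s k,
      x * u ∈ cosetSpan K s k := by
    intro k u hu x hx
    refine cosetSpan_induction (C := fun x => x * u ∈ cosetSpan K s k) ?_ ?_ ?_ ?_ hx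
    · exact fun b hb => mem_cosetSpan_of_mem (mul_mem hb hu)
    · intro u' hu' v hv
      rw [mul_assoc]
      exact mul_mem_cosetSpan hu' (mul_mem hv hu)
    · exact fun x y hx hy => by rw [add_mul]; exact add_mem hx hy
    · exact fun r x hx => by rw [smul_mul_assoc]; exact Submodule.smul_mem _ _ hx
  -- it suffices that the double coset is stable under conjugation by `s k`
  have hred : ∀ k, (∀ u ∈ coxeterAlg K s (k + 1), s k * u * s k ∈ cosetSpan K s k) →
      ∀ b ∈ coxeterAlg K s (k + 2), b ∈ cosetSpan K s k := by
    intro k hconj b hb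
    have key : ∀ x ∈ cosetSpan K s k, b * x ∈ cosetSpan K s k := by
      induction hb using Algebra.adjoin_induction with
      | mem y hy =>
        obtain ⟨i, hi, rfl⟩ := hy
        rcases Nat.lt_or_ge i k with h | h
        · exact hmul k _ (s_mem_coxeterAlg (by omega))
        · obtain rfl : i = k := by omega
          intro x hx
          refine cosetSpan_induction (C := fun x => s i * x ∈ cosetSpan K s i) ?_ ?_ ?_ ?_ hx
          · intro b hb
            rw [← one_mul (s i)]
            exact mul_mem_cosetSpan (one_mem _) hb
          · intro u hu v hv
            rw [← mul_assoc, ← mul_assoc]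
            exact hmul' i v hv _ (hconj u hu)
          · exact fun x y hx hy => by rw [mul_add]; exact add_mem hx hy
          · exact fun r x hx => by rw [mul_smul_comm]; exact Submodule.smul_mem _ _ hx
      | algebraMap r =>
        intro x hx
        rw [← Algebra.smul_def]
        exact Submodule.smul_mem _ _ hx
      | add y z _ _ hy hz => exact fun x hx => by rw [add_mul]; exact add_mem (hy x hx) (hz x hx)
      | mul y z _ _ hy hz => exact fun x hx => by rw [mul_assoc]; exact hy _ (hz x hx)
    have := key 1 (mem_cosetSpan_of_mem (one_mem _))
    rwa [mul_one] at this
  induction k generalizing b with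
  | zero =>
    refine hred 0 (fun u hu => ?_) b hb
    rw [zero_add, coxeterAlg_one, Algebra.mem_bot] at hu
    obtain ⟨r, rfl⟩ := hu
    rw [mul_assoc, Algebra.commutes, ← mul_assoc, hJ.sq 0 (by omega), one_mul]
    exact mem_cosetSpan_of_mem (algebraMap_mem _ r)
  | succ k ih =>
    refine hred (k + 1) (fun u hu => ?_) b hb
    have hc : ∀ b ∈ coxeterAlg K s (k + 1), s (k + 1) * b = b * s (k + 1) := fun b hb =>
      (commute_of_mem_coxeterAlg (fun i hi =>
        (hJ.comm i (k + 1) (by omega) (by omega)).symm) hb).eq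
    have hle : coxeterAlg K s (k + 1) ≤ coxeterAlg K s (k + 1 + 1) :=
      coxeterAlg_mono (Nat.le_succ _)
    refine cosetSpan_induction (C := fun u => s (k + 1) * u * s (k + 1) ∈ cosetSpan K s (k + 1))
      ?_ ?_ ?_ ?_ (ih (by omega) hu)
    · intro b hb
      rw [hc b hb, mul_assoc, hJ.sq (k + 1) (by omega), mul_one]
      exact mem_cosetSpan_of_mem (hle hb)
    · intro u hu v hv
      have h1 : s (k + 1) * (u * s k * v) * s (k + 1) = u * s k * s (k + 1) * (s k * v) := by
        calc s (k + 1) * (u * s k * v) * s (k + 1)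
            = (s (k + 1) * u) * s k * (v * s (k + 1)) := by noncomm_ring
          _ = u * (s (k + 1) * s k * s (k + 1)) * v := by
            rw [hc u hu, ← hc v hv]; noncomm_ring
          _ = _ := by rw [← hJ.braid k (by omega)]; noncomm_ring
      rw [h1]
      have hsk : s k ∈ coxeterAlg K s (k + 1 + 1) := s_mem_coxeterAlg (by omega)
      exact mul_mem_cosetSpan (mul_mem (hle hu) hsk) (mul_mem hsk (hle hv))
    · exact fun x y hx hy => by rw [mul_add, add_mul]; exact add_mem hx hy
    · exact fun r x hx => by
        rw [mul_smul_comm, smul_mul_assoc]; exact Submodule.smul_mem _ _ hx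

/-- Between idempotents of standard tableaux, the algebra is one-dimensional if the tableaux agree,
and zero if their shapes differ. The induction inserts the sum of all idempotents of level `k`
next to the double coset representative `s (k - 1)`, whose action on joint eigenvectors is known. -/
theorem tabIdem_mul_mul_aux [Nonempty (Fin m)] (hq : IsSeparated n q) {k : ℕ} (hk : k ≤ n) :
    (∀ p, Std k p → ∀ a ∈ heckeAlg K J s k, ∃ r : K,
      tabIdem q J p k * a * tabIdem q J p k = r • tabIdem q J p k) ∧
    (∀ p p', Std k p → Std k p' → boxShape p' k ≠ boxShape p k → ∀ a ∈ heckeAlg K J s k,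
      tabIdem q J p' k * a * tabIdem q J p k = 0) := by
  induction k with
  | zero =>
    constructor
    · intro p _ a ha
      rw [heckeAlg_zero, Algebra.mem_bot] at ha
      obtain ⟨r, rfl⟩ := ha
      exact ⟨r, by rw [tabIdem, one_mul, mul_one, Algebra.algebraMap_eq_smul_one]⟩
    · exact fun p p' _ _ h => absurd (by simp [boxShape]) h
  | succ k ih =>
    obtain ⟨ihP, ihQ⟩ := ih (by omega)
    have hkn : k < n := hk
    -- left and right factors of level `k`
    have hleft : ∀ p, Std (k + 1) p →
        tabIdem q J p k * tabIdem q J p (k + 1) = tabIdem q J p (k + 1) := fun p hp =>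
      tabIdem_mul_eq_self hq hkn.le (hp.mono k.le_succ)
        ((hJ.isWeight_tabIdem hq hk hp).mono k.le_succ)
    have hright : ∀ p, Std (k + 1) p →
        tabIdem q J p (k + 1) * tabIdem q J p k = tabIdem q J p (k + 1) := fun p hp =>
      mul_tabIdem_eq_self hq hkn.le (hp.mono k.le_succ)
        fun i hi => hJ.tabIdem_mul_jm hq hk hp (by omega)
    have hJc : ∀ b ∈ coxeterAlg K s k, Commute (J k) b := fun b hb =>
      commute_of_mem_coxeterAlg
        (fun i hi => (hJ.s_comm i k (by omega) hkn (by omega) (by omega)).symm) hb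
    -- both claims for the elements of level `k`
    have hP : ∀ p, Std (k + 1) p → ∀ a ∈ heckeAlg K J s k, ∃ r : K,
        tabIdem q J p (k + 1) * a * tabIdem q J p (k + 1) = r • tabIdem q J p (k + 1) := by
      intro p hp a ha
      obtain ⟨r, hr⟩ := ihP p (hp.mono k.le_succ) a ha
      refine ⟨r, ?_⟩
      calc tabIdem q J p (k + 1) * a * tabIdem q J p (k + 1)
          = tabIdem q J p (k + 1) * tabIdem q J p k * a *
              (tabIdem q J p k * tabIdem q J p (k + 1)) := by rw [hleft p hp, hright p hp]
        _ = tabIdem q J p (k + 1) * (tabIdem q J p k * a * tabIdem q J p k) *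
              tabIdem q J p (k + 1) := by noncomm_ring
        _ = _ := by
          rw [hr, mul_smul_comm, smul_mul_assoc, hright p hp, hJ.tabIdem_mul_self hq hk hp]
    have hQ : ∀ p p', Std (k + 1) p → Std (k + 1) p' → boxShape p' (k + 1) ≠ boxShape p (k + 1) →
        ∀ a ∈ heckeAlg K J s k, Commute (J k) a →
        tabIdem q J p' (k + 1) * a * tabIdem q J p (k + 1) = 0 := by
      intro p p' hp hp' hne a ha hca
      by_cases hsh : boxShape p' k = boxShape p k
      · have h1 : boxRes q (p' k) ≠ boxRes q (p k) := fun h => hne <| by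
          have h2 := hq.addable_inj (hp.mono k.le_succ).isLower
            (by rw [(hp.mono k.le_succ).card]; omega) (hsh ▸ hp' k k.lt_succ_self)
            (hp k k.lt_succ_self) h
          rw [boxShape_succ, boxShape_succ, hsh, h2]
        refine mul_eq_zero_of_ne (x := J k) ?_ (hJ.isWeight_tabIdem hq hk hp k k.lt_succ_self) h1
        rw [mul_assoc, ← hca.eq, ← mul_assoc, hJ.tabIdem_mul_jm hq hk hp' k.lt_succ_self,
          smul_mul_assoc]
      · rw [← hright p' hp', ← hleft p hp,
          show tabIdem q J p' (k + 1) * tabIdem q J p' k * a *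
            (tabIdem q J p k * tabIdem q J p (k + 1)) = tabIdem q J p' (k + 1) *
            (tabIdem q J p' k * a * tabIdem q J p k) * tabIdem q J p (k + 1) by noncomm_ring,
          ihQ p p' (hp.mono k.le_succ) (hp'.mono k.le_succ) hsh a ha, mul_zero, zero_mul]
    -- at the first level, the Coxeter generators contribute only scalars
    rcases k with _ | k
    · have hcox : ∀ p, Std 1 p → ∀ a ∈ heckeAlg K J s (0 + 1), ∃ b ∈ coxeterAlg K s 0,
          a * tabIdem q J p (0 + 1) = b * tabIdem q J p (0 + 1) := by
        intro p hp a ha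
        obtain ⟨b, hb, h⟩ := hJ.exists_coxeterAlg_mul_eq hk (hJ.isWeight_tabIdem hq hk hp) ha
        refine ⟨b, ?_, h⟩
        rw [zero_add, coxeterAlg_one] at hb
        exact (bot_le : ⊥ ≤ coxeterAlg K s 0) hb
      constructor
      · intro p hp a ha
        obtain ⟨b, hb, h⟩ := hcox p hp a ha
        rw [mul_assoc, h, ← mul_assoc]
        exact hP p hp b (coxeterAlg_le_heckeAlg _ hb)
      · intro p p' hp hp' hne a ha
        obtain ⟨b, hb, h⟩ := hcox p hp a ha
        rw [mul_assoc, h, ← mul_assoc]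
        exact hQ p p' hp hp' hne b (coxeterAlg_le_heckeAlg _ hb) (hJc b hb)
    obtain ⟨ι, _, T, hT, hsum⟩ := hJ.exists_sum_tabIdem_eq_one hq (k := k + 1) (by omega)
    -- the tableaux of level `k + 1` are extended by the last box of `p`
    have hext : ∀ p, Std (k + 2) p → ∀ i, boxShape (T i) (k + 1) = boxShape p (k + 1) →
        Std (k + 2) (Function.update (T i) (k + 1) (p (k + 1))) ∧
        boxShape (Function.update (T i) (k + 1) (p (k + 1))) (k + 2) = boxShape p (k + 2) := by
      intro p hp i hi
      refine ⟨(hT i).update (hi ▸ hp (k + 1) (by omega)), ?_⟩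
      rw [boxShape_update, hi, ← boxShape_succ]
    have hupd : ∀ (i : ι) (x : Box m), ∀ j < k + 1, Function.update (T i) (k + 1) x j = T i j :=
      fun i x j hj => Function.update_of_ne hj.ne _ _
    -- tableaux of level `k + 1` with another shape than the one below `p` do not contribute
    have hskip : ∀ v ∈ coxeterAlg K s (k + 1), ∀ p, Std (k + 2) p → ∀ i,
        boxShape (T i) (k + 1) ≠ boxShape p (k + 1) →
        tabIdem q J (T i) (k + 1) * v * tabIdem q J p (k + 2) = 0 := by
      intro v hv p hp i hne
      rw [← hleft p hp, ← mul_assoc, ihQ p (T i) (hp.mono (by omega)) (hT i) hne v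
        (coxeterAlg_le_heckeAlg _ hv), zero_mul]
    have hskip' : ∀ u ∈ coxeterAlg K s (k + 1), ∀ p, Std (k + 2) p → ∀ i,
        boxShape (T i) (k + 1) ≠ boxShape p (k + 1) →
        tabIdem q J p (k + 2) * u * tabIdem q J (T i) (k + 1) = 0 := by
      intro u hu p hp i hne
      rw [← hright p hp, mul_assoc _ _ u, mul_assoc, ihQ (T i) p (hT i) (hp.mono (by omega))
        hne.symm u (coxeterAlg_le_heckeAlg _ hu), mul_zero]
    have hy : ∀ v ∈ coxeterAlg K s (k + 1), ∀ p, Std (k + 2) p → ∀ i,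
        IsWeight J (k + 2) (boxRes q ∘ Function.update (T i) (k + 1) (p (k + 1)))
          (tabIdem q J (T i) (k + 1) * v * tabIdem q J p (k + 2)) := by
      intro v hv p hp i
      refine (((((hJ.isWeight_tabIdem hq (by omega) (hT i)).mul_right v).mul_right _).extend
        (a := boxRes q (p (k + 1))) ?_)).congr fun j hj => ?_
      · rw [← mul_assoc, ((hJ.commute_jm_tabIdem (T i) hkn (by omega)).mul_right (hJc v hv)).eq,
          mul_assoc, hJ.isWeight_tabIdem hq hk hp (k + 1) (by omega), mul_smul_comm]
        rfl
      · rcases eq_or_ne j (k + 1) with rfl | h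
        · simp
        · simp [Function.update_of_ne h]
    have hz : ∀ u ∈ coxeterAlg K s (k + 1), ∀ p, Std (k + 2) p →
        tabIdem q J p (k + 2) * u * J (k + 1) =
          boxRes q (p (k + 1)) • (tabIdem q J p (k + 2) * u) := by
      intro u hu p hp
      rw [mul_assoc, ← (hJc u hu).eq, ← mul_assoc, hJ.tabIdem_mul_jm hq hk hp (by omega),
        smul_mul_assoc]
    have hexp : ∀ u v x y : A, x * (u * s k * v) * y =
        ∑ i, x * u * (s k * (tabIdem q J (T i) (k + 1) * v * y)) := by
      intro u v x y
      calc x * (u * s k * v) * y = x * u * (s k * (1 * v * y)) := by noncomm_ring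
        _ = _ := by rw [← hsum]; simp only [Finset.sum_mul, Finset.mul_sum]
    have hne : ∀ p, Std (k + 2) p → ∀ i, boxShape (T i) (k + 1) = boxShape p (k + 1) →
        boxRes q (T i k) ≠ boxRes q (p (k + 1)) := by
      intro p hp i hi h
      have := hq.add_three_le (hext p hp i hi).1 hk (Nat.lt_succ_self k) (by omega)
        (by rw [hupd i _ k (by omega), Function.update_self]; exact h)
      omega
    -- the action of `s k` on a joint eigenvector, up to one with exchanged eigenvalues
    have hs : ∀ v ∈ coxeterAlg K s (k + 1), ∀ p, Std (k + 2) p → ∀ i,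
        boxShape (T i) (k + 1) = boxShape p (k + 1) → ∃ (r : K) (y' : A),
        s k * (tabIdem q J (T i) (k + 1) * v * tabIdem q J p (k + 2)) =
          r • (tabIdem q J (T i) (k + 1) * v * tabIdem q J p (k + 2)) + y' ∧
        IsWeight J (k + 2) (fun j => boxRes q
          (Function.update (T i) (k + 1) (p (k + 1)) (Equiv.swap k (k + 1) j))) y' := by
      intro v hv p hp i hi
      obtain ⟨c, h1⟩ : ∃ c : K, IsWeight J (k + 2) (fun j => boxRes q
          (Function.update (T i) (k + 1) (p (k + 1)) (Equiv.swap k (k + 1) j)))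
          (s k * (tabIdem q J (T i) (k + 1) * v * tabIdem q J p (k + 2)) +
            c • (tabIdem q J (T i) (k + 1) * v * tabIdem q J p (k + 2))) :=
        ⟨_, hJ.isWeight_swap hk (by omega : k + 1 < k + 2) (hy v hv p hp i)
          (by simpa [hupd] using hne p hp i hi)⟩
      exact ⟨-c, _, by module, h1⟩
    constructor
    · intro p hp a ha
      obtain ⟨b, hb, h⟩ := hJ.exists_coxeterAlg_mul_eq hk (hJ.isWeight_tabIdem hq hk hp) ha
      rw [mul_assoc, h, ← mul_assoc]
      refine cosetSpan_induction (C := fun b => ∃ r : K,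
        tabIdem q J p (k + 2) * b * tabIdem q J p (k + 2) = r • tabIdem q J p (k + 2)) ?_ ?_ ?_ ?_
        (hJ.mem_cosetSpan hk hb)
      · exact fun b hb => hP p hp b (coxeterAlg_le_heckeAlg _ hb)
      · intro u hu v hv
        have hterm : ∀ i, ∃ r : K, tabIdem q J p (k + 2) * u * (s k *
            (tabIdem q J (T i) (k + 1) * v * tabIdem q J p (k + 2))) =
              r • tabIdem q J p (k + 2) := by
          intro i
          by_cases hi : boxShape (T i) (k + 1) = boxShape p (k + 1)
          · obtain ⟨r, y', h1, h2⟩ := hs v hv p hp i hi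
            have h3 : tabIdem q J p (k + 2) * u * y' = 0 :=
              mul_eq_zero_of_ne (hz u hu p hp) (h2 (k + 1) (by omega))
                (by simpa [hupd] using (hne p hp i hi).symm)
            obtain ⟨r', h4⟩ := hP p hp (u * tabIdem q J (T i) (k + 1) * v)
              (mul_mem (mul_mem (coxeterAlg_le_heckeAlg _ hu) (tabIdem_mem_heckeAlg _ _))
                (coxeterAlg_le_heckeAlg _ hv))
            refine ⟨r * r', ?_⟩
            rw [h1, mul_add, h3, add_zero, mul_smul_comm, mul_smul, ← h4]
            congr 1
            noncomm_ring
          · exact ⟨0, by rw [hskip v hv p hp i hi, mul_zero, mul_zero, zero_smul]⟩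
        choose r hr using hterm
        exact ⟨∑ i, r i, by rw [hexp, Finset.sum_smul]; exact Finset.sum_congr rfl fun i _ => hr i⟩
      · rintro x y ⟨r, hr⟩ ⟨r', hr'⟩
        exact ⟨r + r', by rw [mul_add, add_mul, hr, hr', add_smul]⟩
      · rintro c x ⟨r, hr⟩
        exact ⟨c * r, by rw [mul_smul_comm, smul_mul_assoc, hr, smul_smul]⟩
    · intro p p' hp hp' hshape a ha
      obtain ⟨b, hb, h⟩ := hJ.exists_coxeterAlg_mul_eq hk (hJ.isWeight_tabIdem hq hk hp) ha
      rw [mul_assoc, h, ← mul_assoc]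
      refine cosetSpan_induction (C := fun b =>
        tabIdem q J p' (k + 2) * b * tabIdem q J p (k + 2) = 0) ?_ ?_ ?_ ?_
        (hJ.mem_cosetSpan hk hb)
      · exact fun b hb => hQ p p' hp hp' hshape b (coxeterAlg_le_heckeAlg _ hb) (hJc b hb)
      · intro u hu v hv
        rw [hexp]
        refine Finset.sum_eq_zero fun i _ => ?_
        by_cases hi : boxShape (T i) (k + 1) = boxShape p (k + 1)
        · obtain ⟨r, y', h1, h2⟩ := hs v hv p hp i hi
          have h3 : tabIdem q J p' (k + 2) * u * y' = 0 := by
            rw [← one_mul y', ← hsum, Finset.sum_mul, Finset.mul_sum]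
            refine Finset.sum_eq_zero fun j _ => ?_
            by_cases hj : boxShape (T j) (k + 1) = boxShape p' (k + 1)
            · -- otherwise the exchanged eigenvalues would be those of a tableau of the other shape
              obtain ⟨l, hl, hl'⟩ : ∃ l < k + 2,
                  boxRes q (Function.update (T j) (k + 1) (p' (k + 1)) l) ≠ boxRes q
                    (Function.update (T i) (k + 1) (p (k + 1)) (Equiv.swap k (k + 1) l)) := by
                by_contra! hall
                have h5 := hq.boxShape_eq_of_swap hk (hext p hp i hi).1 (hext p' hp' j hj).1 hall
                rw [(hext p hp i hi).2, (hext p' hp' j hj).2] at h5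
                exact hshape h5
              rw [← mul_assoc]
              refine mul_eq_zero_of_ne (x := J l) ?_ (h2 l hl) hl'
              rcases Nat.lt_succ_iff_lt_or_eq.1 hl with h5 | rfl
              · rw [hupd j _ l h5, mul_assoc, hJ.tabIdem_mul_jm hq (by omega) (hT j) h5,
                  mul_smul_comm]
              · rw [Function.update_self, mul_assoc,
                  ← (hJ.commute_jm_tabIdem (T j) hkn (by omega)).eq, ← mul_assoc, hz u hu p' hp',
                  smul_mul_assoc]
            · rw [← mul_assoc, hskip' u hu p' hp' j hj, zero_mul]
          have h4 : tabIdem q J p' (k + 2) * u *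
              (tabIdem q J (T i) (k + 1) * v * tabIdem q J p (k + 2)) = 0 := by
            have h5 := hQ p p' hp hp' hshape (u * tabIdem q J (T i) (k + 1) * v)
              (mul_mem (mul_mem (coxeterAlg_le_heckeAlg _ hu) (tabIdem_mem_heckeAlg _ _))
                (coxeterAlg_le_heckeAlg _ hv))
              (((hJc u hu).mul_right (hJ.commute_jm_tabIdem (T i) hkn (by omega))).mul_right
                (hJc v hv))
            rw [← h5]
            noncomm_ring
          rw [h1, mul_add, h3, add_zero, mul_smul_comm, h4, smul_zero]
        · rw [hskip v hv p hp i hi, mul_zero, mul_zero]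
      · intro x y hx hy
        rw [mul_add, add_mul, hx, hy, add_zero]
      · intro c x hx
        rw [mul_smul_comm, smul_mul_assoc, hx, smul_zero]

/-- The idempotent of a standard tableau is primitive, provided it does not vanish. -/
theorem isPrimitiveIdempotent_tabIdem [Nonempty (Fin m)] (hq : IsSeparated n q)
    (htop : heckeAlg K J s n = ⊤) {p : ℕ → Box m} (hp : Std n p) (h0 : tabIdem q J p n ≠ 0) :
    IsPrimitiveIdempotent (tabIdem q J p n) := by
  have hE := hJ.tabIdem_mul_self hq le_rfl hp
  refine ⟨h0, hE, fun x y hx hy hxy hyx hsum => ?_⟩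
  obtain ⟨r, hr⟩ := (hJ.tabIdem_mul_mul_aux hq le_rfl).1 p hp x (by rw [htop]; trivial)
  have h1 : tabIdem q J p n * x * tabIdem q J p n = x := by
    rw [← hsum, add_mul, hx.eq, hyx, add_zero, mul_add, hx.eq, hxy, add_zero]
  rw [h1] at hr
  have h2 : (r * r - r) • tabIdem q J p n = 0 := by
    have := hx.eq
    rw [hr, smul_mul_smul_comm, hE] at this
    rw [sub_smul, this, sub_self]
  have h3 : r * (r - 1) = 0 := by
    rw [← (smul_eq_zero.1 h2).resolve_right h0]; ring
  rcases mul_eq_zero.1 h3 with h | h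
  · left; rw [hr, h, zero_smul]
  · right
    rw [sub_eq_zero] at h
    rw [h, one_smul] at hr
    rw [hr] at hsum
    exact add_eq_left.1 hsum

end IsJucysMurphy

/-- A primitive idempotent with the eigenvalues of a standard tableau is the one constructed. -/
theorem eq_tabIdem (hq : IsSeparated n q) {p : ℕ → Box m} (hp : Std n p)
    (hprim : IsPrimitiveIdempotent (tabIdem q J p n)) {e : A} (he0 : e ≠ 0)
    (he : IsIdempotentElem e) (hl : IsWeight J n (boxRes q ∘ p) e)
    (hr : ∀ i < n, e * J i = boxRes q (p i) • e) : e = tabIdem q J p n := by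
  have h1 := tabIdem_mul_eq_self hq le_rfl hp hl
  have h2 := mul_tabIdem_eq_self hq le_rfl hp hr
  have hE := hprim.2.1
  have hf : IsIdempotentElem (tabIdem q J p n - e) := by
    rw [IsIdempotentElem, mul_sub, sub_mul, sub_mul, hE.eq, h1, h2, he.eq, sub_self, sub_zero]
  have h3 : e * (tabIdem q J p n - e) = 0 := by rw [mul_sub, h2, he.eq, sub_self]
  have h4 : (tabIdem q J p n - e) * e = 0 := by rw [sub_mul, h1, he.eq, sub_self]
  rcases hprim.2.2 e (tabIdem q J p n - e) he hf h3 h4 (by abel) with h | h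
  · exact absurd h he0
  · exact (sub_eq_zero.1 h).symm

end Idempotents

/-! ### The Jucys-Murphy elements of the Hecke algebra -/

section Relations

variable {K : Type*} [Field K] {m n : ℕ}

/-- The commutation relations of the Jucys-Murphy elements follow from those of the generators. -/
theorem IsJucysMurphy.of_relations {A : Type*} [Ring A] [Algebra K A] {q : Fin m → K} {J s : ℕ → A}
    (cyclotomic : (List.ofFn fun c => J 0 - algebraMap K A (q c)).prod = 0)
    (reflection : 1 < n → Commute (J 0) (J 1))
    (comm_zero : ∀ i, 1 ≤ i → i + 1 < n → Commute (J 0) (s i))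
    (sq : ∀ i, i + 1 < n → s i * s i = 1)
    (braid : ∀ i, i + 2 < n → s i * s (i + 1) * s i = s (i + 1) * s i * s (i + 1))
    (comm : ∀ i j, i + 1 < j → j + 1 < n → Commute (s i) (s j))
    (jm_succ : ∀ i, i + 1 < n → J (i + 1) = s i * J i * s i + s i) : IsJucysMurphy n q J s := by
  have h1 : ∀ j i, j < i → i + 1 < n → Commute (s i) (J j) := by
    intro j
    induction j with
    | zero => exact fun i hi hin => (comm_zero i hi hin).symm
    | succ j ih =>
      intro i hi hin
      have h2 := (comm j i hi hin).symm
      rw [jm_succ j (by omega)]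
      exact ((h2.mul_right (ih i (by omega) hin)).mul_right h2).add_right h2
  have h2 : ∀ i j, i + 1 < j → j < n → Commute (s i) (J j) := by
    intro i j hij
    induction j, hij using Nat.le_induction with
    | base =>
      intro hin
      have hb := braid i hin
      have hs := sq i (by omega)
      have hc := (h1 i (i + 1) (by omega) hin).eq
      rw [Nat.succ_eq_add_one, jm_succ (i + 1) hin, jm_succ i (by omega), Commute, SemiconjBy]
      have e1 : s i * (s (i + 1) * (s i * J i * s i) * s (i + 1)) =
          s (i + 1) * (s i * J i * s i) * s (i + 1) * s i := by
        calc s i * (s (i + 1) * (s i * J i * s i) * s (i + 1))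
            = (s i * s (i + 1) * s i) * J i * s i * s (i + 1) := by noncomm_ring
          _ = s (i + 1) * s i * (s (i + 1) * J i) * s i * s (i + 1) := by rw [hb]; noncomm_ring
          _ = s (i + 1) * s i * J i * (s (i + 1) * s i * s (i + 1)) := by rw [hc]; noncomm_ring
          _ = _ := by rw [← hb]; noncomm_ring
      have e2 : s i * (s (i + 1) * s i * s (i + 1) + s (i + 1)) =
          (s (i + 1) * s i * s (i + 1) + s (i + 1)) * s i := by
        calc s i * (s (i + 1) * s i * s (i + 1) + s (i + 1))
            = s i * (s (i + 1) * s i * s (i + 1)) + s i * s (i + 1) := by noncomm_ring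
          _ = s i * s i * s (i + 1) * s i + s i * s (i + 1) := by rw [← hb]; noncomm_ring
          _ = s (i + 1) * s i + s i * s (i + 1) * (s i * s i) := by rw [hs]; noncomm_ring
          _ = s (i + 1) * s i + (s i * s (i + 1) * s i) * s i := by noncomm_ring
          _ = _ := by rw [hb]; noncomm_ring
      calc s i * (s (i + 1) * (s i * J i * s i + s i) * s (i + 1) + s (i + 1))
          = s i * (s (i + 1) * (s i * J i * s i) * s (i + 1)) +
            s i * (s (i + 1) * s i * s (i + 1) + s (i + 1)) := by noncomm_ring
        _ = _ := by rw [e1, e2]; noncomm_ring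
    | succ j hij ih =>
      intro hin
      have h3 := comm i j hij hin
      rw [jm_succ j hin]
      exact ((h3.mul_right (ih (by omega))).mul_right h3).add_right h3
  have h3 : ∀ j i, j < i → i < n → Commute (J j) (J i) := by
    intro j
    induction j with
    | zero =>
      intro i hi
      induction i, hi using Nat.le_induction with
      | base => exact reflection
      | succ i hi ih =>
        intro hin
        have h4 := comm_zero i hi hin
        rw [jm_succ i hin]
        exact ((h4.mul_right (ih (by omega))).mul_right h4).add_right h4
    | succ j ih =>
      intro i hi hin
      have h4 := h2 j i hi hin
      rw [jm_succ j (by omega)]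
      exact ((h4.mul_left (ih i (by omega) hin)).mul_left h4).add_left h4
  refine ⟨cyclotomic, sq, braid, comm, fun i j hi hj => ?_, jm_succ, fun i j hi hj hne hne' => ?_⟩
  · rcases lt_trichotomy i j with h | rfl | h
    · exact h3 i j h hj
    · exact Commute.refl _
    · exact (h3 j i h hi).symm
  · rcases Nat.lt_or_ge j i with h | h
    · exact h1 j i h hi
    · exact h2 i j (by omega) hj

variable (q : Fin m → K)

/-- The Jucys-Murphy elements as a sequence indexed by all natural numbers, extended by zero. -/
noncomputable def jmSeq (n : ℕ) (q : Fin m → K) (k : ℕ) : Hecke n q :=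
  if h : k < n then jm q k h else 0

/-- The Coxeter generators as a sequence indexed by all natural numbers, extended by zero. -/
noncomputable def genSeq (n : ℕ) (q : Fin m → K) (k : ℕ) : Hecke n q :=
  if h : k + 1 < n then genS q k h else 0

theorem jmSeq_of_lt {k : ℕ} (h : k < n) : jmSeq n q k = jm q k h := dif_pos h

theorem genSeq_of_lt {k : ℕ} (h : k + 1 < n) : genSeq n q k = genS q k h := dif_pos h

theorem isJucysMurphy_hecke (hn : 0 < n) : IsJucysMurphy n q (jmSeq n q) (genSeq n q) := by
  have hrel : ∀ {x y}, Rel n q x y →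
      RingQuot.mkAlgHom K (Rel n q) x = RingQuot.mkAlgHom K (Rel n q) y :=
    fun h => RingQuot.mkAlgHom_rel K h
  have h0 : jmSeq n q 0 = genT n q := by rw [jmSeq_of_lt q hn, jm]
  have hsucc : ∀ i, i + 1 < n →
      jmSeq n q (i + 1) = genSeq n q i * jmSeq n q i * genSeq n q i + genSeq n q i := fun i hi => by
    rw [jmSeq_of_lt q hi, jmSeq_of_lt q (Nat.lt_of_succ_lt hi), genSeq_of_lt q hi, jm]
  refine IsJucysMurphy.of_relations ?_ ?_ ?_ ?_ ?_ ?_ hsucc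
  · have := hrel Rel.cyclotomic
    rw [map_list_prod, List.map_ofFn, map_zero] at this
    rw [h0, ← this]
    congr 2
    funext c
    simp [genT]
  · intro h
    have := hrel (Rel.reflection h)
    simp only [map_mul, map_add] at this
    rw [hsucc 0 h, h0, genSeq_of_lt q h]
    exact this
  · intro i hi h
    have := hrel (Rel.comm_t i hi h)
    simp only [map_mul] at this
    rw [h0, genSeq_of_lt q h]
    exact this
  · intro i h
    have := hrel (Rel.sq i h)
    rw [map_mul, map_one] at this
    rw [genSeq_of_lt q h]
    exact this
  · intro i h
    have := hrel (Rel.braid i (by omega) h)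
    simp only [map_mul] at this
    rw [genSeq_of_lt q h, genSeq_of_lt q (by omega)]
    exact this
  · intro i j hij h
    have := hrel (Rel.comm i j hij (by omega) h)
    simp only [map_mul] at this
    rw [genSeq_of_lt q h, genSeq_of_lt q (by omega)]
    exact this

theorem heckeAlg_eq_top (hn : 0 < n) : heckeAlg K (jmSeq n q) (genSeq n q) n = ⊤ := by
  have h1 : (Algebra.adjoin K (Set.range (FreeAlgebra.ι K : Gen n → _))).map
      (RingQuot.mkAlgHom K (Rel n q)) = ⊤ := by
    rw [FreeAlgebra.adjoin_range_ι, Algebra.map_top, AlgHom.range_eq_top]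
    exact RingQuot.mkAlgHom_surjective K (Rel n q)
  rw [eq_top_iff, ← h1, AlgHom.map_adjoin]
  refine Algebra.adjoin_mono ?_
  rintro _ ⟨_, ⟨g, rfl⟩, rfl⟩
  rcases g with _ | ⟨k, h⟩
  · exact Or.inl ⟨0, hn, by rw [jmSeq_of_lt q hn, jm]; rfl⟩
  · exact Or.inr ⟨k, h, by rw [genSeq_of_lt q h]; rfl⟩

end Relations

/-! ### Young's seminormal form -/

section Seminormal

variable {K : Type*} [Field K] {m n : ℕ}

/-- The coefficient with which `t_{k+1}` exchanges two consecutive eigenvalues `x`, `y`. It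
vanishes when they differ by `1`, so that only sequences of standard tableaux are reached. -/
noncomputable def swapCoeff (x y : K) : K :=
  open Classical in if y = x + 1 ∨ y = x - 1 then 0 else 1 + (y - x)⁻¹

theorem swapCoeff_mul {x y : K} (h : x ≠ y) :
    swapCoeff x y * swapCoeff y x = 1 - (y - x)⁻¹ * (y - x)⁻¹ := by
  have h1 : y - x ≠ 0 := sub_ne_zero.2 h.symm
  have h3 : (x - y)⁻¹ = -(y - x)⁻¹ := by rw [← inv_neg, neg_sub]
  by_cases hxy : y = x + 1 ∨ y = x - 1
  · rw [swapCoeff, if_pos hxy, zero_mul]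
    rcases hxy with rfl | rfl <;> simp
  · have hyx : ¬ (x = y + 1 ∨ x = y - 1) := by
      rintro (rfl | rfl) <;> simp at hxy
    rw [swapCoeff, swapCoeff, if_neg hxy, if_neg hyx, h3]
    ring

/-- The operator by which `t` acts on the space with one basis vector for each sequence. -/
noncomputable def semT (K : Type*) [Field K] : Module.End K ((ℕ → K) →₀ K) :=
  Finsupp.linearCombination K fun w => w 0 • Finsupp.single w 1

/-- The operator by which `t_{k+1}` acts on the space with one basis vector for each sequence of
eigenvalues of the Jucys-Murphy elements. The relations of the Hecke algebra only hold on the span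
of the residue sequences of standard tableaux. -/
noncomputable def semS (K : Type*) [Field K] (k : ℕ) : Module.End K ((ℕ → K) →₀ K) :=
  Finsupp.linearCombination K fun w => (w (k + 1) - w k)⁻¹ • Finsupp.single w 1 +
    swapCoeff (w k) (w (k + 1)) • Finsupp.single (w ∘ Equiv.swap k (k + 1)) 1

theorem semT_single (w : ℕ → K) : semT K (Finsupp.single w 1) = w 0 • Finsupp.single w 1 := by
  simp [semT]

theorem semS_single (k : ℕ) (w : ℕ → K) : semS K k (Finsupp.single w 1) =
    (w (k + 1) - w k)⁻¹ • Finsupp.single w 1 +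
      swapCoeff (w k) (w (k + 1)) • Finsupp.single (w ∘ Equiv.swap k (k + 1)) 1 := by
  rw [semS, Finsupp.linearCombination_single, one_smul]

theorem comp_swap_swap {α : Type*} (w : ℕ → α) (i j : ℕ) : (w ∘ Equiv.swap i j) ∘ Equiv.swap i j = w := by
  funext l; simp

theorem semS_semS {k : ℕ} {w : ℕ → K} (h : w k ≠ w (k + 1)) :
    semS K k (semS K k (Finsupp.single w 1)) = Finsupp.single w 1 := by
  rw [semS_single, map_add, map_smul, map_smul, semS_single, semS_single, comp_swap_swap]
  simp only [Function.comp, Equiv.swap_apply_left, Equiv.swap_apply_right]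
  have h3 : (w k - w (k + 1))⁻¹ = -(w (k + 1) - w k)⁻¹ := by rw [← inv_neg, neg_sub]
  rw [h3]
  linear_combination (norm := module) swapCoeff_mul h • (Finsupp.single w 1 : (ℕ → K) →₀ K)

theorem semS_comm {i j : ℕ} (hij : i + 1 < j) (w : ℕ → K) :
    semS K i (semS K j (Finsupp.single w 1)) = semS K j (semS K i (Finsupp.single w 1)) := by
  have hc : (w ∘ Equiv.swap i (i + 1)) ∘ Equiv.swap j (j + 1) =
      (w ∘ Equiv.swap j (j + 1)) ∘ Equiv.swap i (i + 1) := by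
    funext l
    simp only [Function.comp, Equiv.swap_apply_def]
    congr 1
    split_ifs <;> omega
  have e1 : Equiv.swap i (i + 1) j = j := swap_apply_of_gt hij
  have e2 : Equiv.swap i (i + 1) (j + 1) = j + 1 := swap_apply_of_gt (by omega)
  have e3 : Equiv.swap j (j + 1) i = i := swap_apply_of_lt (by omega)
  have e4 : Equiv.swap j (j + 1) (i + 1) = i + 1 := swap_apply_of_lt (by omega)
  simp only [semS_single, map_add, map_smul, hc, Function.comp_apply, e1, e2, e3, e4]
  module

theorem semS_braid {k : ℕ} {w : ℕ → K} (h1 : w k ≠ w (k + 1)) (h2 : w (k + 1) ≠ w (k + 2))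
    (h3 : w k ≠ w (k + 2)) :
    semS K k (semS K (k + 1) (semS K k (Finsupp.single w 1))) =
      semS K (k + 1) (semS K k (semS K (k + 1) (Finsupp.single w 1))) := by
  have hc : ((w ∘ Equiv.swap k (k + 1)) ∘ Equiv.swap (k + 1) (k + 2)) ∘ Equiv.swap k (k + 1) =
      ((w ∘ Equiv.swap (k + 1) (k + 2)) ∘ Equiv.swap k (k + 1)) ∘
        Equiv.swap (k + 1) (k + 2) := by
    funext l
    simp only [Function.comp, Equiv.swap_apply_def]
    congr 1
    split_ifs <;> omega
  have e1 : Equiv.swap k (k + 1) (k + 2) = k + 2 := swap_apply_of_gt (by omega)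
  have e2 : Equiv.swap (k + 1) (k + 2) k = k := swap_apply_of_lt (by omega)
  have g1 := swapCoeff_mul h1
  have g2 := swapCoeff_mul h2
  have n1 : w (k + 1) - w k ≠ 0 := sub_ne_zero.2 h1.symm
  have n2 : w (k + 2) - w (k + 1) ≠ 0 := sub_ne_zero.2 h2.symm
  have n3 : w (k + 2) - w k ≠ 0 := sub_ne_zero.2 h3.symm
  have i1 : (w k - w (k + 1))⁻¹ = -(w (k + 1) - w k)⁻¹ := by rw [← inv_neg, neg_sub]
  have i2 : (w (k + 1) - w (k + 2))⁻¹ = -(w (k + 2) - w (k + 1))⁻¹ := by rw [← inv_neg, neg_sub]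
  -- the rational identity behind the braid relation
  have hab : (w (k + 1) - w k)⁻¹ * (w (k + 2) - w (k + 1))⁻¹ =
      (w (k + 2) - w k)⁻¹ * ((w (k + 1) - w k)⁻¹ + (w (k + 2) - w (k + 1))⁻¹) := by
    field_simp; ring
  simp only [semS_single, map_add, map_smul, hc, comp_swap_swap, Function.comp_apply,
    Equiv.swap_apply_left, Equiv.swap_apply_right, e1, e2, show k + 1 + 1 = k + 2 from rfl, i1, i2]
  generalize (w (k + 1) - w k)⁻¹ = a at *
  generalize (w (k + 2) - w (k + 1))⁻¹ = b at *
  generalize (w (k + 2) - w k)⁻¹ = c at *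
  match_scalars
  · linear_combination c * g1 - c * g2 + (a - b) * hab
  · linear_combination swapCoeff (w k) (w (k + 1)) * hab
  · linear_combination -swapCoeff (w (k + 1)) (w (k + 2)) * hab
  all_goals ring

end Seminormal

section SeminormalModule

variable {K : Type*} [Field K] {m n : ℕ} (q : Fin m → K)

/-- The residue sequences of the standard tableaux with `n` entries. -/
def residueSeqs (n : ℕ) (q : Fin m → K) : Set (ℕ → K) := {w | ∃ p, Std n p ∧ boxRes q ∘ p = w}

variable {q}

theorem exists_eq_of_mem_residueSeqs (hn : 0 < n) {w : ℕ → K} (hw : w ∈ residueSeqs n q) :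
    ∃ c, w 0 = q c := by
  obtain ⟨p, hp, rfl⟩ := hw
  have h := hp 0 hn
  obtain ⟨a, b, c, h0⟩ : ∃ a b c, p 0 = (a, b, c) := ⟨_, _, _, rfl⟩
  rw [h0] at h
  rcases a with _ | a
  · rcases b with _ | b
    · exact ⟨c, by simp [h0, boxRes]⟩
    · have := h.2.2 _ _ _ rfl; simp [boxShape] at this
  · have := h.2.1 _ _ _ rfl; simp [boxShape] at this

/-- Residues at distance at most two are distinct, so that the coefficients of the seminormal form
and its braid relation make sense. -/
theorem ne_of_mem_residueSeqs (hq : IsSeparated n q) {w : ℕ → K} (hw : w ∈ residueSeqs n q)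
    {i j : ℕ} (hij : i < j) (hj : j < i + 3) (hjn : j < n) : w i ≠ w j := by
  obtain ⟨p, hp, rfl⟩ := hw
  intro h
  have := hq.add_three_le hp le_rfl hij hjn h
  omega

theorem swap_mem_residueSeqs {w : ℕ → K} (hw : w ∈ residueSeqs n q) {k : ℕ} (hk : k + 1 < n)
    (h : swapCoeff (w k) (w (k + 1)) ≠ 0) : w ∘ Equiv.swap k (k + 1) ∈ residueSeqs n q := by
  obtain ⟨p, hp, rfl⟩ := hw
  rw [swapCoeff] at h
  split_ifs at h with h1
  · exact absurd rfl h
  · rw [not_or] at h1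
    exact ⟨_, hp.swap hk h1.1 h1.2, rfl⟩

theorem eq_of_mem_supported {S : Set (ℕ → K)} {f g : Module.End K ((ℕ → K) →₀ K)}
    (h : ∀ w ∈ S, f (Finsupp.single w 1) = g (Finsupp.single w 1)) {x : (ℕ → K) →₀ K}
    (hx : x ∈ Finsupp.supported K K S) : f x = g x := by
  rw [Finsupp.supported_eq_span_single] at hx
  refine LinearMap.eqOn_span (s := (fun i => Finsupp.single i (1 : K)) '' S) ?_ hx
  rintro _ ⟨w, hw, rfl⟩
  exact h w hw

theorem mem_supported_of_forall {S : Set (ℕ → K)} {f : Module.End K ((ℕ → K) →₀ K)}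
    (h : ∀ w ∈ S, f (Finsupp.single w 1) ∈ Finsupp.supported K K S) {x : (ℕ → K) →₀ K}
    (hx : x ∈ Finsupp.supported K K S) : f x ∈ Finsupp.supported K K S := by
  nth_rewrite 1 [Finsupp.supported_eq_span_single] at hx
  induction hx using Submodule.span_induction with
  | mem y hy => obtain ⟨w, hw, rfl⟩ := hy; exact h w hw
  | zero => rw [map_zero]; exact zero_mem _
  | add y z _ _ hy hz => rw [map_add]; exact add_mem hy hz
  | smul r y _ hy => rw [map_smul]; exact Submodule.smul_mem _ _ hy

/-- The operators of the generators on the space with one basis vector for each sequence. -/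
noncomputable def semGen (K : Type*) [Field K] : Gen n → Module.End K ((ℕ → K) →₀ K)
  | Gen.t => semT K
  | Gen.s k _ => semS K k

theorem semGen_mem (g : Gen n) {x : (ℕ → K) →₀ K}
    (hx : x ∈ Finsupp.supported K K (residueSeqs n q)) :
    semGen K g x ∈ Finsupp.supported K K (residueSeqs n q) := by
  refine mem_supported_of_forall (fun w hw => ?_) hx
  rcases g with _ | ⟨k, h⟩
  · rw [semGen, semT_single]
    exact Submodule.smul_mem _ _ (Finsupp.single_mem_supported K 1 hw)
  · rw [semGen, semS_single]
    refine add_mem (Submodule.smul_mem _ _ (Finsupp.single_mem_supported K 1 hw)) ?_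
    by_cases h0 : swapCoeff (w k) (w (k + 1)) = 0
    · rw [h0, zero_smul]; exact zero_mem _
    · exact Submodule.smul_mem _ _
        (Finsupp.single_mem_supported K 1 (swap_mem_residueSeqs hw h h0))

/-- If `f` acts like `J_{k+1}` on a seminormal basis vector and on the one with exchanged
eigenvalues, then `t_{k+1} f t_{k+1} + t_{k+1}` acts on the former by the next eigenvalue. -/
theorem semS_diag {k : ℕ} {w : ℕ → K} (h : w k ≠ w (k + 1)) {f : Module.End K ((ℕ → K) →₀ K)}
    (hf : f (Finsupp.single w 1) = w k • Finsupp.single w 1)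
    (hf' : swapCoeff (w k) (w (k + 1)) ≠ 0 → f (Finsupp.single (w ∘ Equiv.swap k (k + 1)) 1) =
      w (k + 1) • Finsupp.single (w ∘ Equiv.swap k (k + 1)) 1) :
    semS K k (f (semS K k (Finsupp.single w 1))) + semS K k (Finsupp.single w 1) =
      w (k + 1) • Finsupp.single w 1 := by
  have hf2 : swapCoeff (w k) (w (k + 1)) • f (Finsupp.single (w ∘ Equiv.swap k (k + 1)) 1) =
      (swapCoeff (w k) (w (k + 1)) * w (k + 1)) •
        Finsupp.single (w ∘ Equiv.swap k (k + 1)) 1 := by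
    by_cases h0 : swapCoeff (w k) (w (k + 1)) = 0
    · rw [h0, zero_smul, zero_mul, zero_smul]
    · rw [hf' h0, smul_smul]
  rw [semS_single k w, map_add, map_smul, map_smul, hf, hf2, map_add, map_smul, map_smul, map_smul,
    semS_single, semS_single, comp_swap_swap]
  simp only [Function.comp, Equiv.swap_apply_left, Equiv.swap_apply_right]
  have h3 : (w k - w (k + 1))⁻¹ = -(w (k + 1) - w k)⁻¹ := by rw [← inv_neg, neg_sub]
  have h4 : (w (k + 1) - w k) * (w (k + 1) - w k)⁻¹ = 1 :=
    mul_inv_cancel₀ (sub_ne_zero.2 h.symm)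
  have h5 := swapCoeff_mul h
  rw [h3]
  generalize (w (k + 1) - w k)⁻¹ = a at *
  match_scalars
  · linear_combination w (k + 1) * h5 - a * h4
  · linear_combination -swapCoeff (w k) (w (k + 1)) * h4

/-- The operators of the Jucys-Murphy elements on the space with one basis vector for each
sequence. -/
noncomputable def semJ (K : Type*) [Field K] : ℕ → Module.End K ((ℕ → K) →₀ K)
  | 0 => semT K
  | k + 1 => semS K k * semJ K k * semS K k + semS K k

theorem semJ_single (hq : IsSeparated n q) {k : ℕ} (hk : k < n) {w : ℕ → K}
    (hw : w ∈ residueSeqs n q) : semJ K k (Finsupp.single w 1) = w k • Finsupp.single w 1 := by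
  induction k generalizing w with
  | zero => exact semT_single w
  | succ k ih =>
    exact semS_diag (ne_of_mem_residueSeqs hq hw (by omega) (by omega) hk) (ih (by omega) hw)
      fun h0 => by simpa using ih (by omega) (swap_mem_residueSeqs hw hk h0)

/-- Young's seminormal form: the representation of the Hecke algebra on the space with one basis
vector for each standard tableau, identified with its sequence of residues. -/
theorem exists_seminormal (hn : 0 < n) (hq : IsSeparated n q) :
    ∃ ρ : Hecke n q →ₐ[K] Module.End K (Finsupp.supported K K (residueSeqs n q)),
      ∀ (g : Gen n) (x : Finsupp.supported K K (residueSeqs n q)),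
        (ρ (RingQuot.mkAlgHom K (Rel n q) (FreeAlgebra.ι K g)) x : (ℕ → K) →₀ K) =
          semGen K g x := by
  let act : Gen n → Module.End K (Finsupp.supported K K (residueSeqs n q)) := fun g =>
    (semGen K g).restrict fun _ hx => semGen_mem g hx
  have hact : ∀ (a : FreeAlgebra K (Gen n)) (x : Finsupp.supported K K (residueSeqs n q)),
      (FreeAlgebra.lift K act a x : (ℕ → K) →₀ K) = FreeAlgebra.lift K (semGen K) a x := by
    intro a
    induction a using FreeAlgebra.induction with
    | grade0 r => intro x; simp [Module.algebraMap_end_apply]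
    | grade1 g => intro x; rw [FreeAlgebra.lift_ι_apply, FreeAlgebra.lift_ι_apply]; rfl
    | mul a b ha hb =>
      intro x
      rw [map_mul, map_mul, Module.End.mul_apply, Module.End.mul_apply, ha, hb]
    | add a b ha hb =>
      intro x
      rw [map_add, map_add, LinearMap.add_apply, LinearMap.add_apply, Submodule.coe_add, ha, hb]
  have hrel : ∀ a b, Rel n q a b → FreeAlgebra.lift K act a = FreeAlgebra.lift K act b := by
    intro a b hab
    refine LinearMap.ext fun x => Subtype.ext ?_
    rw [hact, hact]
    refine eq_of_mem_supported (fun w hw => ?_) x.2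
    have hT : FreeAlgebra.lift K (semGen K) (FreeAlgebra.ι K (Gen.t : Gen n)) = semT K :=
      FreeAlgebra.lift_ι_apply _ _
    have hS : ∀ k h, FreeAlgebra.lift K (semGen K) (FreeAlgebra.ι K (Gen.s k h : Gen n)) =
        semS K k := fun k h => FreeAlgebra.lift_ι_apply _ _
    rcases hab with _ | h | ⟨k, hk, h⟩ | ⟨k, h⟩ | ⟨k, h, h'⟩ | ⟨k, l, hkl, hk, hl⟩
    · obtain ⟨c, hc⟩ := exists_eq_of_mem_residueSeqs hn hw
      have key : ∀ l : List K, FreeAlgebra.lift K (semGen K)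
          (l.map fun c => FreeAlgebra.ι K (Gen.t : Gen n) - algebraMap K _ c).prod
            (Finsupp.single w 1) = (l.map fun c => w 0 - c).prod • Finsupp.single w 1 := by
        intro l
        induction l with
        | nil => simp
        | cons c l ih =>
          rw [List.map_cons, List.prod_cons, map_mul, Module.End.mul_apply, ih, map_smul, map_sub,
            hT, AlgHom.commutes, LinearMap.sub_apply, semT_single, Module.algebraMap_end_apply,
            ← sub_smul, smul_smul, List.map_cons, List.prod_cons, mul_comm]
      have h1 := key (List.ofFn q)
      rw [List.map_ofFn, List.map_ofFn] at h1
      have h2 : (List.ofFn ((fun c => w 0 - c) ∘ q)).prod = 0 := by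
        rw [List.prod_eq_zero_iff, List.mem_ofFn]
        exact ⟨c, by simp [hc]⟩
      rw [h2, zero_smul] at h1
      rw [map_zero, LinearMap.zero_apply]
      exact h1
    · have h01 : w 0 ≠ w 1 := ne_of_mem_residueSeqs hq hw (by omega) (by omega) h
      have hd := semS_diag (k := 0) h01 (semT_single w) (fun _ => by
        rw [semT_single]; simp)
      simp only [map_mul, map_add, hT, hS, Module.End.mul_apply, LinearMap.add_apply, semT_single,
        map_smul]
      rw [hd, ← map_add, hd, map_smul, semT_single]
      exact smul_comm _ _ _
    · have e1 : Equiv.swap k (k + 1) 0 = 0 := swap_apply_of_lt (by omega)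
      simp only [map_mul, hT, hS, Module.End.mul_apply, semT_single, map_smul, semS_single, map_add,
        Function.comp_apply, e1]
      module
    · simp only [map_mul, map_one, hS, Module.End.mul_apply, Module.End.one_apply]
      exact semS_semS (ne_of_mem_residueSeqs hq hw (by omega) (by omega) h)
    · simp only [map_mul, hS, Module.End.mul_apply]
      exact semS_braid (ne_of_mem_residueSeqs hq hw (by omega) (by omega) h)
        (ne_of_mem_residueSeqs hq hw (by omega) (by omega) h')
        (ne_of_mem_residueSeqs hq hw (by omega) (by omega) h')
    · simp only [map_mul, hS, Module.End.mul_apply]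
      exact semS_comm hkl w
  refine ⟨RingQuot.liftAlgHom K ⟨FreeAlgebra.lift K act, fun {a b} h => hrel a b h⟩,
    fun g x => ?_⟩
  rw [RingQuot.liftAlgHom_mkAlgHom_apply, FreeAlgebra.lift_ι_apply]
  rfl

/-- The idempotent of a standard tableau fixes the corresponding seminormal basis vector. -/
theorem tabIdem_ne_zero (hn : 0 < n) (hq : IsSeparated n q) {p : ℕ → Box m} (hp : Std n p) :
    tabIdem q (jmSeq n q) p n ≠ 0 := by
  obtain ⟨ρ, hρ⟩ := exists_seminormal hn hq
  have hjm : ∀ k (h : k < n) (x : Finsupp.supported K K (residueSeqs n q)),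
      (ρ (jm q k h) x : (ℕ → K) →₀ K) = semJ K k x := by
    intro k
    induction k with
    | zero => exact fun h x => hρ Gen.t x
    | succ k ih =>
      intro h x
      have hs : ∀ x, (ρ (genS q k h) x : (ℕ → K) →₀ K) = semS K k x := hρ (Gen.s k h)
      rw [jm, map_add, map_mul, map_mul, LinearMap.add_apply, Module.End.mul_apply,
        Module.End.mul_apply, Submodule.coe_add, hs, ih, hs, semJ]
      rfl
  have hfix : ∀ k ≤ n, ρ (tabIdem q (jmSeq n q) p k)
      ⟨Finsupp.single (boxRes q ∘ p) 1, Finsupp.single_mem_supported K 1 ⟨p, hp, rfl⟩⟩ =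
      ⟨Finsupp.single (boxRes q ∘ p) 1, Finsupp.single_mem_supported K 1 ⟨p, hp, rfl⟩⟩ := by
    intro k hk
    set v : Finsupp.supported K K (residueSeqs n q) :=
      ⟨Finsupp.single (boxRes q ∘ p) 1, Finsupp.single_mem_supported K 1 ⟨p, hp, rfl⟩⟩ with hv
    have hv0 : v ≠ 0 := fun h => by
      have := congrArg Subtype.val h
      simp [hv] at this
    induction k with
    | zero => simp [tabIdem]
    | succ k ih =>
      have h1 : (ρ (jmSeq n q k)).HasEigenvector (boxRes q (p k)) v := by
        refine ⟨Module.End.mem_eigenspace_iff.2 (Subtype.ext ?_), hv0⟩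
        rw [jmSeq_of_lt q hk]
        exact (hjm k hk v).trans (semJ_single hq hk ⟨p, hp, rfl⟩)
      rw [tabIdem, map_mul, Module.End.mul_apply, ← Polynomial.aeval_algHom_apply,
        Module.End.aeval_apply_of_hasEigenvector h1, eval_basis_self hq hk (hp.mono hk), one_smul]
      exact ih (by omega)
  intro h0
  have := congrArg Subtype.val (hfix n le_rfl)
  rw [h0, map_zero] at this
  exact one_ne_zero (Finsupp.single_eq_zero.1 this.symm)

end SeminormalModule

/-! ### Generalized hook lengths -/

section Hooks

variable {K : Type*} [Field K] {m n : ℕ}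

/-- The Young diagram `mu` arises from `lam` by adding the cell `(i, j)`. -/
structure IsAddCell (lam mu : YoungDiagram) (i j : ℕ) : Prop where
  cells_eq : mu.cells = insert (i, j) lam.cells
  notMem : (i, j) ∉ lam

theorem nat_eq_of_forall_lt_iff {a b : ℕ} (h : ∀ l, l < a ↔ l < b) : a = b :=
  le_antisymm (not_lt.1 fun h1 => lt_irrefl _ ((h b).1 h1))
    (not_lt.1 fun h1 => lt_irrefl _ ((h a).2 h1))

namespace IsAddCell

variable {lam mu : YoungDiagram} {i j : ℕ} (h : IsAddCell lam mu i j)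
include h

theorem mem_iff {a b : ℕ} : (a, b) ∈ mu ↔ (a = i ∧ b = j) ∨ (a, b) ∈ lam := by
  rw [← YoungDiagram.mem_cells, h.cells_eq, Finset.mem_insert, Prod.mk.injEq,
    YoungDiagram.mem_cells]

theorem rowLen_left : lam.rowLen i = j := by
  refine nat_eq_of_forall_lt_iff fun l => ?_
  rw [← YoungDiagram.mem_iff_lt_rowLen]
  constructor
  · intro hl
    by_contra hlt
    exact h.notMem (lam.up_left_mem le_rfl (not_lt.1 hlt) hl)
  · intro hl
    have h1 : (i, l) ∈ mu := mu.up_left_mem le_rfl hl.le (h.mem_iff.2 (Or.inl ⟨rfl, rfl⟩))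
    rcases h.mem_iff.1 h1 with h2 | h2
    · omega
    · exact h2

theorem colLen_left : lam.colLen j = i := by
  refine nat_eq_of_forall_lt_iff fun l => ?_
  rw [← YoungDiagram.mem_iff_lt_colLen]
  constructor
  · intro hl
    by_contra hlt
    exact h.notMem (lam.up_left_mem (not_lt.1 hlt) le_rfl hl)
  · intro hl
    have h1 : (l, j) ∈ mu := mu.up_left_mem hl.le le_rfl (h.mem_iff.2 (Or.inl ⟨rfl, rfl⟩))
    rcases h.mem_iff.1 h1 with h2 | h2
    · omega
    · exact h2

theorem rowLen_right : mu.rowLen i = j + 1 := by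
  refine nat_eq_of_forall_lt_iff fun l => ?_
  rw [← YoungDiagram.mem_iff_lt_rowLen, h.mem_iff, YoungDiagram.mem_iff_lt_rowLen, h.rowLen_left]
  omega

theorem colLen_right : mu.colLen j = i + 1 := by
  refine nat_eq_of_forall_lt_iff fun l => ?_
  rw [← YoungDiagram.mem_iff_lt_colLen, h.mem_iff, YoungDiagram.mem_iff_lt_colLen, h.colLen_left]
  omega

theorem rowLen_of_ne {a : ℕ} (ha : a ≠ i) : mu.rowLen a = lam.rowLen a := by
  refine nat_eq_of_forall_lt_iff fun l => ?_
  rw [← YoungDiagram.mem_iff_lt_rowLen, h.mem_iff, YoungDiagram.mem_iff_lt_rowLen]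
  tauto

theorem colLen_of_ne {b : ℕ} (hb : b ≠ j) : mu.colLen b = lam.colLen b := by
  refine nat_eq_of_forall_lt_iff fun l => ?_
  rw [← YoungDiagram.mem_iff_lt_colLen, h.mem_iff, YoungDiagram.mem_iff_lt_colLen]
  tauto

end IsAddCell

/-- The product of the shifted hook lengths `h^{λ,μ}_x + d` over the cells `x` of `λ`. -/
def pairHookProd (lam mu : YoungDiagram) (d : K) : K :=
  ∏ x ∈ lam.cells, ((genHook lam mu x.1 x.2 : K) + d)

theorem prod_cells_row {M : Type*} [CommMonoid M] (lam : YoungDiagram) (i : ℕ) (f : ℕ × ℕ → M) :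
    ∏ x ∈ lam.cells, f x =
      (∏ b ∈ Finset.range (lam.rowLen i), f (i, b)) * ∏ x ∈ lam.cells with x.1 ≠ i, f x := by
  rw [← Finset.prod_filter_mul_prod_filter_not lam.cells (fun x => x.1 = i)]
  congr 1
  have : (lam.cells.filter fun x => x.1 = i) = lam.row i := rfl
  rw [this, YoungDiagram.row_eq_prod, Finset.prod_product, Finset.prod_singleton]

theorem prod_cells_col {M : Type*} [CommMonoid M] (lam : YoungDiagram) (j : ℕ) (f : ℕ × ℕ → M) :
    ∏ x ∈ lam.cells, f x =
      (∏ a ∈ Finset.range (lam.colLen j), f (a, j)) * ∏ x ∈ lam.cells with x.2 ≠ j, f x := by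
  rw [← Finset.prod_filter_mul_prod_filter_not lam.cells (fun x => x.2 = j)]
  congr 1
  have : (lam.cells.filter fun x => x.2 = j) = lam.col j := rfl
  rw [this, YoungDiagram.col_eq_prod, Finset.prod_product_right, Finset.prod_singleton]

/-- The effect on the shifted hook lengths of a new cell in the first diagram. -/
theorem IsAddCell.pairHookProd_left {lam lam' : YoungDiagram} {i j : ℕ}
    (h : IsAddCell lam lam' i j) (mu : YoungDiagram) (d : K) :
    pairHookProd lam' mu d *
        ∏ b ∈ Finset.range j, ((j : K) - i + d - b - 1 + mu.colLen b) =
      pairHookProd lam mu d * (((j : K) - i + d - j + mu.colLen j) *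
        ∏ b ∈ Finset.range j, ((j : K) - i + d - b + mu.colLen b)) := by
  have h0 : (i, j) ∉ lam.cells := fun h1 => h.notMem h1
  have e1 : ∏ x ∈ lam.cells with x.1 ≠ i, ((genHook lam' mu x.1 x.2 : K) + d) =
      ∏ x ∈ lam.cells with x.1 ≠ i, ((genHook lam mu x.1 x.2 : K) + d) := by
    refine Finset.prod_congr rfl fun x hx => ?_
    rw [genHook, genHook, h.rowLen_of_ne (Finset.mem_filter.1 hx).2]
  have e2 : ∏ b ∈ Finset.range j, ((genHook lam' mu i b : K) + d) =
      ∏ b ∈ Finset.range j, ((j : K) - i + d - b + mu.colLen b) := by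
    refine Finset.prod_congr rfl fun b _ => ?_
    rw [genHook, h.rowLen_right]; push_cast; ring
  have e3 : ∏ b ∈ Finset.range j, ((genHook lam mu i b : K) + d) =
      ∏ b ∈ Finset.range j, ((j : K) - i + d - b - 1 + mu.colLen b) := by
    refine Finset.prod_congr rfl fun b _ => ?_
    rw [genHook, h.rowLen_left]; push_cast; ring
  have e4 : (genHook lam' mu i j : K) + d = (j : K) - i + d - j + mu.colLen j := by
    rw [genHook, h.rowLen_right]; push_cast; ring
  rw [pairHookProd, pairHookProd, h.cells_eq, Finset.prod_insert h0, prod_cells_row lam i,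
    prod_cells_row lam i, h.rowLen_left, e1, e2, e3, e4]
  ring

/-- The effect on the shifted hook lengths of a new cell in the second diagram. -/
theorem IsAddCell.pairHookProd_right {mu mu' : YoungDiagram} {i j : ℕ}
    (h : IsAddCell mu mu' i j) (lam : YoungDiagram) (d : K) :
    pairHookProd lam mu' d *
        ∏ a ∈ Finset.range (lam.colLen j), ((j : K) - i - d - lam.rowLen a + a + 1) =
      pairHookProd lam mu d *
        ∏ a ∈ Finset.range (lam.colLen j), ((j : K) - i - d - lam.rowLen a + a) := by
  have e1 : ∏ x ∈ lam.cells with x.2 ≠ j, ((genHook lam mu' x.1 x.2 : K) + d) =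
      ∏ x ∈ lam.cells with x.2 ≠ j, ((genHook lam mu x.1 x.2 : K) + d) := by
    refine Finset.prod_congr rfl fun x hx => ?_
    rw [genHook, genHook, h.colLen_of_ne (Finset.mem_filter.1 hx).2]
  have e2 : ∏ a ∈ Finset.range (lam.colLen j), (((genHook lam mu' a j : K) + d) *
        ((j : K) - i - d - lam.rowLen a + a + 1)) =
      ∏ a ∈ Finset.range (lam.colLen j), (((genHook lam mu a j : K) + d) *
        ((j : K) - i - d - lam.rowLen a + a)) := by
    refine Finset.prod_congr rfl fun a _ => ?_
    rw [genHook, genHook, h.colLen_right, h.colLen_left]; push_cast; ring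
  rw [Finset.prod_mul_distrib, Finset.prod_mul_distrib] at e2
  rw [pairHookProd, pairHookProd, prod_cells_col lam j, prod_cells_col lam j, e1]
  linear_combination (∏ x ∈ lam.cells with x.2 ≠ j, ((genHook lam mu x.1 x.2 : K) + d)) * e2

/-- The numerator, without one factor that is treated separately, of the change of the hook
products caused by a new cell in column `j`, as a function of the residue of the new cell. -/
def hookNum {R : Type*} [CommRing R] (mu : YoungDiagram) (j : ℕ) (y : R) : R :=
  (∏ b ∈ Finset.range j, (y - b + mu.colLen b)) *
    ∏ a ∈ Finset.range (mu.colLen j), (y - mu.rowLen a + a)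

/-- The denominator of the change of the hook products caused by a new cell in column `j`. -/
def hookDen {R : Type*} [CommRing R] (mu : YoungDiagram) (j : ℕ) (y : R) : R :=
  (∏ b ∈ Finset.range j, (y - b - 1 + mu.colLen b)) *
    ∏ a ∈ Finset.range (mu.colLen j), (y - mu.rowLen a + a + 1)

theorem map_hookNum {R S F : Type*} [CommRing R] [CommRing S] [FunLike F R S] [RingHomClass F R S]
    (f : F) (mu : YoungDiagram) (j : ℕ) (y : R) : f (hookNum mu j y) = hookNum mu j (f y) := by
  simp [hookNum, map_prod]

theorem map_hookDen {R S F : Type*} [CommRing R] [CommRing S] [FunLike F R S] [RingHomClass F R S]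
    (f : F) (mu : YoungDiagram) (j : ℕ) (y : R) : f (hookDen mu j y) = hookDen mu j (f y) := by
  simp [hookDen, map_prod]

/-- The product of all generalized hook lengths of a multidiagram. -/
def hookProd (q : Fin m → K) (M : Fin m → YoungDiagram) : K :=
  ∏ s, ∏ u, pairHookProd (M s) (M u) (q s - q u)

theorem theta_eq (q : Fin m → K) (lam : Multipartition m n) :
    theta q lam = (hookProd q lam.parts)⁻¹ := by
  rw [theta, hookProd, ← Finset.prod_inv_distrib]
  refine Finset.prod_congr rfl fun s _ => ?_
  rw [← Finset.prod_inv_distrib, Finset.prod_comm]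
  refine Finset.prod_congr rfl fun u _ => ?_
  rw [pairHookProd, ← Finset.prod_inv_distrib]
  exact Finset.prod_congr rfl fun x _ => by rw [add_sub_assoc]

theorem prod_prod_erase {ι : Type*} [Fintype ι] [DecidableEq ι] (c : ι) (f : ι → ι → K) :
    ∏ s, ∏ u, f s u = f c c * (∏ u ∈ Finset.univ.erase c, f c u) *
      (∏ s ∈ Finset.univ.erase c, f s c) *
        ∏ s ∈ Finset.univ.erase c, ∏ u ∈ Finset.univ.erase c, f s u := by
  rw [← Finset.mul_prod_erase _ _ (Finset.mem_univ c),
    ← Finset.mul_prod_erase _ (f c) (Finset.mem_univ c), mul_assoc (f c c * _),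
    ← Finset.prod_mul_distrib]
  congr 1
  exact Finset.prod_congr rfl fun s _ => (Finset.mul_prod_erase _ _ (Finset.mem_univ c)).symm

/-- The change of the product of all generalized hook lengths when a cell is added. -/
theorem hookProd_addCell (q : Fin m → K) {M M' : Fin m → YoungDiagram} {i j : ℕ} {c : Fin m}
    (hc : IsAddCell (M c) (M' c) i j) (hM : ∀ u, u ≠ c → M' u = M u) :
    hookProd q M' * ∏ u, hookDen (M u) j ((j : K) - i + q c - q u) =
      hookProd q M * (hookNum (M c) j ((j : K) - i + q c - q c) *
        ∏ u ∈ Finset.univ.erase c, (((j : K) - i + q c - q u - j + (M u).colLen j) *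
          hookNum (M u) j ((j : K) - i + q c - q u))) := by
  classical
  have hcc : pairHookProd (M' c) (M' c) (q c - q c) * hookDen (M c) j ((j : K) - i + q c - q c) =
      pairHookProd (M c) (M c) (q c - q c) * hookNum (M c) j ((j : K) - i + q c - q c) := by
    have h1 := hc.pairHookProd_left (M' c) (q c - q c)
    have h2 := hc.pairHookProd_right (M c) (q c - q c)
    have e : ∀ b ∈ Finset.range j, ((M' c).colLen b : K) = (M c).colLen b := fun b hb => by
      rw [hc.colLen_of_ne (by simp at hb; omega)]
    have e1 : ∏ b ∈ Finset.range j, ((j : K) - i + (q c - q c) - b - 1 + (M' c).colLen b) =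
        ∏ b ∈ Finset.range j, ((j : K) - i - b - 1 + (M c).colLen b) :=
      Finset.prod_congr rfl fun b hb => by rw [e b hb]; ring
    have e2 : ∏ b ∈ Finset.range j, ((j : K) - i + (q c - q c) - b + (M' c).colLen b) =
        ∏ b ∈ Finset.range j, ((j : K) - i - b + (M c).colLen b) :=
      Finset.prod_congr rfl fun b hb => by rw [e b hb]; ring
    -- the new cell has hook length `1`
    have e3 : (j : K) - i + (q c - q c) - j + (M' c).colLen j = 1 := by
      rw [hc.colLen_right]; push_cast; ring
    rw [e1, e2, e3, one_mul] at h1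
    rw [hookNum, hookDen, add_sub_assoc, sub_self, add_zero]
    simp only [sub_self, sub_zero] at h1 h2
    rw [← mul_assoc, h1, mul_right_comm, h2]
    ring
  have hcu : ∀ u ∈ Finset.univ.erase c,
      pairHookProd (M' c) (M' u) (q c - q u) * pairHookProd (M' u) (M' c) (q u - q c) *
        hookDen (M u) j ((j : K) - i + q c - q u) =
      pairHookProd (M c) (M u) (q c - q u) * pairHookProd (M u) (M c) (q u - q c) *
        (((j : K) - i + q c - q u - j + (M u).colLen j) *
          hookNum (M u) j ((j : K) - i + q c - q u)) := by
    intro u hu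
    rw [hM u (Finset.ne_of_mem_erase hu)]
    have h1 := hc.pairHookProd_left (M u) (q c - q u)
    have h2 := hc.pairHookProd_right (M u) (q u - q c)
    rw [show (j : K) - i - (q u - q c) = j - i + q c - q u by ring] at h2
    rw [show (j : K) - i + (q c - q u) = j - i + q c - q u by ring] at h1
    rw [hookNum, hookDen]
    generalize pairHookProd (M' c) (M u) (q c - q u) = A' at *
    generalize pairHookProd (M u) (M' c) (q u - q c) = B' at *
    calc _ = (A' * ∏ b ∈ Finset.range j, ((j : K) - i + q c - q u - b - 1 + (M u).colLen b)) *
          (B' * ∏ a ∈ Finset.range ((M u).colLen j),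
            ((j : K) - i + q c - q u - (M u).rowLen a + a + 1)) := by ring
      _ = _ := by rw [h1, h2]; ring
  have hrest : ∏ s ∈ Finset.univ.erase c, ∏ u ∈ Finset.univ.erase c,
      pairHookProd (M' s) (M' u) (q s - q u) = ∏ s ∈ Finset.univ.erase c,
        ∏ u ∈ Finset.univ.erase c, pairHookProd (M s) (M u) (q s - q u) := by
    refine Finset.prod_congr rfl fun s hs => Finset.prod_congr rfl fun u hu => ?_
    rw [hM u (Finset.ne_of_mem_erase hu), hM s (Finset.ne_of_mem_erase hs)]
  have hprod := Finset.prod_congr rfl hcu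
  simp only [Finset.prod_mul_distrib] at hprod
  rw [hookProd, hookProd, prod_prod_erase c, prod_prod_erase c, hrest,
    ← Finset.mul_prod_erase _ _ (Finset.mem_univ c)]
  simp only [Finset.prod_mul_distrib]
  linear_combination (∏ s ∈ Finset.univ.erase c, ∏ u ∈ Finset.univ.erase c,
      pairHookProd (M s) (M u) (q s - q u)) *
    ((∏ u ∈ Finset.univ.erase c, pairHookProd (M' c) (M' u) (q c - q u)) *
      (∏ u ∈ Finset.univ.erase c, pairHookProd (M' u) (M' c) (q u - q c)) *
      (∏ u ∈ Finset.univ.erase c, hookDen (M u) j ((j : K) - i + q c - q u)) * hcc +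
      pairHookProd (M c) (M c) (q c - q c) * hookNum (M c) j ((j : K) - i + q c - q c) * hprod)

/-- Along a column the factors `1 - 1 / u ^ 2` telescope. -/
theorem prod_content_col {L : Type*} [Field L] (u : L) (hu : ∀ d : ℤ, u + d ≠ 0) (N : ℕ) :
    (∏ i ∈ Finset.range N, (1 - (u + i)⁻¹ * (u + i)⁻¹)) * (u * (u + N - 1)) =
      (u - 1) * (u + N) := by
  induction N with
  | zero => simp; ring
  | succ N ih =>
    have h1 : u + N ≠ 0 := by simpa using hu N
    have h2 : u + N - 1 ≠ 0 := by
      have := hu (N - 1); push_cast at this; rwa [← add_sub_assoc] at this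
    refine mul_right_cancel₀ h2 ?_
    rw [Finset.prod_range_succ]
    generalize ∏ i ∈ Finset.range N, (1 - (u + i)⁻¹ * (u + i)⁻¹) = P at ih
    have h3 : (1 - (u + N)⁻¹ * (u + N)⁻¹) * (u + N) = (u + N - 1) * (u + N + 1) * (u + N)⁻¹ := by
      field_simp; ring
    push_cast
    calc P * (1 - (u + N)⁻¹ * (u + N)⁻¹) * (u * (u + (N + 1) - 1)) * (u + N - 1)
        = (P * (u * (u + N - 1))) * ((1 - (u + N)⁻¹ * (u + N)⁻¹) * (u + N)) := by ring
      _ = (u - 1) * ((u + N - 1) * (u + N + 1)) * ((u + N) * (u + N)⁻¹) := by rw [ih, h3]; ring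
      _ = _ := by rw [mul_inv_cancel₀ h1]; ring

/-- Along a row the factors `1 - 1 / u ^ 2` telescope. -/
theorem prod_content_row {L : Type*} [Field L] (u : L) (hu : ∀ d : ℤ, u + d ≠ 0) (N : ℕ) :
    (∏ i ∈ Finset.range N, (1 - (u - i)⁻¹ * (u - i)⁻¹)) * (u * (u - N + 1)) =
      (u + 1) * (u - N) := by
  have h := prod_content_col (-u) (fun d h => hu (-d) (by push_cast; linear_combination -h)) N
  have e : ∏ i ∈ Finset.range N, (1 - (-u + (i : L))⁻¹ * (-u + (i : L))⁻¹) =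
      ∏ i ∈ Finset.range N, (1 - (u - i)⁻¹ * (u - i)⁻¹) := by
    refine Finset.prod_congr rfl fun i _ => ?_
    rw [show -u + (i : L) = -(u - i) by ring, inv_neg, neg_mul_neg]
  rw [e] at h
  linear_combination h

/-- A product over a diagram, by columns to the left of column `j` and by rows from there on. -/
theorem prod_cells_eq {M : Type*} [CommMonoid M] (mu : YoungDiagram) (j : ℕ) (f : ℕ × ℕ → M) :
    ∏ x ∈ mu.cells, f x = (∏ b ∈ Finset.range j, ∏ a ∈ Finset.range (mu.colLen b), f (a, b)) *
      ∏ a ∈ Finset.range (mu.colLen j), ∏ l ∈ Finset.range (mu.rowLen a - j), f (a, j + l) := by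
  rw [← Finset.prod_filter_mul_prod_filter_not mu.cells (fun x => x.2 < j)]
  congr 1
  · rw [← Finset.prod_fiberwise_of_maps_to (t := Finset.range j) (g := fun x => x.2)
      (fun x hx => by simpa using (Finset.mem_filter.1 hx).2)]
    refine Finset.prod_congr rfl fun b hb => ?_
    have h1 : ((mu.cells.filter fun x => x.2 < j).filter fun x => x.2 = b) = mu.col b := by
      rw [Finset.filter_filter, YoungDiagram.col]
      refine Finset.filter_congr fun x _ => ⟨fun h => h.2, fun h => ⟨?_, h⟩⟩
      rw [h]; simpa using hb
    rw [h1, YoungDiagram.col_eq_prod, Finset.prod_product_right, Finset.prod_singleton]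
  · rw [← Finset.prod_fiberwise_of_maps_to (t := Finset.range (mu.colLen j)) (g := fun x => x.1)]
    · refine Finset.prod_congr rfl fun a ha => ?_
      have h1 : ((mu.cells.filter fun x => ¬ x.2 < j).filter fun x => x.1 = a) =
          (Finset.range (mu.rowLen a - j)).image fun l => (a, j + l) := by
        ext ⟨x, y⟩
        simp only [Finset.mem_filter, YoungDiagram.mem_cells, Finset.mem_image, Finset.mem_range,
          Prod.mk.injEq, YoungDiagram.mem_iff_lt_rowLen]
        constructor
        · rintro ⟨⟨h1, h2⟩, rfl⟩
          exact ⟨y - j, by omega, rfl, by omega⟩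
        · rintro ⟨l, hl, rfl, rfl⟩
          exact ⟨⟨by omega, by omega⟩, rfl⟩
      rw [h1, Finset.prod_image]
      intro l _ l' _ h
      simpa using h
    · rintro ⟨x, y⟩ hx
      simp only [Finset.mem_filter, YoungDiagram.mem_cells] at hx
      simp only [Finset.mem_range, ← YoungDiagram.mem_iff_lt_colLen]
      exact mu.up_left_mem le_rfl (not_lt.1 hx.2) hx.1

/-- Splitting a diagram at column `j`, the columns to the left and the rows to the right telescope.
The left-hand side does not depend on `j`, apart from the denominator. -/
theorem prod_content_mul_hookDen {L : Type*} [Field L] (mu : YoungDiagram) (j : ℕ) (y : L)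
    (hy : ∀ d : ℤ, y + d ≠ 0) :
    y * (∏ x ∈ mu.cells, (1 - (y - ((x.2 : L) - x.1))⁻¹ * (y - ((x.2 : L) - x.1))⁻¹)) *
        hookDen mu j y = (y - j + mu.colLen j) * hookNum mu j y := by
  have hleft : ∀ j : ℕ, y * (∏ b ∈ Finset.range j, ∏ a ∈ Finset.range (mu.colLen b),
      (1 - (y - ((b : L) - a))⁻¹ * (y - ((b : L) - a))⁻¹)) *
        ∏ b ∈ Finset.range j, (y - b - 1 + mu.colLen b) =
      (y - j) * ∏ b ∈ Finset.range j, (y - b + mu.colLen b) := by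
    intro j
    induction j with
    | zero => simp
    | succ j ih =>
      have h1 := prod_content_col (y - j)
        (fun d h => hy (d - j) (by push_cast; linear_combination h)) (mu.colLen j)
      rw [Finset.prod_range_succ, Finset.prod_range_succ, Finset.prod_range_succ]
      rw [Finset.prod_congr rfl fun (a : ℕ) _ => by
        rw [show y - (j : L) + a = y - ((j : L) - a) by ring]] at h1
      push_cast
      linear_combination (∏ a ∈ Finset.range (mu.colLen j),
        (1 - (y - ((j : L) - a))⁻¹ * (y - ((j : L) - a))⁻¹)) * (y - j - 1 + mu.colLen j) * ih +
        (∏ b ∈ Finset.range j, (y - b + mu.colLen b)) * h1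
  have hright : ∀ N ≤ mu.colLen j, (y - j) * (∏ a ∈ Finset.range N,
      ∏ l ∈ Finset.range (mu.rowLen a - j),
        (1 - (y - (((j + l : ℕ) : L) - a))⁻¹ * (y - (((j + l : ℕ) : L) - a))⁻¹)) *
        ∏ a ∈ Finset.range N, (y - mu.rowLen a + a + 1) =
      (y - j + N) * ∏ a ∈ Finset.range N, (y - mu.rowLen a + a) := by
    intro N hN
    induction N with
    | zero => simp
    | succ N ih =>
      have hlt : j < mu.rowLen N := by
        rw [← YoungDiagram.mem_iff_lt_rowLen, YoungDiagram.mem_iff_lt_colLen]; omega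
      have h1 := prod_content_row (y - j + N)
        (fun d h => hy (d - j + N) (by push_cast; linear_combination h)) (mu.rowLen N - j)
      rw [Finset.prod_congr rfl fun (l : ℕ) _ => by
        rw [show y - (j : L) + N - l = y - (((j + l : ℕ) : L) - N) by push_cast; ring],
        Nat.cast_sub hlt.le] at h1
      rw [Finset.prod_range_succ, Finset.prod_range_succ, Finset.prod_range_succ]
      have ih' := ih (by omega)
      push_cast at h1 ih' ⊢
      linear_combination (∏ l ∈ Finset.range (mu.rowLen N - j),
        (1 - (y - ((j : L) + l - N))⁻¹ * (y - ((j : L) + l - N))⁻¹)) *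
          (y - mu.rowLen N + N + 1) * ih' +
        (∏ a ∈ Finset.range N, (y - mu.rowLen a + a)) * h1
  have hj : y - j ≠ 0 := by simpa [sub_eq_add_neg] using hy (-j)
  rw [prod_cells_eq mu j, hookDen, hookNum]
  refine mul_left_cancel₀ hj ?_
  linear_combination ((y - j) * (∏ a ∈ Finset.range (mu.colLen j),
      ∏ l ∈ Finset.range (mu.rowLen a - j),
        (1 - (y - (((j + l : ℕ) : L) - a))⁻¹ * (y - (((j + l : ℕ) : L) - a))⁻¹)) *
        ∏ a ∈ Finset.range (mu.colLen j), (y - mu.rowLen a + a + 1)) * hleft j +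
    ((y - j) * ∏ b ∈ Finset.range j, (y - b + mu.colLen b)) * hright _ le_rfl

/-- A component of a multidiagram as a Young diagram. -/
def boxDiagram {s : Finset (Box m)} (hs : IsLowerBoxes s) (c : Fin m) : YoungDiagram where
  cells := (s.filter fun x => x.2.2 = c).image fun x => (x.1, x.2.1)
  isLowerSet := by
    rintro ⟨a, b⟩ ⟨a', b'⟩ ⟨h1, h2⟩ h
    simp only [Finset.coe_image, Set.mem_image, Finset.mem_coe, Finset.mem_filter, Prod.exists,
      Prod.mk.injEq] at h ⊢
    obtain ⟨x, y, z, ⟨h3, rfl⟩, rfl, rfl⟩ := h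
    exact ⟨a', b', z, ⟨hs _ _ _ h3 _ h1 _ h2, rfl⟩, rfl, rfl⟩

theorem mem_boxDiagram {s : Finset (Box m)} {hs : IsLowerBoxes s} {c : Fin m} {a b : ℕ} :
    (a, b) ∈ boxDiagram hs c ↔ (a, b, c) ∈ s := by
  rw [← YoungDiagram.mem_cells, boxDiagram]
  simp only [Finset.mem_image, Finset.mem_filter, Prod.exists, Prod.mk.injEq]
  constructor
  · rintro ⟨x, y, z, ⟨h3, rfl⟩, rfl, rfl⟩; exact h3
  · exact fun h => ⟨a, b, c, ⟨h, rfl⟩, rfl, rfl⟩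

theorem prod_boxDiagram {M : Type*} [CommMonoid M] {s : Finset (Box m)} (hs : IsLowerBoxes s)
    (f : Box m → M) :
    ∏ x ∈ s, f x = ∏ c, ∏ x ∈ (boxDiagram hs c).cells, f (x.1, x.2, c) := by
  rw [← Finset.prod_fiberwise_of_maps_to (t := Finset.univ) (g := fun x : Box m => x.2.2)
    fun _ _ => Finset.mem_univ _]
  refine Finset.prod_congr rfl fun c _ => ?_
  rw [boxDiagram, Finset.prod_image]
  · refine Finset.prod_congr rfl fun x hx => ?_
    rw [← (Finset.mem_filter.1 hx).2]
  · rintro ⟨a, b, c'⟩ hx ⟨a', b', c''⟩ hx' h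
    simp only [Finset.coe_filter, Set.mem_ofPred_eq] at hx hx'
    simp only [Prod.mk.injEq] at h
    rw [h.1, h.2, hx.2, hx'.2]

theorem isAddCell_boxDiagram {s s' : Finset (Box m)} (hs : IsLowerBoxes s) (hs' : IsLowerBoxes s')
    {a b : ℕ} {c : Fin m} (hx : (a, b, c) ∉ s) (h : s' = insert (a, b, c) s) :
    IsAddCell (boxDiagram hs c) (boxDiagram hs' c) a b := by
  refine ⟨?_, fun h1 => hx (mem_boxDiagram.1 h1)⟩
  ext ⟨a', b'⟩
  rw [Finset.mem_insert, YoungDiagram.mem_cells, YoungDiagram.mem_cells, mem_boxDiagram,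
    mem_boxDiagram, h, Finset.mem_insert]
  simp

theorem boxDiagram_of_ne {s s' : Finset (Box m)} (hs : IsLowerBoxes s) (hs' : IsLowerBoxes s')
    {a b : ℕ} {c u : Fin m} (h : s' = insert (a, b, c) s) (hu : u ≠ c) :
    boxDiagram hs' u = boxDiagram hs u := by
  refine YoungDiagram.ext (Finset.ext ?_)
  rintro ⟨a', b'⟩
  rw [YoungDiagram.mem_cells, YoungDiagram.mem_cells, mem_boxDiagram, mem_boxDiagram, h,
    Finset.mem_insert]
  simp [hu]

/-- The shifted hook lengths of a multidiagram do not vanish: up to one, they are differences of the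
residue at the end of a row and the residue at the foot of a column, and genericity applies. -/
theorem IsSeparated.genHook_ne_zero {q : Fin m → K} (hq : IsSeparated n q) {s : Finset (Box m)}
    (hs : IsLowerBoxes s) (hn : s.card ≤ n) {i j : ℕ} {c : Fin m} (h : (i, j, c) ∈ s)
    (u : Fin m) : (genHook (boxDiagram hs c) (boxDiagram hs u) i j : K) + (q c - q u) ≠ 0 := by
  have hrow : j < (boxDiagram hs c).rowLen i := by
    rw [← YoungDiagram.mem_iff_lt_rowLen]; exact mem_boxDiagram.2 h
  have hrow' : (i, (boxDiagram hs c).rowLen i - 1, c) ∈ s := by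
    rw [← mem_boxDiagram (hs := hs), YoungDiagram.mem_iff_lt_rowLen]; omega
  have hcol' : (boxDiagram hs u).colLen j ≠ 0 → ((boxDiagram hs u).colLen j - 1, j, u) ∈ s := by
    intro h0
    rw [← mem_boxDiagram (hs := hs), YoungDiagram.mem_iff_lt_colLen]; omega
  have h1 := hs.add_lt_card h hrow'
  by_cases hu : c = u
  · subst hu
    have hcol : i < (boxDiagram hs c).colLen j := by
      rw [← YoungDiagram.mem_iff_lt_colLen]; exact mem_boxDiagram.2 h
    have h2 := hs.add_lt_card (hcol' (by omega)) hrow'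
    rw [sub_self, add_zero]
    refine hq.int_ne _ ?_ ?_
    · rw [genHook]; omega
    · rw [genHook]; exact abs_le.2 ⟨by omega, by omega⟩
  · rw [← add_sub_assoc]
    refine hq.sub_ne c u hu _ ?_
    rw [genHook]
    by_cases h0 : (boxDiagram hs u).colLen j = 0
    · exact abs_le.2 ⟨by omega, by omega⟩
    · have h2 := hs.add_lt_card_of_ne (Ne.symm hu) (hcol' h0) hrow'
      exact abs_le.2 ⟨by omega, by omega⟩

theorem IsSeparated.hookProd_ne_zero {q : Fin m → K} (hq : IsSeparated n q) {s : Finset (Box m)}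
    (hs : IsLowerBoxes s) (hn : s.card ≤ n) : hookProd q (boxDiagram hs) ≠ 0 :=
  Finset.prod_ne_zero_iff.2 fun _ _ => Finset.prod_ne_zero_iff.2 fun u _ =>
    Finset.prod_ne_zero_iff.2 fun _ hx =>
      hq.genHook_ne_zero hs hn (mem_boxDiagram.1 ((YoungDiagram.mem_cells _).1 hx)) u

open Polynomial in
/-- Adding a box with residue `r` to a multidiagram `s` changes the product of all generalized
hook lengths by the value at `z = r` of the rational function
`(z - r)⁻¹ ∏ (z - q c) ∏ (1 - 1 / (z - boxRes q x) ^ 2)`. -/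
theorem exists_hookProd_ratio {q : Fin m → K} (hq : IsSeparated n q) {s s' : Finset (Box m)}
    (hs : IsLowerBoxes s) (hs' : IsLowerBoxes s') (hn : s.card ≤ n) {x : Box m}
    (hx : Addable s x) (h : s' = insert x s) {L : Type*} [Field L] [Algebra K L] (z : L)
    (hz : ∀ a : K, z ≠ algebraMap K L a) :
    ∃ N D : K[X], D.eval (boxRes q x) ≠ 0 ∧
      hookProd q (boxDiagram hs') * D.eval (boxRes q x) =
        hookProd q (boxDiagram hs) * N.eval (boxRes q x) ∧
      (∏ c, (z - algebraMap K L (q c))) *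
        (∏ y ∈ s, (1 - (z - algebraMap K L (boxRes q y))⁻¹ *
          (z - algebraMap K L (boxRes q y))⁻¹)) * aeval z D =
        (z - algebraMap K L (boxRes q x)) * aeval z N := by
  classical
  obtain ⟨i, j, c⟩ := x
  have hadd := isAddCell_boxDiagram hs hs' hx.1 h
  have hres : boxRes q (i, j, c) = (j : K) - i + q c := rfl
  set M := boxDiagram hs with hM
  have hrowM : (M c).rowLen i = j := hadd.rowLen_left
  have hcolM : (M c).colLen j = i := hadd.colLen_left
  -- for the component `c` the factor `z - q u - j + colLen j` is `z - r`; it is left out of `N`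
  refine ⟨hookNum (M c) j (X - C (q c)) * ∏ u ∈ Finset.univ.erase c,
    ((X - C (q u) - (j : K[X]) + ((M u).colLen j : K[X])) * hookNum (M u) j (X - C (q u))),
    ∏ u, hookDen (M u) j (X - C (q u)), ?_, ?_, ?_⟩
  · rw [eval_prod]
    refine Finset.prod_ne_zero_iff.2 fun u _ => ?_
    rw [← coe_evalRingHom, map_hookDen]
    simp only [coe_evalRingHom, eval_sub, eval_X, eval_C]
    refine mul_ne_zero ?_ ?_
    · refine Finset.prod_ne_zero_iff.2 fun b hb => ?_
      have hmem : (i, b, c) ∈ s := by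
        rw [← mem_boxDiagram (hs := hs), YoungDiagram.mem_iff_lt_rowLen, ← hM, hrowM]
        simpa using hb
      have := hq.genHook_ne_zero hs hn hmem u
      rw [genHook, ← hM, hrowM] at this
      intro h0
      apply this
      push_cast
      rw [hres] at h0
      linear_combination h0
    · refine Finset.prod_ne_zero_iff.2 fun a ha => ?_
      have hmem : (a, j, u) ∈ s := by
        rw [← mem_boxDiagram (hs := hs), YoungDiagram.mem_iff_lt_colLen, ← hM]
        simpa using ha
      have := hq.genHook_ne_zero hs hn hmem c
      rw [genHook, ← hM, hcolM] at this
      intro h0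
      apply this
      push_cast
      rw [hres] at h0
      linear_combination -h0
  · have := hookProd_addCell q hadd fun u hu => boxDiagram_of_ne hs hs' h hu
    rw [eval_prod, eval_mul, eval_prod]
    simp only [eval_mul, eval_add, eval_sub, eval_X, eval_C, eval_natCast]
    simp only [← coe_evalRingHom, map_hookDen, map_hookNum]
    simp only [coe_evalRingHom, eval_sub, eval_X, eval_C, hres]
    exact this
  · rw [prod_boxDiagram hs, map_mul, map_prod, map_prod]
    simp only [map_hookDen, map_hookNum, map_mul, map_sub, map_add, aeval_X, aeval_C, map_natCast,
      ← hM]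
    have hy : ∀ (u : Fin m) (d : ℤ), z - algebraMap K L (q u) + d ≠ 0 := fun u d h0 =>
      hz (q u - d) (by rw [map_sub, map_intCast]; linear_combination h0)
    have key := fun u => prod_content_mul_hookDen (M u) j (z - algebraMap K L (q u)) (hy u)
    have hc : ∀ (u : Fin m) (y : ℕ × ℕ), z - algebraMap K L (boxRes q (y.1, y.2, u)) =
        z - algebraMap K L (q u) - ((y.2 : L) - y.1) := by
      intro u y
      rw [boxRes, map_add, map_sub, map_natCast, map_natCast]; ring
    simp only [hc]
    rw [← Finset.prod_mul_distrib, ← Finset.prod_mul_distrib, Finset.prod_congr rfl fun u _ => key u,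
      ← Finset.mul_prod_erase _ _ (Finset.mem_univ c), hcolM, hres, map_add, map_sub, map_natCast,
      map_natCast]
    ring

end Hooks

/-! ### The rational functions `φ_k` on joint eigenvectors -/

section Baxter

variable {K : Type*} [Field K] {m n : ℕ}

theorem IsJucysMurphy.map {A : Type*} [Ring A] [Algebra K A] {q : Fin m → K} {J s : ℕ → A}
    (hJ : IsJucysMurphy n q J s) {L B : Type*} [Field L] [Algebra K L] [Ring B] [Algebra L B]
    (f : A →+* B) (hf : ∀ a, f (algebraMap K A a) = algebraMap L B (algebraMap K L a)) :
    IsJucysMurphy n (algebraMap K L ∘ q) (f ∘ J) (f ∘ s) where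
  cyclotomic := by
    have := congrArg f hJ.cyclotomic
    rw [map_list_prod, List.map_ofFn, map_zero] at this
    rw [← this]
    congr 2
    funext c
    simp [hf]
  sq i hi := by simp only [Function.comp, ← map_mul, hJ.sq i hi, map_one]
  braid i hi := by simp only [Function.comp, ← map_mul, hJ.braid i hi]
  comm i j hi hj := (hJ.comm i j hi hj).map f
  jm_comm i j hi hj := (hJ.jm_comm i j hi hj).map f
  jm_succ i hi := by simp only [Function.comp, ← map_mul, ← map_add, hJ.jm_succ i hi]
  s_comm i j hi hj h h' := (hJ.s_comm i j hi hj h h').map f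

/-- If `X 0` is `f(z) / (z - J 0)` and `X (k + 1)` is obtained from `X k` as `φ_{k+2}` from
`φ_{k+1}`, then `X k * (z - J k)` acts as a scalar on the vectors which are eigenvectors of
`J 0, …, J (k - 1)`. Consequently `X k` itself acts as a scalar on an eigenvector of `J k`. -/
theorem IsJucysMurphy.baxter_mul {L B : Type*} [Field L] [Ring B] [Algebra L B] {q : Fin m → L}
    {J s : ℕ → B} (hJ : IsJucysMurphy n q J s) {z : L} {X : ℕ → B}
    (hX : X 0 * (algebraMap L B z - J 0) = algebraMap L B (∏ c, (z - q c))) {w : ℕ → L} {k : ℕ}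
    (hk : k < n) (hsucc : ∀ i < k, X (i + 1) = (algebraMap L B (z - w i)⁻¹ + s i) * X i * s i)
    (hz : ∀ i < k, z ≠ w i) {e : B} (he : IsWeight J k w e) :
    X k * ((algebraMap L B z - J k) * e) =
      ((∏ c, (z - q c)) * ∏ i ∈ Finset.range k, (1 - (z - w i)⁻¹ * (z - w i)⁻¹)) • e := by
  induction k generalizing e with
  | zero =>
    rw [← mul_assoc, hX, Finset.prod_range_zero, mul_one, Algebra.smul_def]
  | succ k ih =>
    have ih' := fun {e} => ih (by omega) (fun i hi => hsucc i (by omega))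
      (fun i hi => hz i (by omega)) (e := e)
    set F := (∏ c, (z - q c)) * ∏ i ∈ Finset.range k, (1 - (z - w i)⁻¹ * (z - w i)⁻¹) with hF
    have h0 : z - w k ≠ 0 := sub_ne_zero.2 (hz k k.lt_succ_self)
    -- `s k * e` is an eigenvector of `J 0, …, J (k - 1)`, and `e` one of `J 0, …, J k`
    have h1 := ih' (hJ.isWeight_s_mul hk (he.mono k.le_succ))
    have h2 : X k * e = (F * (z - w k)⁻¹) • e := by
      have := ih' (he.mono k.le_succ)
      rw [sub_mul, he k k.lt_succ_self, ← Algebra.smul_def, ← sub_smul, mul_smul_comm] at this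
      rw [mul_comm, mul_smul, ← this, smul_smul, inv_mul_cancel₀ h0, one_smul]
    have h3 : s k * ((algebraMap L B z - J (k + 1)) * e) =
        (algebraMap L B z - J k) * (s k * e) - e := by
      have h4 := congrArg (· * e) (hJ.s_mul_jm_succ hk)
      have h5 := Algebra.commutes z (s k)
      simp only [add_mul, one_mul, mul_assoc] at h4
      rw [sub_mul, mul_sub, h4, ← mul_assoc, ← h5]
      noncomm_ring
    have h6 : s k * (s k * e) = e := by rw [← mul_assoc, hJ.sq k hk, one_mul]
    rw [hsucc k k.lt_succ_self, mul_assoc, h3, mul_assoc, mul_sub, h1, h2, add_mul, mul_sub,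
      mul_smul_comm, mul_smul_comm, mul_sub, mul_smul_comm, mul_smul_comm, h6, ← Algebra.smul_def,
      ← Algebra.smul_def, Finset.prod_range_succ, ← mul_assoc, ← hF]
    module

/-- The action of `X k` on a joint eigenvector, for an algebra whose scalars are extended from
`K` to a field of rational functions. -/
theorem IsJucysMurphy.baxter_mul_eq {A : Type*} [Ring A] [Algebra K A] {q : Fin m → K}
    {J s : ℕ → A} (hJ : IsJucysMurphy n q J s) {L B : Type*} [Field L] [Algebra K L] [Ring B]
    (f : A →+* B) (i : L →+* B) (hi : ∀ u b, i u * b = b * i u)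
    (hf : ∀ a, f (algebraMap K A a) = i (algebraMap K L a)) {z : L}
    (hz : ∀ a, z ≠ algebraMap K L a) {X : ℕ → B}
    (hX : X 0 * (i z - f (J 0)) = i (∏ c, (z - algebraMap K L (q c)))) {w : ℕ → K} {k : ℕ}
    (hk : k < n) (hsucc : ∀ j < k,
      X (j + 1) = (i (z - algebraMap K L (w j))⁻¹ + f (s j)) * X j * f (s j))
    {e : A} (he : IsWeight J (k + 1) w e) :
    X k * f e = i ((∏ c, (z - algebraMap K L (q c))) * (∏ j ∈ Finset.range k,
      (1 - (z - algebraMap K L (w j))⁻¹ * (z - algebraMap K L (w j))⁻¹)) *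
      (z - algebraMap K L (w k))⁻¹) * f e := by
  let _ : Algebra L B := i.toAlgebra' hi
  have halg : ∀ u, i u = algebraMap L B u := fun _ => rfl
  simp only [halg] at hX hsucc hf ⊢
  have he' : IsWeight (f ∘ J) (k + 1) (algebraMap K L ∘ w) (f e) := fun j hj => by
    rw [Function.comp, ← map_mul, he j hj, Algebra.smul_def, map_mul, hf, Algebra.smul_def,
      Function.comp]
  have h0 : z - algebraMap K L (w k) ≠ 0 := sub_ne_zero.2 (hz _)
  have := (hJ.map f hf).baxter_mul hX hk hsucc (fun j _ => hz _) (he'.mono k.le_succ)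
  rw [sub_mul, he' k k.lt_succ_self, ← Algebra.smul_def, ← sub_smul, mul_smul_comm] at this
  simp only [Function.comp] at this
  rw [← Algebra.smul_def, mul_comm, mul_smul, ← this, smul_smul, inv_mul_cancel₀ h0, one_smul]

open Polynomial in
/-- A polynomial form of `f(z) / (z - y)` when `f(y) = 0`. -/
theorem exists_mul_sub_eq {R B : Type*} [CommRing R] [Ring B] (i : R →+* B)
    (hi : ∀ r b, i r * b = b * i r) {q : Fin m → R} {y : B}
    (hy : (List.ofFn fun c => y - i (q c)).prod = 0) (z : R) :
    ∃ P : B, P * (i z - y) = i (∏ c, (z - q c)) ∧ Commute P (i z - y) := by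
  let _ : Algebra R B := i.toAlgebra' hi
  have halg : ∀ r, i r = algebraMap R B r := fun _ => rfl
  obtain ⟨g, hg⟩ := X_sub_C_dvd_sub_C_eval (a := z) (p := ∏ c, (X - C (q c)))
  refine ⟨aeval y g, ?_, ?_⟩
  · have h1 : aeval y (∏ c, (X - C (q c))) = 0 := by
      rw [← hy, ← List.prod_ofFn, map_list_prod, List.map_ofFn]
      congr 2
      funext c
      simp [halg]
    have h2 := congrArg (aeval y) hg
    rw [mul_comm, map_sub, h1, aeval_C, map_mul, map_sub, aeval_X, aeval_C, eval_prod] at h2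
    simp only [eval_sub, eval_X, eval_C] at h2
    rw [halg, halg, ← neg_sub, mul_neg, ← h2, zero_sub, neg_neg]
  · refine Commute.sub_right (hi z _).symm ?_
    have := (Commute.all g X).map (aeval y : R[X] →ₐ[R] B)
    rwa [aeval_X] at this

end Baxter

/-! ### Evaluation of rational functions -/

section Evaluation

variable {K : Type*} [Field K] {m n : ℕ} {q : Fin m → K}

/-- The scalar rational function `u` is regular along `z_{k+1} = a`, with value `u'`. -/
def ScalarEvaluatesTo (k : Fin n) (a : K) (u u' : RatFun K n) : Prop :=
  ∃ P d : Pol K n, subst k a d ≠ 0 ∧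
    algebraMap (Pol K n) (RatFun K n) d * u = algebraMap (Pol K n) (RatFun K n) P ∧
    algebraMap (Pol K n) (RatFun K n) (subst k a d) * u' =
      algebraMap (Pol K n) (RatFun K n) (subst k a P)

namespace ScalarEvaluatesTo

variable {k : Fin n} {a : K} {u u' v v' : RatFun K n}

theorem pol (P : Pol K n) : ScalarEvaluatesTo k a (algebraMap _ _ P) (algebraMap _ _ (subst k a P)) :=
  ⟨P, 1, by rw [map_one]; exact one_ne_zero, by rw [map_one, one_mul],
    by rw [map_one, map_one, one_mul]⟩

theorem const (b : K) : ScalarEvaluatesTo k a (algebraMap K (RatFun K n) b)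
    (algebraMap K (RatFun K n) b) := by
  have := pol (k := k) (a := a) (algebraMap K (Pol K n) b)
  rwa [AlgHom.commutes, ← IsScalarTower.algebraMap_apply] at this

theorem var_self : ScalarEvaluatesTo k a (var K k) (algebraMap K (RatFun K n) a) := by
  have := pol (k := k) (a := a) (MvPolynomial.X k)
  rwa [subst, MvPolynomial.aeval_X, Function.update_self, ← MvPolynomial.algebraMap_eq,
    ← IsScalarTower.algebraMap_apply] at this

theorem var_of_ne {j : Fin n} (h : j ≠ k) : ScalarEvaluatesTo k a (var K j) (var K j) := by
  have := pol (k := k) (a := a) (MvPolynomial.X j)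
  rwa [subst, MvPolynomial.aeval_X, Function.update_of_ne h] at this

theorem add (hu : ScalarEvaluatesTo k a u u') (hv : ScalarEvaluatesTo k a v v') :
    ScalarEvaluatesTo k a (u + v) (u' + v') := by
  obtain ⟨P, d, hd, h1, h2⟩ := hu
  obtain ⟨Q, e, he, h3, h4⟩ := hv
  refine ⟨e * P + d * Q, d * e, ?_, ?_, ?_⟩
  · rw [map_mul]; exact mul_ne_zero hd he
  · simp only [map_add, map_mul, ← h1, ← h3]; ring
  · simp only [map_add, map_mul, ← h2, ← h4]; ring

theorem mul (hu : ScalarEvaluatesTo k a u u') (hv : ScalarEvaluatesTo k a v v') :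
    ScalarEvaluatesTo k a (u * v) (u' * v') := by
  obtain ⟨P, d, hd, h1, h2⟩ := hu
  obtain ⟨Q, e, he, h3, h4⟩ := hv
  refine ⟨P * Q, d * e, ?_, ?_, ?_⟩
  · rw [map_mul]; exact mul_ne_zero hd he
  · simp only [map_mul, ← h1, ← h3]; ring
  · simp only [map_mul, ← h2, ← h4]; ring

theorem sub (hu : ScalarEvaluatesTo k a u u') (hv : ScalarEvaluatesTo k a v v') :
    ScalarEvaluatesTo k a (u - v) (u' - v') := by
  have := hu.add ((const (k := k) (a := a) (-1)).mul hv)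
  simpa only [map_neg, map_one, neg_one_mul, ← sub_eq_add_neg] using this

theorem ne_zero (hu : ScalarEvaluatesTo k a u u') (h0 : u' ≠ 0) : u ≠ 0 := by
  rintro rfl
  obtain ⟨P, d, hd, h1, h2⟩ := hu
  have hinj := IsFractionRing.injective (Pol K n) (RatFun K n)
  rw [mul_zero] at h1
  rw [(map_eq_zero_iff _ hinj).1 h1.symm, map_zero, map_zero] at h2
  exact mul_ne_zero ((map_ne_zero_iff _ hinj).2 hd) h0 h2

theorem inv (hu : ScalarEvaluatesTo k a u u') (h0 : u' ≠ 0) :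
    ScalarEvaluatesTo k a u⁻¹ u'⁻¹ := by
  have hu0 := hu.ne_zero h0
  obtain ⟨P, d, hd, h1, h2⟩ := hu
  have hinj := IsFractionRing.injective (Pol K n) (RatFun K n)
  have h3 : subst k a P ≠ 0 := by
    rintro h
    rw [h, map_zero] at h2
    exact mul_ne_zero ((map_ne_zero_iff _ hinj).2 hd) h0 h2
  refine ⟨d, P, h3, ?_, ?_⟩
  · rw [← h1, mul_inv_cancel_right₀ hu0]
  · rw [← h2, mul_inv_cancel_right₀ h0]

theorem aeval_var (f : Polynomial K) : ScalarEvaluatesTo k a (Polynomial.aeval (var K k) f)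
    (algebraMap K (RatFun K n) (f.eval a)) := by
  induction f using Polynomial.induction_on' with
  | add f g hf hg => rw [map_add, Polynomial.eval_add, map_add]; exact hf.add hg
  | monomial i c =>
    rw [Polynomial.aeval_monomial, Polynomial.eval_monomial, map_mul, map_pow]
    refine (const c).mul ?_
    induction i with
    | zero => simpa using const (k := k) (a := a) 1
    | succ i ih => rw [pow_succ, pow_succ]; exact ih.mul var_self

end ScalarEvaluatesTo

theorem scal_mul_comm (u : RatFun K n) (F : HRat n q) : scal q u * F = F * scal q u := by
  induction F using TensorProduct.induction_on with
  | zero => simp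
  | tmul x y => simp [scal, mul_comm]
  | add x y hx hy => rw [mul_add, add_mul, hx, hy]

theorem hsubst_scalar (k : Fin n) (a : K) (d : Pol K n) :
    hsubst q k a (Algebra.TensorProduct.includeRight d) =
      Algebra.TensorProduct.includeRight (subst k a d) := by
  simp [hsubst]

namespace EvaluatesTo

variable {k : Fin n} {a : K} {F F' G G' : HRat n q}

theorem const (x : Hecke n q) : EvaluatesTo q k a (const q x) (const q x) :=
  ⟨x ⊗ₜ 1, 1, by rw [map_one]; exact one_ne_zero,
    by simp [DegenerateCyclotomic.const, polToRat],
    by simp [DegenerateCyclotomic.const, polToRat, hsubst]⟩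

theorem scal {u u' : RatFun K n} (h : ScalarEvaluatesTo k a u u') :
    EvaluatesTo q k a (scal q u) (scal q u') := by
  obtain ⟨P, d, hd, h1, h2⟩ := h
  refine ⟨Algebra.TensorProduct.includeRight P, d, hd, ?_, ?_⟩
  · rw [← map_mul, h1, scal_pol]
  · rw [← map_mul, h2, scal_pol, hsubst_scalar]

theorem mul (hF : EvaluatesTo q k a F F') (hG : EvaluatesTo q k a G G') :
    EvaluatesTo q k a (F * G) (F' * G') := by
  obtain ⟨P, d, hd, h1, h2⟩ := hF
  obtain ⟨Q, e, he, h3, h4⟩ := hG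
  refine ⟨P * Q, d * e, ?_, ?_, ?_⟩
  · rw [map_mul]; exact mul_ne_zero hd he
  · rw [map_mul (polToRat q), ← h1, ← h3, map_mul, map_mul, mul_assoc, ← mul_assoc _ F G,
      scal_mul_comm _ F, mul_assoc F, ← mul_assoc]
  · rw [map_mul (hsubst q k a), map_mul (polToRat q), ← h2, ← h4, map_mul, map_mul, map_mul,
      mul_assoc, ← mul_assoc _ F' G', scal_mul_comm _ F', mul_assoc F', ← mul_assoc]

theorem add (hF : EvaluatesTo q k a F F') (hG : EvaluatesTo q k a G G') :
    EvaluatesTo q k a (F + G) (F' + G') := by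
  obtain ⟨P, d, hd, h1, h2⟩ := hF
  obtain ⟨Q, e, he, h3, h4⟩ := hG
  refine ⟨Algebra.TensorProduct.includeRight e * P + Algebra.TensorProduct.includeRight d * Q,
    d * e, ?_, ?_, ?_⟩
  · rw [map_mul]; exact mul_ne_zero hd he
  · rw [map_add, map_mul (polToRat q), map_mul (polToRat q), ← h1, ← h3, ← scal_pol, ← scal_pol,
      ← mul_assoc, ← mul_assoc, ← map_mul, ← map_mul, ← map_mul, ← map_mul, mul_comm e, mul_add]
  · rw [map_add, map_mul (hsubst q k a), map_mul (hsubst q k a), hsubst_scalar, hsubst_scalar,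
      map_add, map_mul (polToRat q), map_mul (polToRat q), ← h2, ← h4, ← scal_pol, ← scal_pol,
      ← mul_assoc, ← mul_assoc, map_mul (subst k a), map_mul (algebraMap _ _), map_mul, mul_add,
      scal_mul_comm _ (DegenerateCyclotomic.scal q (algebraMap _ _ (subst k a e)))]

theorem sum {ι : Type*} {S : Finset ι} {F F' : ι → HRat n q}
    (h : ∀ i ∈ S, EvaluatesTo q k a (F i) (F' i)) :
    EvaluatesTo q k a (∑ i ∈ S, F i) (∑ i ∈ S, F' i) := by
  classical
  induction S using Finset.induction_on with
  | empty => simpa using EvaluatesTo.const (q := q) (k := k) (a := a) 0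
  | insert i S hi ih =>
    rw [Finset.sum_insert hi, Finset.sum_insert hi]
    exact (h i (Finset.mem_insert_self i S)).add
      (ih fun j hj => h j (Finset.mem_insert_of_mem hj))

end EvaluatesTo

theorem var_ne_algebraMap (k : Fin n) (b : K) : var K k ≠ algebraMap K (RatFun K n) b := by
  rw [var, IsScalarTower.algebraMap_apply K (Pol K n)]
  intro h
  have := IsFractionRing.injective (Pol K n) (RatFun K n) h
  rw [MvPolynomial.algebraMap_eq] at this
  have h1 := congrArg (MvPolynomial.aeval (fun _ => b + 1)) this
  rw [MvPolynomial.aeval_X, MvPolynomial.aeval_C] at h1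
  simp at h1

theorem var_injective : Function.Injective (var K : Fin n → RatFun K n) := fun _ _ h =>
  MvPolynomial.X_injective (IsFractionRing.injective (Pol K n) (RatFun K n) h)

end Evaluation

/-! ### The fusion procedure -/

section FusionProcedure

variable {K : Type*} [Field K] {m n : ℕ} {q : Fin m → K}

/-- `f(z) / (z - t)` is a polynomial in `z` and `t`. -/
theorem exists_polynomial_mul_sub_eq (hn : 0 < n) (z : Pol K n) :
    ∃ P : HPol n q, P * (1 ⊗ₜ z - genT n q ⊗ₜ 1) =
      1 ⊗ₜ (∏ c, (z - algebraMap K (Pol K n) (q c))) ∧ Commute P (1 ⊗ₜ z - genT n q ⊗ₜ 1) := by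
  have hi : ∀ (d : Pol K n) (F : HPol n q),
      (Algebra.TensorProduct.includeRight d : HPol n q) * F =
        F * Algebra.TensorProduct.includeRight d := fun d F => by
    induction F using TensorProduct.induction_on with
    | zero => simp
    | tmul x y => simp [mul_comm]
    | add x y hx hy => rw [mul_add, add_mul, hx, hy]
  let i : Pol K n →+* HPol n q :=
    (Algebra.TensorProduct.includeRight : Pol K n →ₐ[K] HPol n q).toRingHom
  refine exists_mul_sub_eq (B := HPol n q) i hi
    (q := fun c => algebraMap K (Pol K n) (q c)) ?_ z
  have := congrArg (Algebra.TensorProduct.includeLeft : Hecke n q →ₐ[K] HPol n q)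
    (isJucysMurphy_hecke q hn).cyclotomic
  rw [map_list_prod, List.map_ofFn, map_zero, jmSeq_of_lt q hn, jm] at this
  rw [← this]
  congr 2
  funext c
  rw [Function.comp, map_sub, AlgHom.commutes]
  exact congrArg _ (AlgHom.commutes _ _)

/-- `t(z_{k+1})` is a polynomial, and the evaluations of the other variables do not change it. -/
theorem exists_tFun_eq (hn : 0 < n) (k : Fin n) :
    tFun q (var K k) * (scal q (var K k) - const q (genT n q)) =
      scal q (∏ c, (var K k - algebraMap K (RatFun K n) (q c))) ∧
    ∀ (j : Fin n) (a : K), k ≠ j → EvaluatesTo q j a (tFun q (var K k)) (tFun q (var K k)) := by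
  obtain ⟨P, hP, hc⟩ := exists_polynomial_mul_sub_eq (q := q) hn (MvPolynomial.X k)
  have h1 : polToRat q (1 ⊗ₜ MvPolynomial.X k - genT n q ⊗ₜ 1) =
      scal q (var K k) - const q (genT n q) := by
    simp [polToRat, scal, const, var]
  set f := ∏ c, (MvPolynomial.X k - algebraMap K (Pol K n) (q c)) with hf
  have h2 : polToRat q (1 ⊗ₜ f) =
      scal q (∏ c, (var K k - algebraMap K (RatFun K n) (q c))) := by
    have : algebraMap (Pol K n) (RatFun K n) f =
        ∏ c, (var K k - algebraMap K (RatFun K n) (q c)) := by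
      rw [hf, map_prod]
      simp only [map_sub, ← IsScalarTower.algebraMap_apply]
      rfl
    rw [← this, scal_pol]
    rfl
  have h0 : ∏ c, (var K k - algebraMap K (RatFun K n) (q c)) ≠ 0 :=
    Finset.prod_ne_zero_iff.2 fun c _ => sub_ne_zero.2 (var_ne_algebraMap k _)
  generalize hprod : ∏ c, (var K k - algebraMap K (RatFun K n) (q c)) = u at h2 h0 ⊢
  have h3 : polToRat q P * (scal q (var K k) - const q (genT n q)) = scal q u := by
    rw [← h1, ← map_mul, hP, h2]
  have h4 : (scal q (var K k) - const q (genT n q)) * polToRat q P = scal q u := by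
    rw [← h3, ← h1]; exact (hc.map (polToRat q)).eq.symm
  have hu : scal q u⁻¹ * scal q u = 1 := by rw [← map_mul, inv_mul_cancel₀ h0, map_one]
  have hunit : IsUnit (scal q (var K k) - const q (genT n q)) := by
    refine isUnit_iff_exists_and_exists.2 ⟨⟨polToRat q P * scal q u⁻¹, ?_⟩,
      ⟨scal q u⁻¹ * polToRat q P, ?_⟩⟩
    · rw [← mul_assoc, h4, scal_mul_comm, hu]
    · rw [mul_assoc, h3, hu]
  have h5 : tFun q (var K k) * (scal q (var K k) - const q (genT n q)) = scal q u := by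
    rw [tFun, ← hprod, mul_assoc, Ring.inverse_mul_cancel _ hunit, mul_one]
  refine ⟨h5, fun j a hj => ⟨P, 1, by rw [map_one]; exact one_ne_zero, ?_, ?_⟩⟩
  · rw [map_one, map_one, one_mul]
    exact hunit.mul_right_cancel (h5.trans h3.symm)
  · rw [map_one, map_one, map_one, one_mul]
    refine hunit.mul_right_cancel (h5.trans ?_)
    have h6 := congrArg (hsubst q j a) hP
    rw [map_mul] at h6
    have hX : subst j a (MvPolynomial.X k) = MvPolynomial.X k := by
      rw [subst, MvPolynomial.aeval_X, Function.update_of_ne hj]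
    have h7 : hsubst q j a (1 ⊗ₜ MvPolynomial.X k - genT n q ⊗ₜ 1) =
        1 ⊗ₜ MvPolynomial.X k - genT n q ⊗ₜ 1 := by
      rw [map_sub, hsubst, Algebra.TensorProduct.map_tmul, Algebra.TensorProduct.map_tmul, hX,
        map_one, map_one, AlgHom.id_apply]
    have h8 : hsubst q j a (1 ⊗ₜ f) = 1 ⊗ₜ f := by
      rw [hsubst, Algebra.TensorProduct.map_tmul, hf, map_prod]
      simp only [map_sub, hX, AlgHom.commutes, map_one]
    rw [h7, h8] at h6
    rw [← h1, ← map_mul, h6, h2]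

/-- The functions `φ_{k+1}` with arbitrary rational functions `v 0, …, v (k - 1)` in place of the
variables `z_1, …, z_k`. -/
noncomputable def phiGen (q : Fin m → K) (v : ℕ → RatFun K n) (z : RatFun K n) : ℕ → HRat n q
  | 0 => tFun q z
  | k + 1 => (scal q (z - v k)⁻¹ + const q (genSeq n q k)) * phiGen q v z k *
      const q (genSeq n q k)

theorem phi_eq_phiGen {v : ℕ → RatFun K n} (hv : ∀ i : Fin n, v i = var K i) (z : RatFun K n) :
    ∀ (k : ℕ) (h : k < n), phi q k h z = phiGen q v z k
  | 0, _ => rfl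
  | k + 1, h => by
    rw [phi, phiGen, phi_eq_phiGen hv z k (by omega), baxter, genSeq_of_lt q h, one_div,
      hv ⟨k, by omega⟩]

/-- The first `k` variables are replaced by the residues of the sequence `p`. -/
noncomputable def fusionArgs (q : Fin m → K) (p : ℕ → Box m) (k i : ℕ) : RatFun K n :=
  if i < k then algebraMap K (RatFun K n) (boxRes q (p i))
  else if h : i < n then var K ⟨i, h⟩ else 0

theorem fusionArgs_of_lt {p : ℕ → Box m} {k i : ℕ} (h : i < k) :
    fusionArgs (n := n) q p k i = algebraMap K (RatFun K n) (boxRes q (p i)) := if_pos h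

theorem fusionArgs_of_le {p : ℕ → Box m} {k : ℕ} {i : Fin n} (h : k ≤ i) :
    fusionArgs q p k i = var K i := by
  rw [fusionArgs, if_neg (not_lt.2 h), dif_pos i.2]

theorem scalarEvaluatesTo_fusionArgs (p : ℕ → Box m) (k : Fin n) {i : ℕ} (hi : i < n) :
    ScalarEvaluatesTo k (boxRes q (p k)) (fusionArgs q p k i) (fusionArgs q p (k + 1) i) := by
  rcases lt_trichotomy i k with h | rfl | h
  · rw [fusionArgs_of_lt h, fusionArgs_of_lt (by omega)]
    exact .const _
  · rw [fusionArgs_of_le le_rfl, fusionArgs_of_lt (Nat.lt_succ_self _)]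
    exact .var_self
  · rw [fusionArgs_of_le (i := ⟨i, hi⟩) h.le, fusionArgs_of_le (i := ⟨i, hi⟩) h]
    exact .var_of_ne (Fin.ne_of_gt h)

theorem var_ne_fusionArgs (p : ℕ → Box m) (k : ℕ) {i : ℕ} {j : Fin n} (h : i < j) :
    var K j ≠ fusionArgs q p k i := by
  rcases lt_or_ge i k with h1 | h1
  · rw [fusionArgs_of_lt h1]
    exact var_ne_algebraMap _ _
  · rw [fusionArgs_of_le (i := ⟨i, h.trans j.2⟩) h1]
    exact fun h2 => (Fin.ne_of_gt h) (var_injective h2)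

/-- The evaluation of `z_{k+1}` in a function `φ` whose last argument is a later variable. -/
theorem evaluatesTo_phiGen (p : ℕ → Box m) (k : Fin n) {j : Fin n} (hkj : k < j) {l : ℕ}
    (hl : l ≤ j) : EvaluatesTo q k (boxRes q (p k)) (phiGen q (fusionArgs q p k) (var K j) l)
      (phiGen q (fusionArgs q p (k + 1)) (var K j) l) := by
  induction l with
  | zero => exact (exists_tFun_eq k.pos j).2 k _ hkj.ne'
  | succ l ih =>
    have h1 := (ScalarEvaluatesTo.var_of_ne (a := boxRes q (p k)) hkj.ne').sub
      (scalarEvaluatesTo_fusionArgs (q := q) p k (i := l) (by omega))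
    have h2 := h1.inv (sub_ne_zero.2 (var_ne_fusionArgs p (k + 1) (by omega)))
    exact (((EvaluatesTo.scal h2).add (.const _)).mul (ih (by omega))).mul (.const _)

theorem prod_boxShape {M : Type*} [CommMonoid M] {p : ℕ → Box m} {k : ℕ} (hp : Std k p)
    (f : Box m → M) : ∏ y ∈ boxShape p k, f y = ∏ i ∈ Finset.range k, f (p i) := by
  refine Finset.prod_image fun i hi j hj h => ?_
  simp only [Finset.coe_range, Set.mem_Iio] at hi hj
  rcases lt_trichotomy i j with h1 | h1 | h1
  · exact absurd h (hp.ne h1 hj)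
  · exact h1
  · exact absurd h.symm (hp.ne h1 hi)

/-- `f(z) ∏ (1 - 1 / (z - c) ^ 2)`, the product being over the residues `c` of the first `k` boxes
of `p`. -/
noncomputable def fusionFactor (q : Fin m → K) (p : ℕ → Box m) (k : ℕ) (z : RatFun K n) :
    RatFun K n :=
  (∏ c, (z - algebraMap K (RatFun K n) (q c))) * ∏ i ∈ Finset.range k,
    (1 - (z - algebraMap K (RatFun K n) (boxRes q (p i)))⁻¹ *
      (z - algebraMap K (RatFun K n) (boxRes q (p i)))⁻¹)

/-- When the first `k` variables are the residues of a tableau, `φ_{k+1}(z)` acts as a scalar on the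
idempotent of an extension of this tableau by one box. -/
theorem phiGen_mul_tabIdem_succ [Nonempty (Fin m)] (hq : IsSeparated n q) {p : ℕ → Box m}
    (k : Fin n) (hp : Std (k + 1) p) {v : ℕ → RatFun K n}
    (hv : ∀ i < (k : ℕ), v i = algebraMap K (RatFun K n) (boxRes q (p i))) :
    phiGen q v (var K k) k * const q (tabIdem q (jmSeq n q) p (k + 1)) =
      scal q (fusionFactor q p k (var K k) *
        (var K k - algebraMap K (RatFun K n) (boxRes q (p k)))⁻¹) *
        const q (tabIdem q (jmSeq n q) p (k + 1)) := by
  have hJ := isJucysMurphy_hecke q k.pos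
  refine hJ.baxter_mul_eq (const q).toRingHom (scal q).toRingHom scal_mul_comm (fun a => ?_)
    (var_ne_algebraMap k) (X := phiGen q v (var K k)) ?_ k.2 (fun j hj => ?_)
    (hJ.isWeight_tabIdem hq k.2 hp)
  · exact ((const q).commutes a).trans (((scal q).commutes a).symm.trans rfl)
  · rw [jmSeq_of_lt q k.pos, jm]
    exact (exists_tFun_eq k.pos k).1
  · rw [Function.comp, ← hv j hj]
    rfl

/-- Multiplication by the next `φ` and evaluation at the next residue take the idempotent of a
tableau to a multiple of the idempotent of the extended tableau. The multiple is the change in the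
product of the generalized hook lengths. -/
theorem evaluatesTo_phiGen_mul_tabIdem [Nonempty (Fin m)] (hq : IsSeparated n q) {p : ℕ → Box m}
    (k : Fin n) (hp : Std (k + 1) p) {v : ℕ → RatFun K n}
    (hv : ∀ i < (k : ℕ), v i = algebraMap K (RatFun K n) (boxRes q (p i))) :
    EvaluatesTo q k (boxRes q (p k))
      (phiGen q v (var K k) k * const q (hookProd q (boxDiagram (hp.mono k.1.le_succ).isLower) •
        tabIdem q (jmSeq n q) p k))
      (const q (hookProd q (boxDiagram hp.isLower) • tabIdem q (jmSeq n q) p (k + 1))) := by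
  classical
  have hp' := hp.mono k.1.le_succ
  set a := boxRes q (p k) with ha
  set z : RatFun K n := var K k with hz
  obtain ⟨N, D, hD, hND, hF⟩ := exists_hookProd_ratio hq hp'.isLower hp.isLower
    (by rw [hp'.card]; exact k.2.le) (hp k k.1.lt_succ_self) (boxShape_succ p k) z
    (var_ne_algebraMap k)
  rw [prod_boxShape hp' fun y => 1 - (z - algebraMap K (RatFun K n) (boxRes q y))⁻¹ *
    (z - algebraMap K (RatFun K n) (boxRes q y))⁻¹, ← ha] at hF
  change fusionFactor q p k z * _ = _ at hF
  have hza : z - algebraMap K (RatFun K n) a ≠ 0 := sub_ne_zero.2 (var_ne_algebraMap k _)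
  have hD0 : algebraMap K (RatFun K n) (D.eval a) ≠ 0 := by simpa using hD
  have hDz : Polynomial.aeval z D ≠ 0 := (ScalarEvaluatesTo.aeval_var D).ne_zero hD0
  -- the coefficient of the idempotent of each extension by an addable box `x`
  have hcoeff : ∀ x ∈ addables (boxShape p k), ScalarEvaluatesTo k a
      (fusionFactor q p k z * (z - algebraMap K (RatFun K n) (boxRes q x))⁻¹)
      (algebraMap K (RatFun K n) (if x = p k then N.eval a / D.eval a else 0)) := by
    intro x hx
    have hND' := (ScalarEvaluatesTo.aeval_var (k := k) (a := a) N).mul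
      ((ScalarEvaluatesTo.aeval_var D).inv hD0)
    have hF' : fusionFactor q p k z = (z - algebraMap K (RatFun K n) a) *
        (Polynomial.aeval z N * (Polynomial.aeval z D)⁻¹) := by
      rw [← mul_assoc, ← hF, mul_inv_cancel_right₀ hDz]
    rw [hF']
    split_ifs with h
    · rw [h, ← ha, mul_right_comm, mul_inv_cancel₀ hza, one_mul, map_div₀, div_eq_mul_inv]
      exact hND'
    · -- the factor `z - a` of `F` is not cancelled
      have hne : a ≠ boxRes q x := fun h' => h (hq.injOn_addables k.2 hp' hx
        (mem_addables hp'.isLower |>.2 (hp k k.1.lt_succ_self)) h'.symm)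
      have h1 := ScalarEvaluatesTo.var_self.sub (.const (k := k) (a := a) a)
      have h2 := ScalarEvaluatesTo.var_self.sub (.const (k := k) (a := a) (boxRes q x))
      have h3 := (h1.mul hND').mul (h2.inv (sub_ne_zero.2 fun h' =>
        hne ((algebraMap K (RatFun K n)).injective h')))
      rwa [sub_self, zero_mul, zero_mul, ← map_zero (algebraMap K (RatFun K n))] at h3
  have hJ := isJucysMurphy_hecke q k.pos
  -- the idempotent is split into those of its extensions
  have hsum : phiGen q v z k * const q (hookProd q (boxDiagram hp'.isLower) •
      tabIdem q (jmSeq n q) p k) = ∑ x ∈ addables (boxShape p k),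
        scal q (fusionFactor q p k z * (z - algebraMap K (RatFun K n) (boxRes q x))⁻¹) *
          const q (hookProd q (boxDiagram hp'.isLower) •
            tabIdem q (jmSeq n q) (Function.update p k x) (k + 1)) := by
    rw [← hJ.sum_tabIdem_update hq k.2 hp', Finset.smul_sum, map_sum, Finset.mul_sum]
    refine Finset.sum_congr rfl fun x hx => ?_
    have hfix : ∀ i < (k : ℕ), Function.update p k x i = p i := fun i hi =>
      Function.update_of_ne hi.ne _ _
    have h1 := phiGen_mul_tabIdem_succ hq k (hp'.update ((mem_addables hp'.isLower).1 hx))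
      (v := v) fun i hi => by rw [hfix i hi, hv i hi]
    have h2 : fusionFactor q (Function.update p k x) k z = fusionFactor q p k z := by
      rw [fusionFactor, fusionFactor]
      congr 1
      refine Finset.prod_congr rfl fun i hi => ?_
      rw [hfix i (Finset.mem_range.1 hi)]
    rw [h2, Function.update_self] at h1
    rw [map_smul, mul_smul_comm, h1, mul_smul_comm]
  have hval : const q (hookProd q (boxDiagram hp.isLower) • tabIdem q (jmSeq n q) p (k + 1)) =
      ∑ x ∈ addables (boxShape p k),
        scal q (algebraMap K (RatFun K n) (if x = p k then N.eval a / D.eval a else 0)) *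
          const q (hookProd q (boxDiagram hp'.isLower) •
            tabIdem q (jmSeq n q) (Function.update p k x) (k + 1)) := by
    rw [Finset.sum_eq_single_of_mem (p k)
      ((mem_addables hp'.isLower).2 (hp k k.1.lt_succ_self))]
    · rw [if_pos rfl, Function.update_eq_self, AlgHom.commutes, ← Algebra.smul_def, ← map_smul,
        smul_smul, mul_comm, mul_div_assoc', ← hND, mul_div_cancel_right₀ _ hD]
    · intro x _ hx
      rw [if_neg hx, map_zero, map_zero, zero_mul]
  rw [hsum, hval]
  exact EvaluatesTo.sum fun x hx => (EvaluatesTo.scal (hcoeff x hx)).mul (.const _)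

/-- The rational functions which interpolate between `Φ` and the idempotent. The stage `(k, j)` is
the product of the last `j` factors of `Φ` after the evaluation of the first `k` variables; when
`j ≤ k`, nothing is left but a multiple of an idempotent. -/
noncomputable def fusionStage (q : Fin m → K) {p : ℕ → Box m} (hp : Std n p) (k : ℕ) :
    (j : ℕ) → j ≤ n → HRat n q
  | 0, _ => 1
  | j + 1, h =>
    if j < k then const q (hookProd q (boxDiagram (hp.mono h).isLower) •
      tabIdem q (jmSeq n q) p (j + 1))
    else phiGen q (fusionArgs q p k) (var K ⟨j, h⟩) j * fusionStage q hp k j (Nat.le_of_succ_le h)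

theorem fusionStage_zero {p : ℕ → Box m} (hp : Std n p) :
    ∀ (j : ℕ) (h : j ≤ n), fusionStage q hp 0 j h = phiProd q j h
  | 0, _ => rfl
  | j + 1, h => by
    rw [fusionStage, if_neg (Nat.not_lt_zero j), fusionStage_zero hp j, phiProd,
      phi_eq_phiGen fun i => fusionArgs_of_le (Nat.zero_le i)]

theorem hookProd_boxDiagram_zero {p : ℕ → Box m} (hs : IsLowerBoxes (boxShape p 0)) :
    hookProd q (boxDiagram hs) = 1 := by
  rw [hookProd]
  refine Finset.prod_eq_one fun c _ => Finset.prod_eq_one fun u _ => ?_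
  have : (boxDiagram hs c).cells = ∅ := by simp [boxDiagram, boxShape]
  rw [pairHookProd, this, Finset.prod_empty]

theorem fusionStage_of_le {p : ℕ → Box m} (hp : Std n p) {k j : ℕ} (hj : j ≤ n) (hjk : j ≤ k) :
    fusionStage q hp k j hj = const q (hookProd q (boxDiagram (hp.mono hj).isLower) •
      tabIdem q (jmSeq n q) p j) := by
  cases j with
  | zero => rw [fusionStage, hookProd_boxDiagram_zero, one_smul, tabIdem, map_one]
  | succ j => rw [fusionStage, if_pos (Nat.lt_of_succ_le hjk)]

theorem evaluatesTo_fusionStage [Nonempty (Fin m)] (hq : IsSeparated n q) {p : ℕ → Box m}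
    (hp : Std n p) (k : Fin n) (j : ℕ) (hj : j ≤ n) :
    EvaluatesTo q k (boxRes q (p k)) (fusionStage q hp k j hj)
      (fusionStage q hp (k + 1) j hj) := by
  induction j with
  | zero =>
    have := EvaluatesTo.const (k := k) (a := boxRes q (p k)) (1 : Hecke n q)
    rwa [map_one] at this
  | succ j ih =>
    rcases lt_trichotomy j k with h | rfl | h
    · rw [fusionStage_of_le hp hj h, fusionStage_of_le hp hj (by omega)]
      exact .const _
    · rw [fusionStage, if_neg (lt_irrefl _), fusionStage_of_le hp _ le_rfl,
        fusionStage_of_le hp hj le_rfl]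
      exact evaluatesTo_phiGen_mul_tabIdem hq k (hp.mono k.2) fun i hi => fusionArgs_of_lt hi
    · rw [fusionStage, if_neg h.not_gt, fusionStage, if_neg (by omega)]
      exact (evaluatesTo_phiGen p k (j := ⟨j, hj⟩) h le_rfl).mul (ih _)

/-- The consecutive evaluations of `Φ` at the residues of a standard sequence of boxes. -/
theorem consecutiveEval_Phi [Nonempty (Fin m)] (hq : IsSeparated n q) {p : ℕ → Box m}
    (hp : Std n p) (b : K) : ConsecutiveEval q (fun k => boxRes q (p k)) (b • Phi n q)
      (b • hookProd q (boxDiagram hp.isLower) • tabIdem q (jmSeq n q) p n) := by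
  refine ⟨fun k => const q (algebraMap K _ b) * fusionStage q hp k n le_rfl, ?_, fun k => ?_, ?_⟩
  · simp only [Fin.val_zero]
    rw [fusionStage_zero, AlgHom.commutes, ← Algebra.smul_def]
    rfl
  · exact (EvaluatesTo.const _).mul (evaluatesTo_fusionStage hq hp k n le_rfl)
  · simp only [Fin.val_last]
    rw [fusionStage_of_le hp le_rfl le_rfl, AlgHom.commutes, ← Algebra.smul_def, ← map_smul]

end FusionProcedure

/-! ### Standard tableaux as sequences of boxes -/

section Tableaux

variable {K : Type*} [Field K] {m n : ℕ} {lam : Multipartition m n}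

/-- The sequence of the nodes of a standard tableau, in the order of their entries; it is constant
from the index `n` on. -/
def StandardTableau.boxes (T : StandardTableau lam) (hn : 0 < n) (i : ℕ) : Box m :=
  if h : i < n then (T.entry.symm ⟨i, h⟩).1 else (T.entry.symm ⟨0, hn⟩).1

namespace StandardTableau

variable (T : StandardTableau lam) (hn : 0 < n)

theorem boxes_val (k : Fin n) : T.boxes hn k = (T.entry.symm k).1 := dif_pos k.2

theorem boxRes_boxes (q : Fin m → K) (k : Fin n) : boxRes q (T.boxes hn k) = T.res q k := by
  rw [boxes_val]; rfl

theorem boxes_entry (x : lam.Node) : T.boxes hn (T.entry x) = x.1 := by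
  rw [boxes_val, Equiv.symm_apply_apply]

theorem mem_boxShape_boxes (x : lam.Node) {k : ℕ} :
    x.1 ∈ boxShape (T.boxes hn) k ↔ (T.entry x : ℕ) < k := by
  rw [mem_boxShape]
  constructor
  · rintro ⟨i, hi, h⟩
    by_contra hk
    have h1 := T.boxes_val hn ⟨i, by omega⟩
    rw [h] at h1
    have h2 : T.entry x = ⟨i, by omega⟩ := by
      rw [← Equiv.eq_symm_apply]; exact Subtype.ext h1
    rw [h2] at hk
    exact hk hi
  · exact fun h => ⟨_, h, T.boxes_entry hn x⟩

theorem std_boxes : Std n (T.boxes hn) := by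
  intro i hi
  obtain ⟨x, hx⟩ := T.entry.surjective ⟨i, hi⟩
  have hxi : (T.entry x : ℕ) = i := congrArg Fin.val hx
  rw [show T.boxes hn i = x.1 by rw [← T.boxes_entry hn x, hxi]]
  obtain ⟨x, hxm⟩ := x
  refine ⟨fun h => ?_, ?_, ?_⟩
  · exact ((T.mem_boxShape_boxes hn ⟨x, hxm⟩).1 h).ne hxi
  · rintro a b c rfl
    have h := T.col_lt a (a + 1) b c ((lam.parts c).up_left_mem a.le_succ le_rfl hxm) hxm
      a.lt_succ_self
    exact (T.mem_boxShape_boxes hn ⟨(a, b, c), _⟩).2 ((Fin.lt_def.1 h).trans_eq hxi)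
  · rintro a b c rfl
    have h := T.row_lt a b (b + 1) c ((lam.parts c).up_left_mem le_rfl b.le_succ hxm) hxm
      b.lt_succ_self
    exact (T.mem_boxShape_boxes hn ⟨(a, b, c), _⟩).2 ((Fin.lt_def.1 h).trans_eq hxi)

theorem boxDiagram_boxes : boxDiagram (T.std_boxes hn).isLower = lam.parts := by
  funext c
  refine YoungDiagram.ext (Finset.ext ?_)
  rintro ⟨a, b⟩
  rw [YoungDiagram.mem_cells, YoungDiagram.mem_cells, mem_boxDiagram]
  constructor
  · intro h
    obtain ⟨i, hi, h⟩ := mem_boxShape.1 h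
    have h1 := (T.entry.symm ⟨i, hi⟩).2
    rw [← T.boxes_val hn, h] at h1
    exact h1
  · exact fun h => (T.mem_boxShape_boxes hn ⟨(a, b, c), h⟩).2 (Fin.is_lt _)

end StandardTableau

end Tableaux

end DegenerateCyclotomic

theorem mainTheorem1 {K : Type*} [Field K] {m n : ℕ} (hn : 0 < n) (q : Fin m → K)
    (hq : DegenerateCyclotomic.separation n q ≠ 0)
    (lam : DegenerateCyclotomic.Multipartition m n)
    (T : DegenerateCyclotomic.StandardTableau lam) :
    (∃! E : DegenerateCyclotomic.Hecke n q, DegenerateCyclotomic.IsTableauIdempotent q T E) ∧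
    ∀ E : DegenerateCyclotomic.Hecke n q, DegenerateCyclotomic.IsTableauIdempotent q T E →
      DegenerateCyclotomic.ConsecutiveEval q (T.res q)
        (DegenerateCyclotomic.theta q lam • DegenerateCyclotomic.Phi n q) E := by
  have hs := DegenerateCyclotomic.isSeparated_of_separation_ne_zero hq
  have : Nonempty (Fin m) := ⟨(T.entry.symm ⟨0, hn⟩).1.2.2⟩
  have hJ := DegenerateCyclotomic.isJucysMurphy_hecke q hn
  have hp := T.std_boxes hn
  have hprim := hJ.isPrimitiveIdempotent_tabIdem hs
    (DegenerateCyclotomic.heckeAlg_eq_top q hn) hp (DegenerateCyclotomic.tabIdem_ne_zero hn hs hp)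
  have hE : DegenerateCyclotomic.IsTableauIdempotent q T (DegenerateCyclotomic.tabIdem q
      (DegenerateCyclotomic.jmSeq n q) (T.boxes hn) n) := by
    refine ⟨hprim, fun k => ?_, fun k => ?_⟩
    · rw [← DegenerateCyclotomic.jmSeq_of_lt q k.2, ← T.boxRes_boxes hn]
      exact hJ.isWeight_tabIdem hs le_rfl hp k k.2
    · rw [← DegenerateCyclotomic.jmSeq_of_lt q k.2, ← T.boxRes_boxes hn]
      exact hJ.tabIdem_mul_jm hs le_rfl hp k.2
  have huniq : ∀ E, DegenerateCyclotomic.IsTableauIdempotent q T E →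
      E = DegenerateCyclotomic.tabIdem q (DegenerateCyclotomic.jmSeq n q) (T.boxes hn) n := by
    intro E h
    refine DegenerateCyclotomic.eq_tabIdem hs hp hprim h.primitive.1 h.primitive.2.1
      (fun i hi => ?_) fun i hi => ?_
    · rw [DegenerateCyclotomic.jmSeq_of_lt q hi]
      exact (h.jm_mul ⟨i, hi⟩).trans (by rw [← T.boxRes_boxes hn]; rfl)
    · rw [DegenerateCyclotomic.jmSeq_of_lt q hi]
      exact (h.mul_jm ⟨i, hi⟩).trans (by rw [← T.boxRes_boxes hn])
  refine ⟨⟨_, hE, huniq⟩, fun E h => ?_⟩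
  rw [huniq E h]
  have hfus := DegenerateCyclotomic.consecutiveEval_Phi hs hp (DegenerateCyclotomic.theta q lam)
  have h0 : DegenerateCyclotomic.hookProd q lam.parts ≠ 0 := by
    rw [← T.boxDiagram_boxes hn]
    exact hs.hookProd_ne_zero hp.isLower hp.card.le
  rw [T.boxDiagram_boxes hn, smul_smul, DegenerateCyclotomic.theta_eq, inv_mul_cancel₀ h0, one_smul,
    ← DegenerateCyclotomic.theta_eq] at hfus
  simpa only [T.boxRes_boxes hn] using hfus
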